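/- Let $T^2=\mathbb{R}^2/\mathbb{Z}^2$ be the torus, and let $\mathbb{RP}^2=S^2/(x\sim -x)$ be the real projective plane with the quotient topology. Given closed discs $D\subset X$ and $E\subset Y$ in two surfaces and a homeomorphism $h\colon\partial D\to\partial E$ of their boundary circles, the connected sum $X\# Y$ is the quotient space of the disjoint union of $X\setminus\mathrm{Int}(D)$ and $Y\setminus\mathrm{Int}(E)$ in which every $x\in\partial D$ is identified with $h(x)\in\partial E$. The discs used are tame, in the following sense. A disc in $T^2$ or $\mathbb{RP}^2$ is tame if some homeomorphism of the surface onto itself carries it to a round disc. A round disc in $T^2$ is the image of a closed Euclidean ball of radius $r\in(0,\tfrac12)$ in $\mathbb{R}^2$, and a round disc in $\mathbb{RP}^2$ is the image of a closed spherical cap $\{x\in S^2:\langle p,x\rangle\ge t\}$ with $p\in S^2$ and $0<t<1$. A disc in a connected sum $\mathbb{RP}^2\#\mathbb{RP}^2$ is tame if some homeomorphism of the sum onto itself carries it to a disc $A$ that is contained in one of the two summands, is disjoint from the disc $D$ removed from that summand, and is such that a single homeomorphism of that $\mathbb{RP}^2$ onto itself carries both $A$ and $D$ to round discs. **Proposition.**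 For every choice of tame discs and of gluing homeomorphisms in the connected sums involved, the connected sum $T^2\#\mathbb{RP}^2$ is homeomorphic to $\mathbb{RP}^2\#\mathbb{RP}^2\#\mathbb{RP}^2=(\mathbb{RP}^2\#\mathbb{RP}^2)\#\mathbb{RP}^2$. -/

import Mathlib

open Set Topology

namespace Surfaces

/-! ### The torus and the real projective plane -/

/-- The 2-torus `S¹ × S¹`, with `S¹ = ℝ / ℤ`. -/
abbrev Torus : Type := UnitAddCircle × UnitAddCircle

/-- The universal covering `ℝ² → T² = ℝ² / ℤ²` of the torus. -/
def torusProj (x : EuclideanSpace ℝ (Fin 2)) : Torus :=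
  ((x 0 : UnitAddCircle), (x 1 : UnitAddCircle))

/-- The unit sphere `S²` in Euclidean 3-space. -/
abbrev Sphere2 : Type := Metric.sphere (0 : EuclideanSpace ℝ (Fin 3)) 1

/-- The antipodal equivalence relation on `S²`. -/
def antipodalSetoid : Setoid Sphere2 where
  r x y := y = x ∨ y = -x
  iseqv :=
    { refl := fun _ => Or.inl rfl
      symm := by
        rintro x y (h | h)
        · exact Or.inl h.symm
        · exact Or.inr (by rw [h, neg_neg])
      trans := by
        rintro x y z (h | h) (h' | h')
        · exact Or.inl (h'.trans h)
        · exact Or.inr (by rw [h', h])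
        · exact Or.inr (by rw [h', h])
        · exact Or.inl (by rw [h', h, neg_neg]) }

/-- The real projective plane: the quotient of `S²` by the antipodal map, with the
quotient topology. -/
def RP2 : Type := Quotient antipodalSetoid

instance : TopologicalSpace RP2 := inferInstanceAs (TopologicalSpace (Quotient antipodalSetoid))

/-- The projection `S² → RP²`. -/
def rp2Proj (x : Sphere2) : RP2 := Quotient.mk antipodalSetoid x

/-! ### Connected sums -/

section ConnectedSum

variable {X Y : Type*} [TopologicalSpace X] [TopologicalSpace Y]

/-- A point of the boundary of `D`, as a point of the complement of the interior of `D`. -/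
def bdryPt (D : Set X) (x : frontier D) : ((interior D)ᶜ : Set X) :=
  ⟨x.1, x.2.2⟩

/-- The identification made in a connected sum: each `x ∈ ∂D` is glued to `h x ∈ ∂E`. -/
inductive GlueRel (D : Set X) (E : Set Y) (h : frontier D ≃ₜ frontier E) :
    ((interior D)ᶜ : Set X) ⊕ ((interior E)ᶜ : Set Y) →
    ((interior D)ᶜ : Set X) ⊕ ((interior E)ᶜ : Set Y) → Prop
  | glue (x : frontier D) : GlueRel D E h (Sum.inl (bdryPt D x)) (Sum.inr (bdryPt E (h x)))

/-- The connected sum `X # Y` formed with the discs `D ⊆ X` and `E ⊆ Y` and the gluing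
homeomorphism `h : ∂D → ∂E`: the quotient of the disjoint union of `X \ Int D` and
`Y \ Int E` by the equivalence relation generated by `x ∼ h x` for `x ∈ ∂D`, with the
quotient topology. -/
def ConnectedSum (D : Set X) (E : Set Y) (h : frontier D ≃ₜ frontier E) : Type _ :=
  Quot (GlueRel D E h)

instance (D : Set X) (E : Set Y) (h : frontier D ≃ₜ frontier E) :
    TopologicalSpace (ConnectedSum D E h) :=
  inferInstanceAs (TopologicalSpace (Quot (GlueRel D E h)))

/-- The canonical map from `X \ Int D` to the connected sum. -/
def ConnectedSum.inl (D : Set X) (E : Set Y) (h : frontier D ≃ₜ frontier E)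
    (x : ((interior D)ᶜ : Set X)) : ConnectedSum D E h :=
  Quot.mk _ (Sum.inl x)

/-- The canonical map from `Y \ Int E` to the connected sum. -/
def ConnectedSum.inr (D : Set X) (E : Set Y) (h : frontier D ≃ₜ frontier E)
    (y : ((interior E)ᶜ : Set Y)) : ConnectedSum D E h :=
  Quot.mk _ (Sum.inr y)

end ConnectedSum

/-! ### The discs along which connected sums are formed -/

/-- A round closed disc in the flat torus, of any centre and any radius below the
injectivity radius `1/2`. -/
def IsRoundTorus (D : Set Torus) : Prop :=
  ∃ (c : EuclideanSpace ℝ (Fin 2)) (r : ℝ), 0 < r ∧ r < 1 / 2 ∧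
    D = torusProj '' Metric.closedBall c r

/-- A round closed disc in `RP²`: the image of a closed spherical cap of any centre `p`
that is smaller than a hemisphere (so that it is mapped injectively to `RP²`). -/
def IsRoundRP2 (D : Set RP2) : Prop :=
  ∃ (p : Sphere2) (t : ℝ), 0 < t ∧ t < 1 ∧
    D = rp2Proj '' {x : Sphere2 | t ≤ inner ℝ (p : EuclideanSpace ℝ (Fin 3)) x}

section Discs

variable {X Y : Type*} [TopologicalSpace X] [TopologicalSpace Y]

/-- Given the model discs `R` of `X`, the set `D` is a tame (standardly embedded) disc if a
homeomorphism of `X` onto itself carries it to a model disc. -/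
def IsTameDisc (R : Set X → Prop) (D : Set X) : Prop :=
  ∃ f : X ≃ₜ X, R (f '' D)

/-- Two disjoint discs `A`, `D` that one homeomorphism of `X` onto itself carries to model
discs. -/
def IsTamePair (R : Set X → Prop) (A D : Set X) : Prop :=
  Disjoint A D ∧ ∃ f : X ≃ₜ X, R (f '' A) ∧ R (f '' D)

/-- The model discs of a connected sum `X # Y`: the discs contained in one of the two
summands and disjoint from the disc that was removed from it. -/
def IsModelDiscSum (R : Set X → Prop) (S : Set Y → Prop) (D : Set X) (E : Set Y)
    (h : frontier D ≃ₜ frontier E) (F : Set (ConnectedSum D E h)) : Prop :=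
  (∃ A : Set X, IsTamePair R A D ∧
    F = ConnectedSum.inl D E h '' {x | (x : X) ∈ A}) ∨
  (∃ B : Set Y, IsTamePair S B E ∧
    F = ConnectedSum.inr D E h '' {y | (y : Y) ∈ B})

end Discs

end Surfaces

/-! Both sums are the same closed disc with the same pattern of boundary identifications. On the
boundary circle mark two disjoint pairs of opposite arcs, around ±p and around ±q. Each pair is
identified by the reflection along its axis, and the four arcs between them are identified by the
antipodal map. This is `IsDiscModel`.

Summing with a projective plane along a disc means shrinking the disc and identifying antipodal
points of its new boundary, because a projective plane minus a disc is a cylinder with antipodal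
points identified at one end. The gluing map does not matter. A homeomorphism of the circle lifts to
a monotone map of the line, which a straight-line homotopy joins to x ↦ ±x, a map commuting with the
antipodal map. The homeomorphism therefore extends over the crosscap (`exists_level_extension`,
`exists_isCrosscap`, `exists_isAntipodalQuotient`).

For the torus, use the fundamental square with the removed disc at its vertices, and replace that
disc by a diamond. The square becomes an octagon. Opposite sides are matched by translations, which
on the boundary act as reflections in the axes. The cut corners are matched by the point reflection
about the centre of the diamond, which modulo the lattice is the antipodal map of the octagon
(`exists_torus_model`).

For three projective planes, start from one of them with discs around p and q removed, and view it
as a hemisphere whose pole is orthogonal to both p and q. In vertical projection the caps cut the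
unit disc along two pairs of parallel chords. The rest of the bounding circle keeps its antipodal
identification. The half-turn of a cap's boundary about its axis agrees in the projective plane with
a reflection, which exchanges the two parallel chords (`exists_rp2_model`).

Finally the pattern does not depend on the positions or lengths of the arcs. Piecewise linear
parametrizations give a circle homeomorphism between any two admissible patterns, and it extends
radially to the disc (`IsAdmissible.exists_isArcParam`, `exists_circle_homeo`). -/

namespace Surfaces

open unitInterval ComplexConjugate

/-! ### Quotients of compact spaces -/

section General

variable {W Z Z' : Type*} [TopologicalSpace W] [TopologicalSpace Z] [TopologicalSpace Z']

/-- Two Hausdorff images of a compact space under maps with the same fibres are homeomorphic. -/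
theorem nonempty_homeomorph_of_same_fibres [CompactSpace W] [T2Space Z] [T2Space Z']
    {f : W → Z} {g : W → Z'} (hf : Continuous f) (hg : Continuous g)
    (hfs : Function.Surjective f) (hgs : Function.Surjective g)
    (hfg : ∀ a b, f a = f b ↔ g a = g b) :
    ∃ Φ : Z ≃ₜ Z', ∀ a, Φ (f a) = g a := by
  have qf := IsQuotientMap.of_surjective_continuous hfs hf
  have qg := IsQuotientMap.of_surjective_continuous hgs hg
  let F : Z → Z' := fun z => g (Function.surjInv hfs z)
  let G : Z' → Z := fun z => f (Function.surjInv hgs z)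
  have hF : ∀ a, F (f a) = g a := fun a => (hfg _ _).1 (Function.surjInv_eq hfs (f a))
  have hG : ∀ a, G (g a) = f a := fun a => (hfg _ _).2 (Function.surjInv_eq hgs (g a))
  have cF : Continuous F := qf.continuous_iff.2 (by convert hg using 1; ext a; exact hF a)
  have cG : Continuous G := qg.continuous_iff.2 (by convert hf using 1; ext a; exact hG a)
  refine ⟨⟨⟨F, G, ?_, ?_⟩, cF, cG⟩, hF⟩
  · intro z
    obtain ⟨a, rfl⟩ := hfs z
    rw [hF, hG]
  · intro z
    obtain ⟨a, rfl⟩ := hgs z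
    rw [hG, hF]

/-- A quotient of a compact Hausdorff space by a closed equivalence relation is Hausdorff. -/
theorem t2Space_of_isClosed_ker [CompactSpace W] [T2Space W] {f : W → Z} (hf : IsQuotientMap f)
    (hR : IsClosed {p : W × W | f p.1 = f p.2}) : T2Space Z := by
  have hcl : IsClosedMap f := by
    intro C hC
    rw [← hf.isClosed_preimage]
    -- The saturation of a closed set is a projection of a closed subset of the compact square, so
    -- `f` is a closed map.
    have : f ⁻¹' (f '' C) = Prod.snd '' ({p : W × W | f p.1 = f p.2} ∩ Prod.fst ⁻¹' C) := by
      ext x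
      constructor
      · rintro ⟨y, hy, hxy⟩
        exact ⟨(y, x), ⟨hxy, hy⟩, rfl⟩
      · rintro ⟨⟨y, x'⟩, ⟨h1, h2⟩, rfl⟩
        exact ⟨y, h2, h1⟩
    rw [this]
    exact ((hR.inter (hC.preimage continuous_fst)).isCompact.image continuous_snd).isClosed
  have hpt : ∀ y : Z, IsClosed ({y} : Set Z) := by
    intro y
    obtain ⟨x, rfl⟩ := hf.surjective y
    simpa using hcl _ (isClosed_singleton (x := x))
  refine ⟨fun y y' hne => ?_⟩
  have hd : Disjoint (f ⁻¹' {y}) (f ⁻¹' {y'}) := by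
    rw [Set.disjoint_left]
    rintro x hx hx'
    exact hne (hx.symm.trans hx')
  obtain ⟨U, V, hU, hV, hyU, hyV, hUV⟩ := normal_separation ((hpt y).preimage hf.continuous)
    ((hpt y').preimage hf.continuous) hd
  -- The complement of `f '' Uᶜ` consists of the points whose whole fibre lies in `U`.
  refine ⟨(f '' Uᶜ)ᶜ, (f '' Vᶜ)ᶜ, (hcl _ hU.isClosed_compl).isOpen_compl,
    (hcl _ hV.isClosed_compl).isOpen_compl, ?_, ?_, ?_⟩
  · rintro ⟨x, hx, rfl⟩
    exact hx (hyU rfl)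
  · rintro ⟨x, hx, rfl⟩
    exact hx (hyV rfl)
  · rw [Set.disjoint_left]
    intro z hz hz'
    obtain ⟨x, rfl⟩ := hf.surjective z
    have h1 : x ∈ U := by
      by_contra h
      exact hz ⟨x, h, rfl⟩
    have h2 : x ∈ V := by
      by_contra h
      exact hz' ⟨x, h, rfl⟩
    exact Set.disjoint_left.1 hUV h1 h2

end General

/-! ### Point-set topology of connected sums -/

namespace ConnectedSum

variable {X Y : Type*} [TopologicalSpace X] [TopologicalSpace Y]
  (D : Set X) (E : Set Y) (h : frontier D ≃ₜ frontier E)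

theorem continuous_inl : Continuous (inl D E h) := continuous_quot_mk.comp _root_.continuous_inl

theorem continuous_inr : Continuous (inr D E h) := continuous_quot_mk.comp _root_.continuous_inr

theorem continuous_bdryPt : Continuous (bdryPt D) :=
  Continuous.subtype_mk continuous_subtype_val _

theorem bdryPt_injective : Function.Injective (bdryPt D) := by
  rintro ⟨x, hx⟩ ⟨y, hy⟩ hxy
  simpa [bdryPt] using hxy

theorem glue (x : frontier D) : inl D E h (bdryPt D x) = inr D E h (bdryPt E (h x)) :=
  Quot.sound (GlueRel.glue x)

open Classical in
/-- A normal form for points of the connected sum: boundary points are taken on the right. -/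
noncomputable def normalForm :
    ((interior D)ᶜ : Set X) ⊕ ((interior E)ᶜ : Set Y) →
      ((interior D)ᶜ : Set X) ⊕ ((interior E)ᶜ : Set Y)
  | Sum.inl x => if hx : (x : X) ∈ frontier D then Sum.inr (bdryPt E (h ⟨x, hx⟩)) else Sum.inl x
  | Sum.inr y => Sum.inr y

theorem mk_normalForm (a : ((interior D)ᶜ : Set X) ⊕ ((interior E)ᶜ : Set Y)) :
    Quot.mk (GlueRel D E h) (normalForm D E h a) = Quot.mk (GlueRel D E h) a := by
  rcases a with x | y
  · simp only [normalForm]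
    split_ifs with hx
    · exact (glue D E h ⟨x, hx⟩).symm
    · rfl
  · rfl

/-- The normal form is constant along each generating identification, and every point has the same
class as its normal form. This makes the generated equivalence relation computable. -/
theorem mk_eq_mk_iff (a b : ((interior D)ᶜ : Set X) ⊕ ((interior E)ᶜ : Set Y)) :
    Quot.mk (GlueRel D E h) a = Quot.mk (GlueRel D E h) b ↔
      normalForm D E h a = normalForm D E h b := by
  constructor
  · intro hab
    have key : ∀ a b, GlueRel D E h a b → normalForm D E h a = normalForm D E h b := by
      rintro _ _ ⟨x⟩
      have : ((bdryPt D x : ((interior D)ᶜ : Set X)) : X) ∈ frontier D := x.2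
      simp only [normalForm, dif_pos this]
      rfl
    exact congrArg (Quot.lift (normalForm D E h) key) hab
  · intro hab
    rw [← mk_normalForm D E h a, hab, mk_normalForm]

theorem inr_injective : Function.Injective (inr D E h) := by
  intro x y hxy
  exact Sum.inr_injective ((mk_eq_mk_iff D E h _ _).1 hxy)

theorem inl_injective : Function.Injective (inl D E h) := by
  intro x y hxy
  have := (mk_eq_mk_iff D E h _ _).1 hxy
  simp only [normalForm] at this
  split_ifs at this with h1 h2 h2
  · have h0 := Sum.inr_injective this
    simpa [Subtype.ext_iff] using h.injective (bdryPt_injective E h0)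
  · exact Sum.inl_injective this

theorem inl_eq_inr_iff (x : ((interior D)ᶜ : Set X)) (y : ((interior E)ᶜ : Set Y)) :
    inl D E h x = inr D E h y ↔ ∃ z : frontier D, bdryPt D z = x ∧ bdryPt E (h z) = y := by
  constructor
  · intro hxy
    have := (mk_eq_mk_iff D E h _ _).1 hxy
    simp only [normalForm] at this
    split_ifs at this with h1
    exact ⟨⟨x, h1⟩, rfl, Sum.inr_injective this⟩
  · rintro ⟨z, rfl, rfl⟩
    exact glue D E h z

theorem exists_rep (a : ConnectedSum D E h) : (∃ x, inl D E h x = a) ∨ ∃ y, inr D E h y = a := by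
  obtain ⟨x | y, rfl⟩ := Quot.exists_rep a
  · exact Or.inl ⟨x, rfl⟩
  · exact Or.inr ⟨y, rfl⟩

instance [CompactSpace X] [CompactSpace Y] : CompactSpace (ConnectedSum D E h) := by
  have : CompactSpace ((interior D)ᶜ : Set X) :=
    isCompact_iff_compactSpace.1 isOpen_interior.isClosed_compl.isCompact
  have : CompactSpace ((interior E)ᶜ : Set Y) :=
    isCompact_iff_compactSpace.1 isOpen_interior.isClosed_compl.isCompact
  exact inferInstanceAs (CompactSpace (Quot (GlueRel D E h)))

instance [CompactSpace X] [CompactSpace Y] [T2Space X] [T2Space Y] :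
    T2Space (ConnectedSum D E h) := by
  have : CompactSpace ((interior D)ᶜ : Set X) :=
    isCompact_iff_compactSpace.1 isOpen_interior.isClosed_compl.isCompact
  have : CompactSpace ((interior E)ᶜ : Set Y) :=
    isCompact_iff_compactSpace.1 isOpen_interior.isClosed_compl.isCompact
  have : CompactSpace (frontier D) := isCompact_iff_compactSpace.1 isClosed_frontier.isCompact
  refine t2Space_of_isClosed_ker (f := Quot.mk (GlueRel D E h)) isQuotientMap_quot_mk ?_
  -- The equivalence relation is the diagonal together with the graph of the gluing and its
  -- transpose. Both graphs are images of the compact frontier, so the relation is closed.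
  let γ : frontier D → (((interior D)ᶜ : Set X) ⊕ ((interior E)ᶜ : Set Y)) ×
    (((interior D)ᶜ : Set X) ⊕ ((interior E)ᶜ : Set Y)) :=
      fun z => (Sum.inl (bdryPt D z), Sum.inr (bdryPt E (h z)))
  have hγ : Continuous γ := (_root_.continuous_inl.comp (continuous_bdryPt D)).prodMk
    (_root_.continuous_inr.comp ((continuous_bdryPt E).comp h.continuous))
  have hγ' : Continuous fun z => (γ z).swap := continuous_swap.comp hγ
  have : {p : (((interior D)ᶜ : Set X) ⊕ ((interior E)ᶜ : Set Y)) ×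
      (((interior D)ᶜ : Set X) ⊕ ((interior E)ᶜ : Set Y)) |
      Quot.mk (GlueRel D E h) p.1 = Quot.mk (GlueRel D E h) p.2} =
      diagonal _ ∪ range γ ∪ range (fun z => (γ z).swap) := by
    ext ⟨a, b⟩
    simp only [mem_ofPred_eq, mem_union, mem_diagonal_iff, mem_range, γ, Prod.swap_prod_mk,
      Prod.mk.injEq]
    rcases a with x | y <;> rcases b with x' | y'
    · simp only [Sum.inl.injEq, reduceCtorEq, and_false, false_and, exists_false, or_false]
      exact (inl_injective D E h).eq_iff
    · simp only [Sum.inl.injEq, reduceCtorEq, and_false, exists_false, or_false,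
        Sum.inr.injEq, false_or]
      exact inl_eq_inr_iff D E h x y'
    · simp only [Sum.inl.injEq, reduceCtorEq, and_false, exists_false, or_false,
        Sum.inr.injEq, false_or]
      rw [eq_comm]
      refine (inl_eq_inr_iff D E h x' y).trans ?_
      simp only [and_comm]
    · simp only [Sum.inr.injEq, reduceCtorEq, and_false, false_and, exists_false, or_false]
      exact (inr_injective D E h).eq_iff
  have hcl := (isClosed_diagonal.union (isCompact_range hγ).isClosed).union
    (isCompact_range hγ').isClosed
  rw [← this] at hcl
  exact hcl

/-- Homeomorphisms of the summands carry connected sums to connected sums. -/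
theorem exists_congr {X' Y' : Type*} [TopologicalSpace X'] [TopologicalSpace Y']
    (φ : X ≃ₜ X') (ψ : Y ≃ₜ Y') :
    ∃ (h' : frontier (φ '' D) ≃ₜ frontier (ψ '' E))
      (Φ : ConnectedSum D E h ≃ₜ ConnectedSum (φ '' D) (ψ '' E) h'),
      ∀ (x : ((interior D)ᶜ : Set X)) (x' : ((interior (φ '' D))ᶜ : Set X')), φ x = x' →
        Φ (inl D E h x) = inl _ _ h' x' := by
  let a : frontier D ≃ₜ frontier (φ '' D) :=
    (φ.image (frontier D)).trans (Homeomorph.setCongr (φ.image_frontier D))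
  let b : frontier E ≃ₜ frontier (ψ '' E) :=
    (ψ.image (frontier E)).trans (Homeomorph.setCongr (ψ.image_frontier E))
  have hA : φ '' (interior D)ᶜ = (interior (φ '' D))ᶜ := by
    rw [← φ.image_interior, Set.image_compl_eq φ.bijective]
  have hB : ψ '' (interior E)ᶜ = (interior (ψ '' E))ᶜ := by
    rw [← ψ.image_interior, Set.image_compl_eq ψ.bijective]
  let A : ((interior D)ᶜ : Set X) ≃ₜ ((interior (φ '' D))ᶜ : Set X') :=
    (φ.image _).trans (Homeomorph.setCongr hA)
  let B : ((interior E)ᶜ : Set Y) ≃ₜ ((interior (ψ '' E))ᶜ : Set Y') :=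
    (ψ.image _).trans (Homeomorph.setCongr hB)
  let h' := (a.symm.trans h).trans b
  let e := A.sumCongr B
  have key : ∀ p q, GlueRel D E h p q ↔ GlueRel _ _ h' (e p) (e q) := by
    intro p q
    constructor
    · rintro ⟨x⟩
      have h1 : e (Sum.inl (bdryPt D x)) = Sum.inl (bdryPt _ (a x)) := rfl
      have h2 : e (Sum.inr (bdryPt E (h x))) = Sum.inr (bdryPt _ (h' (a x))) := by
        have : h' (a x) = b (h x) := by simp [h']
        rw [this]
        rfl
      rw [h1, h2]
      exact GlueRel.glue _
    · generalize hp : e p = p'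
      generalize hq : e q = q'
      rintro ⟨x⟩
      obtain ⟨x, rfl⟩ := a.surjective x
      have h1 : e (Sum.inl (bdryPt D x)) = Sum.inl (bdryPt _ (a x)) := rfl
      have h2 : e (Sum.inr (bdryPt E (h x))) = Sum.inr (bdryPt _ (h' (a x))) := by
        have : h' (a x) = b (h x) := by simp [h']
        rw [this]
        rfl
      rw [← h1] at hp
      rw [← h2] at hq
      rw [e.injective hp, e.injective hq]
      exact GlueRel.glue _
  let Φ : ConnectedSum D E h ≃ₜ ConnectedSum (φ '' D) (ψ '' E) h' :=
    { toEquiv := Quot.congr e.toEquiv key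
      continuous_toFun := continuous_quot_lift _ (continuous_quot_mk.comp e.continuous)
      continuous_invFun := continuous_quot_lift _ (continuous_quot_mk.comp e.symm.continuous) }
  refine ⟨h', Φ, fun x x' hx => ?_⟩
  have : A x = x' := Subtype.ext hx
  rw [← this]
  rfl

/-- Exchange of the two summands. -/
def swapMap : ConnectedSum D E h → ConnectedSum E D h.symm :=
  Quot.lift (Sum.elim (inr E D h.symm) (inl E D h.symm)) (by
    rintro _ _ ⟨x⟩
    have := glue E D h.symm (h x)
    rw [h.symm_apply_apply] at this
    exact this.symm)

theorem continuous_swapMap : Continuous (swapMap D E h) :=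
  continuous_quot_lift _ ((continuous_inr E D h.symm).sumElim (continuous_inl E D h.symm))

theorem swapMap_swapMap (a : ConnectedSum D E h) : swapMap E D h.symm (swapMap D E h a) = a := by
  obtain ⟨x | y, rfl⟩ := Quot.exists_rep a <;> rfl

/-- Connected sums are symmetric. -/
def swap : ConnectedSum D E h ≃ₜ ConnectedSum E D h.symm where
  toFun := swapMap D E h
  invFun := swapMap E D h.symm
  left_inv := swapMap_swapMap D E h
  right_inv := swapMap_swapMap E D h.symm
  continuous_toFun := continuous_swapMap D E h
  continuous_invFun := continuous_swapMap E D h.symm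

end ConnectedSum

/-! ### Lifting circle maps to the line -/

theorem exp_pi_eq : Circle.exp Real.pi = -1 := by
  ext
  simp

theorem exp_add_pi (x : ℝ) : Circle.exp (x + Real.pi) = -Circle.exp x := by
  rw [Circle.exp_add, exp_pi_eq, mul_neg_one]

theorem exp_isOpenQuotientMap : IsOpenQuotientMap (Circle.exp : ℝ → Circle) :=
  ⟨Circle.exp_surjective, Circle.exp.continuous, isLocalHomeomorph_circleExp.isOpenMap⟩

/-- Continuous self-maps of the circle lift to the line. -/
theorem exists_circle_lift {φ : Circle → Circle} (hφ : Continuous φ) :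
    ∃ f : ℝ → ℝ, Continuous f ∧ ∀ x, Circle.exp (f x) = φ (Circle.exp x) := by
  obtain ⟨y, hy⟩ := Circle.exp_surjective (φ (Circle.exp 0))
  obtain ⟨F, ⟨_, hF⟩, _⟩ := Circle.isCoveringMap_exp.existsUnique_continuousMap_lifts
    (⟨fun x => φ (Circle.exp x), hφ.comp Circle.exp.continuous⟩ : C(ℝ, Circle)) 0 y hy
  exact ⟨F, F.continuous, fun x => congrFun hF x⟩

/-- Uniqueness of lifts through the covering `Circle.exp`: the integer is determined at `0`, and the
two lifts then agree everywhere. -/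
theorem lift_eq_add {f g : ℝ → ℝ} (hf : Continuous f) (hg : Continuous g)
    (h : ∀ x, Circle.exp (f x) = Circle.exp (g x)) :
    ∃ m : ℤ, ∀ x, f x = g x + m * (2 * Real.pi) := by
  obtain ⟨m, hm⟩ := Circle.exp_eq_exp.1 (h 0)
  refine ⟨m, fun x => ?_⟩
  have := Circle.isCoveringMap_exp.eq_of_comp_eq (g₁ := f)
    (g₂ := fun x => g x + m * (2 * Real.pi)) hf (by fun_prop) (by
      ext x
      simp only [Function.comp_apply]
      rw [h x, Circle.exp_add, Circle.exp_int_mul_two_pi, mul_one]) 0 hm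
  exact congrFun this x

theorem lift_add_int_mul {f : ℝ → ℝ} {n : ℤ} (hn : ∀ x, f (x + 2 * Real.pi) = f x + n * (2 * Real.pi))
    (k : ℤ) (x : ℝ) : f (x + k * (2 * Real.pi)) = f x + k * n * (2 * Real.pi) := by
  induction k using Int.induction_on generalizing x with
  | zero => simp
  | succ k ih =>
    have h := ih (x + 2 * Real.pi)
    rw [hn] at h
    push_cast at h ⊢
    rw [show x + ((k : ℝ) + 1) * (2 * Real.pi) = x + 2 * Real.pi + k * (2 * Real.pi) by ring, h]
    ring
  | pred k ih =>
    have h := ih (x - 2 * Real.pi)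
    have h2 := hn (x - 2 * Real.pi)
    rw [sub_add_cancel] at h2
    push_cast at h ⊢
    rw [show x + (-(k : ℝ) - 1) * (2 * Real.pi) = x - 2 * Real.pi + -k * (2 * Real.pi) by ring, h,
      h2]
    ring

/-- A homeomorphism of the circle lifts to a map of the line which is, up to a sign,
strictly increasing and of degree one. -/
theorem exists_monotone_lift (φ : Circle ≃ₜ Circle) :
    ∃ (f : ℝ → ℝ) (n : ℤ), (n = 1 ∨ n = -1) ∧ Continuous f ∧
      (∀ x, Circle.exp (f x) = φ (Circle.exp x)) ∧
      (∀ x, f (x + 2 * Real.pi) = f x + n * (2 * Real.pi)) ∧ StrictMono fun x => n * f x := by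
  obtain ⟨f, hf, hfφ⟩ := exists_circle_lift φ.continuous
  obtain ⟨g, hg, hgφ⟩ := exists_circle_lift φ.symm.continuous
  obtain ⟨n, hn⟩ := lift_eq_add (f := fun x => f (x + 2 * Real.pi)) (g := f) (by fun_prop) hf
    (fun x => by rw [hfφ, hfφ, Circle.exp_add_two_pi])
  obtain ⟨m, hm⟩ := lift_eq_add (f := fun x => g (x + 2 * Real.pi)) (g := g) (by fun_prop) hg
    (fun x => by rw [hgφ, hgφ, Circle.exp_add_two_pi])
  obtain ⟨c, hc⟩ := lift_eq_add (f := fun x => g (f x)) (g := fun x => x) (by fun_prop)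
    continuous_id (fun x => by rw [hgφ, hfφ, φ.symm_apply_apply])
  -- Degrees are multiplicative: moving `x` through one period moves `g (f x)` through `n * m`
  -- periods, while `g ∘ f` is a translation.
  have hnm : n * m = 1 := by
    have h1 := hc (0 + 2 * Real.pi)
    have h2 := hc 0
    rw [hn, lift_add_int_mul hm] at h1
    have h3 : ((n : ℝ) * m - 1) * (2 * Real.pi) = 0 := by linear_combination h1 - h2
    have h4 : (n : ℝ) * m - 1 = 0 := by
      rcases mul_eq_zero.1 h3 with h | h
      · exact h
      · exact absurd h Real.two_pi_pos.ne'
    exact_mod_cast sub_eq_zero.1 h4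
  have hn1 : n = 1 ∨ n = -1 := Int.eq_one_or_neg_one_of_mul_eq_one hnm
  have hnn : (n : ℝ) * n = 1 := by rcases hn1 with rfl | rfl <;> norm_num
  have hinj : Function.Injective fun x => (n : ℝ) * f x := by
    intro x y hxy
    have h0 : f x = f y := by
      have := congrArg (fun u => (n : ℝ) * u) hxy
      simpa only [← mul_assoc, hnn, one_mul] using this
    have h1 := hc x
    have h2 := hc y
    rw [h0, h2] at h1
    linarith
  refine ⟨f, n, hn1, hf, hfφ, hn, ?_⟩
  have hcont : Continuous fun x => (n : ℝ) * f x := by fun_prop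
  rcases hcont.strictMono_of_inj hinj with h | h
  · exact h
  -- A strictly decreasing `n * f` is impossible, since one period increases it by `n * n * 2π =
  -- 2π`.
  · exfalso
    have h1 := h (show (0 : ℝ) < 0 + 2 * Real.pi by simpa using Real.pi_pos)
    simp only at h1
    rw [hn, mul_add, ← mul_assoc, hnn] at h1
    linarith [Real.pi_pos]

/-- Every homeomorphism `φ` of the circle extends to a level-preserving homeomorphism of
`S¹ × [0,1]` (with `φ` at level `1`) which commutes with the antipodal map at level `0`. -/
theorem exists_level_extension (φ : Circle ≃ₜ Circle) :
    ∃ H : Circle × I → Circle, Continuous H ∧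
      (∀ s, Function.Bijective fun z => H (z, s)) ∧ (∀ z, H (z, 1) = φ z) ∧
      ∀ z, H (-z, 0) = -H (z, 0) := by
  obtain ⟨f, n, hn1, hf, hfφ, hn, hmono⟩ := exists_monotone_lift φ
  have hnn : (n : ℝ) * n = 1 := by rcases hn1 with rfl | rfl <;> norm_num
  -- The straight-line homotopy from `n * x` to `f`. Both ends have degree `n`, and both become
  -- increasing after multiplication by `n`, so every stage has these properties too.
  let F : ℝ → I → ℝ := fun x s => s * f x + (1 - s) * (n * x)
  have hFper : ∀ (k : ℤ) x s, F (x + k * (2 * Real.pi)) s = F x s + k * n * (2 * Real.pi) := by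
    intro k x s
    simp only [F, lift_add_int_mul hn]
    ring
  have hFmono : ∀ s, StrictMono fun x => n * F x s := by
    intro s x y hxy
    have h1 := hmono hxy
    simp only at h1
    have e : ∀ x, n * F x s = s * (n * f x) + (1 - s) * x := by
      intro x
      simp only [F]
      linear_combination (1 - (s : ℝ)) * x * hnn
    simp only [e]
    have hs0 := s.2.1
    have hs1 := s.2.2
    rcases hs0.eq_or_lt with h | h
    · rw [← h]; linarith
    · nlinarith
  have hFcont : ∀ s, Continuous fun x => F x s := by
    intro s
    simp only [F]
    fun_prop
  -- The jump of `arg` does no harm: `hFper` makes the value independent of the chosen angle, and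
  -- continuity is checked on the line through the quotient map `Circle.exp`.
  let H : Circle × I → Circle := fun p => Circle.exp (F (Complex.arg p.1) p.2)
  have hH : ∀ x s, H (Circle.exp x, s) = Circle.exp (F x s) := by
    intro x s
    obtain ⟨k, hk⟩ := Circle.exp_eq_exp.1 (Circle.exp_arg (Circle.exp x))
    simp only [H]
    rw [hk, hFper, Circle.exp_add]
    have := Circle.exp_int_mul_two_pi (k * n)
    push_cast at this
    rw [this, mul_one]
  refine ⟨H, ?_, fun s => ⟨?_, ?_⟩, ?_, ?_⟩
  · have q := (exp_isOpenQuotientMap.prodMap (IsOpenQuotientMap.id (X := I))).isQuotientMap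
    refine q.continuous_iff.2 ?_
    have : H ∘ Prod.map (Circle.exp : ℝ → Circle) id = fun p : ℝ × I => Circle.exp (F p.1 p.2) := by
      ext1 ⟨x, s⟩
      exact hH x s
    rw [this]
    refine Circle.exp.continuous.comp ?_
    simp only [F]
    fun_prop
  · intro z w hzw
    obtain ⟨x, rfl⟩ := Circle.exp_surjective z
    obtain ⟨y, rfl⟩ := Circle.exp_surjective w
    simp only [hH] at hzw
    obtain ⟨k, hk⟩ := Circle.exp_eq_exp.1 hzw
    have h1 : F x s = F (y + (k * n : ℤ) * (2 * Real.pi)) s := by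
      rw [hFper, hk]
      push_cast
      linear_combination -(k * 2 * Real.pi) * hnn
    have h2 : x = y + (k * n : ℤ) * (2 * Real.pi) := (hFmono s).injective (by rw [h1])
    rw [h2, Circle.exp_add, Circle.exp_int_mul_two_pi, mul_one]
  · intro w
    obtain ⟨y, rfl⟩ := Circle.exp_surjective w
    obtain ⟨k, hk⟩ := exists_nat_ge (|y - F 0 s| / (2 * Real.pi))
    rw [div_le_iff₀ Real.two_pi_pos] at hk
    have ha := abs_le.1 hk
    have e1 := hFper (n * k) 0 s
    have e2 := hFper (-(n * k)) 0 s
    push_cast at e1 e2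
    have hk1 : ((n : ℝ) * k) * n = k := by linear_combination (k : ℝ) * hnn
    have hk2 : (-((n : ℝ) * k)) * n = -k := by linear_combination (-k : ℝ) * hnn
    rw [hk1] at e1
    rw [hk2] at e2
    -- Moving `k` periods either way changes `F` by `2πk` in absolute value, which brackets `y`; the
    -- intermediate value theorem then applies.
    obtain ⟨x, hx⟩ := mem_range_of_exists_le_of_exists_ge (hFcont s) (c := y)
      ⟨_, by rw [e2]; linarith⟩ ⟨_, by rw [e1]; linarith⟩
    exact ⟨Circle.exp x, by simp only [hH]; rw [← hx]⟩
  · intro z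
    obtain ⟨x, rfl⟩ := Circle.exp_surjective z
    rw [hH, ← hfφ]
    simp [F]
  · intro z
    obtain ⟨x, rfl⟩ := Circle.exp_surjective z
    rw [← exp_add_pi, hH, hH]
    simp only [F]
    rcases hn1 with rfl | rfl
    · rw [← exp_add_pi]
      simp
    · rw [← exp_add_pi, ← Circle.exp_add_two_pi]
      congr 1
      simp
      ring

/-! ### Points of the projective plane -/

theorem rp2Proj_eq_iff (x y : Sphere2) : rp2Proj x = rp2Proj y ↔ y = x ∨ y = -x := by
  unfold rp2Proj
  exact Quotient.eq (r := antipodalSetoid)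

theorem continuous_rp2Proj : Continuous rp2Proj := continuous_quot_mk

theorem rp2Proj_surjective : Function.Surjective rp2Proj := Quotient.mk_surjective

theorem isQuotientMap_rp2Proj : IsQuotientMap rp2Proj := isQuotientMap_quot_mk

theorem rp2Proj_neg (x : Sphere2) : rp2Proj (-x) = rp2Proj x :=
  (rp2Proj_eq_iff _ _).2 (Or.inr (neg_neg x).symm)

instance : CompactSpace RP2 := inferInstanceAs (CompactSpace (Quotient antipodalSetoid))

instance : T2Space RP2 := by
  refine t2Space_of_isClosed_ker isQuotientMap_rp2Proj ?_
  have : {p : Sphere2 × Sphere2 | rp2Proj p.1 = rp2Proj p.2} =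
      {p | p.2 = p.1} ∪ {p | p.2 = -p.1} := by
    ext p
    exact rp2Proj_eq_iff p.1 p.2
  rw [this]
  exact (isClosed_eq continuous_snd continuous_fst).union
    (isClosed_eq continuous_snd continuous_fst.neg)

/-- The absolute value of the component along `p` of a point of the projective plane. -/
noncomputable def absInner (p : EuclideanSpace ℝ (Fin 3)) : RP2 → ℝ :=
  Quotient.lift (fun x : Sphere2 => |inner ℝ p (x : EuclideanSpace ℝ (Fin 3))|) (by
    rintro x y (h | h)
    · rw [h]
    · rw [h]; simp)

theorem absInner_rp2Proj (p : EuclideanSpace ℝ (Fin 3)) (x : Sphere2) :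
    absInner p (rp2Proj x) = |inner ℝ p (x : EuclideanSpace ℝ (Fin 3))| := rfl

theorem continuous_absInner (p : EuclideanSpace ℝ (Fin 3)) : Continuous (absInner p) :=
  continuous_quot_lift _ (by fun_prop)

/-- A representative can be replaced by its antipode, which makes its component along `p`
nonnegative. From here on caps are superlevel sets of a continuous function on the quotient. -/
theorem image_cap_eq (p : EuclideanSpace ℝ (Fin 3)) (t : ℝ) :
    rp2Proj '' {x : Sphere2 | t ≤ inner ℝ p (x : EuclideanSpace ℝ (Fin 3))} =
      {x | t ≤ absInner p x} := by
  ext x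
  obtain ⟨X, rfl⟩ := rp2Proj_surjective x
  simp only [mem_image, mem_ofPred_eq, absInner_rp2Proj]
  constructor
  · rintro ⟨Y, hY, hYX⟩
    rcases (rp2Proj_eq_iff _ _).1 hYX with rfl | rfl
    · exact hY.trans (le_abs_self _)
    · simpa using hY.trans (le_abs_self _)
  · intro h
    rcases le_abs.1 h with h | h
    · exact ⟨X, h, rfl⟩
    · exact ⟨-X, by simpa using h, rp2Proj_neg X⟩

/-! ### Cap coordinates -/

section Cap

variable (b : OrthonormalBasis (Fin 3) ℝ (EuclideanSpace ℝ (Fin 3)))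

/-- The vector of height `h` over the direction `ζ`, in an orthonormal frame. -/
noncomputable def capVec (ζ : Circle) (h : ℝ) : EuclideanSpace ℝ (Fin 3) :=
  √(1 - h ^ 2) • ((ζ : ℂ).re • b 0 + (ζ : ℂ).im • b 1) + h • b 2

theorem inner_capVec_zero (ζ : Circle) (h : ℝ) :
    inner ℝ (b 0) (capVec b ζ h) = √(1 - h ^ 2) * (ζ : ℂ).re := by
  simp [capVec, inner_add_right, inner_smul_right]

theorem inner_capVec_one (ζ : Circle) (h : ℝ) :
    inner ℝ (b 1) (capVec b ζ h) = √(1 - h ^ 2) * (ζ : ℂ).im := by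
  simp [capVec, inner_add_right, inner_smul_right]

theorem inner_capVec_two (ζ : Circle) (h : ℝ) : inner ℝ (b 2) (capVec b ζ h) = h := by
  simp [capVec, inner_add_right, inner_smul_right]

theorem norm_sq_eq_sum (x : EuclideanSpace ℝ (Fin 3)) :
    ‖x‖ ^ 2 = inner ℝ (b 0) x ^ 2 + inner ℝ (b 1) x ^ 2 + inner ℝ (b 2) x ^ 2 := by
  rw [← b.sum_sq_norm_inner_right x, Fin.sum_univ_three]
  simp

theorem circle_sq_add_sq (ζ : Circle) : (ζ : ℂ).re ^ 2 + (ζ : ℂ).im ^ 2 = 1 := by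
  have := Circle.normSq_coe ζ
  rw [Complex.normSq_apply] at this
  linarith

theorem exists_circle_of_sq {u v : ℝ} (h : u ^ 2 + v ^ 2 = 1) :
    ∃ ζ : Circle, (ζ : ℂ).re = u ∧ (ζ : ℂ).im = v := by
  refine ⟨⟨⟨u, v⟩, mem_sphere_zero_iff_norm.2 ?_⟩, rfl, rfl⟩
  rw [Complex.norm_def, Complex.normSq_mk, Real.sqrt_eq_one]
  linarith

theorem norm_capVec (ζ : Circle) {h : ℝ} (hh : h ^ 2 ≤ 1) : ‖capVec b ζ h‖ = 1 := by
  have h1 : ‖capVec b ζ h‖ ^ 2 = 1 := by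
    rw [norm_sq_eq_sum b, inner_capVec_zero, inner_capVec_one, inner_capVec_two, mul_pow, mul_pow,
      Real.sq_sqrt (by linarith), ← mul_add, circle_sq_add_sq]
    ring
  have := norm_nonneg (capVec b ζ h)
  nlinarith

/-- The point of the sphere of height `h` over the direction `ζ` (with `h` clamped
to `[-1, 1]`). -/
noncomputable def capPt (ζ : Circle) (h : ℝ) : Sphere2 :=
  ⟨capVec b ζ (max (-1) (min 1 h)), by
    rw [mem_sphere_zero_iff_norm]
    refine norm_capVec b ζ ?_
    rw [sq_le_one_iff_abs_le_one, abs_le]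
    exact ⟨le_max_left _ _, max_le (by norm_num) (min_le_left _ _)⟩⟩

theorem coe_capPt (ζ : Circle) {h : ℝ} (h1 : -1 ≤ h) (h2 : h ≤ 1) :
    (capPt b ζ h : EuclideanSpace ℝ (Fin 3)) = capVec b ζ h := by
  simp [capPt, h1, h2]

theorem continuous_capPt : Continuous fun p : Circle × ℝ => capPt b p.1 p.2 := by
  refine Continuous.subtype_mk ?_ _
  simp only [capVec]
  have h1 : Continuous fun p : Circle × ℝ => (p.1 : ℂ).re :=
    Complex.continuous_re.comp (continuous_subtype_val.comp continuous_fst)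
  have h2 : Continuous fun p : Circle × ℝ => (p.1 : ℂ).im :=
    Complex.continuous_im.comp (continuous_subtype_val.comp continuous_fst)
  fun_prop

theorem eq_of_inner_basis {x y : EuclideanSpace ℝ (Fin 3)} (h0 : inner ℝ (b 0) x = inner ℝ (b 0) y)
    (h1 : inner ℝ (b 1) x = inner ℝ (b 1) y) (h2 : inner ℝ (b 2) x = inner ℝ (b 2) y) :
    x = y := by
  refine b.repr.injective ?_
  ext i
  simp only [b.repr_apply_apply]
  fin_cases i
  · exact h0
  · exact h1
  · exact h2

theorem capPt_neg (ζ : Circle) {h : ℝ} (h1 : -1 ≤ h) (h2 : h ≤ 1) :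
    capPt b (-ζ) (-h) = -capPt b ζ h := by
  refine Subtype.ext ?_
  rw [coe_capPt b _ (by linarith) (by linarith)]
  change _ = -(capPt b ζ h : EuclideanSpace ℝ (Fin 3))
  rw [coe_capPt b _ h1 h2]
  have e : ((-ζ : Circle) : ℂ) = -(ζ : ℂ) := rfl
  simp only [capVec, e, neg_sq, Complex.neg_re, Complex.neg_im]
  module

/-- At the poles the direction is lost, so the bounds on `h` are strict. Those on `h'` need not be,
as the heights turn out equal. -/
theorem capPt_injective {ζ ζ' : Circle} {h h' : ℝ} (h1 : -1 < h) (h2 : h < 1) (h1' : -1 ≤ h')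
    (h2' : h' ≤ 1) (hh : capPt b ζ h = capPt b ζ' h') : ζ = ζ' ∧ h = h' := by
  have e := congrArg (Subtype.val : Sphere2 → _) hh
  rw [coe_capPt b _ h1.le h2.le, coe_capPt b _ h1' h2'] at e
  have e2 : h = h' := by rw [← inner_capVec_two b ζ h, e, inner_capVec_two]
  subst e2
  have hs : √(1 - h ^ 2) ≠ 0 := (Real.sqrt_pos.2 (by nlinarith)).ne'
  refine ⟨?_, rfl⟩
  ext
  refine Complex.ext ?_ ?_
  · exact mul_left_cancel₀ hs (by rw [← inner_capVec_zero b, e, inner_capVec_zero])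
  · exact mul_left_cancel₀ hs (by rw [← inner_capVec_one b, e, inner_capVec_one])

theorem exists_capPt (x : Sphere2) {h : ℝ} (hx : inner ℝ (b 2) (x : EuclideanSpace ℝ (Fin 3)) = h)
    (h1 : -1 < h) (h2 : h < 1) : ∃ ζ, x = capPt b ζ h := by
  have hpos : 0 < 1 - h ^ 2 := by nlinarith
  have hs : √(1 - h ^ 2) ≠ 0 := (Real.sqrt_pos.2 hpos).ne'
  have hsq := Real.sq_sqrt hpos.le
  have hn := norm_sq_eq_sum b x
  rw [norm_eq_of_mem_sphere, hx] at hn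
  set A := inner ℝ (b 0) (x : EuclideanSpace ℝ (Fin 3)) with hA
  set B := inner ℝ (b 1) (x : EuclideanSpace ℝ (Fin 3)) with hB
  set r := √(1 - h ^ 2) with hr
  obtain ⟨ζ, hζ1, hζ2⟩ : ∃ ζ : Circle, (ζ : ℂ).re = A / r ∧ (ζ : ℂ).im = B / r := by
    refine exists_circle_of_sq ?_
    field_simp
    rw [hsq]
    linarith
  refine ⟨ζ, Subtype.ext ?_⟩
  rw [coe_capPt b _ h1.le h2.le]
  refine eq_of_inner_basis b ?_ ?_ ?_
  · rw [inner_capVec_zero, ← hA, ← hr, hζ1]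
    field_simp
  · rw [inner_capVec_one, ← hB, ← hr, hζ2]
    field_simp
  · rw [inner_capVec_two, hx]

theorem continuous_rp2Proj_capPt : Continuous fun p : Circle × ℝ => rp2Proj (capPt b p.1 p.2) :=
  continuous_rp2Proj.comp (continuous_capPt b)

theorem absInner_capPt (ζ : Circle) {h : ℝ} (h0 : 0 ≤ h) (h2 : h ≤ 1) :
    absInner (b 2) (rp2Proj (capPt b ζ h)) = h := by
  rw [absInner_rp2Proj, coe_capPt b _ (by linarith) h2, inner_capVec_two, abs_of_nonneg h0]

/-- The antipode reverses the height, so two points of nonnegative height can be antipodal only on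
the equator. This is the source of the crosscap. -/
theorem rp2Proj_capPt_eq_iff {ζ ζ' : Circle} {h h' : ℝ} (h0 : 0 ≤ h) (h1 : h < 1) (h0' : 0 ≤ h')
    (h1' : h' < 1) : rp2Proj (capPt b ζ h) = rp2Proj (capPt b ζ' h') ↔
      h = h' ∧ (ζ = ζ' ∨ h = 0 ∧ ζ' = -ζ) := by
  rw [rp2Proj_eq_iff, ← capPt_neg b ζ (by linarith) h1.le]
  constructor
  · rintro (hh | hh)
    · obtain ⟨rfl, rfl⟩ := capPt_injective b (by linarith) h1' (by linarith) h1.le hh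
      exact ⟨rfl, Or.inl rfl⟩
    · obtain ⟨rfl, rfl⟩ := capPt_injective b (by linarith) h1' (by linarith) (by linarith) hh
      have : h = 0 := by linarith
      subst this
      simp
  · rintro ⟨rfl, rfl | ⟨rfl, rfl⟩⟩
    · exact Or.inl rfl
    · right
      simp

theorem exists_rp2Proj_capPt (x : RP2) (hx : absInner (b 2) x < 1) :
    ∃ ζ, x = rp2Proj (capPt b ζ (absInner (b 2) x)) := by
  obtain ⟨X, rfl⟩ := rp2Proj_surjective x
  rw [absInner_rp2Proj] at hx ⊢
  obtain ⟨hx1, hx2⟩ := abs_lt.1 hx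
  rcases abs_choice (inner ℝ (b 2) (X : EuclideanSpace ℝ (Fin 3))) with h | h
  · rw [h]
    obtain ⟨ζ, hζ⟩ := exists_capPt b X rfl hx1 hx2
    exact ⟨ζ, by rw [← hζ]⟩
  · rw [h]
    obtain ⟨ζ, hζ⟩ := exists_capPt b X rfl hx1 hx2
    refine ⟨-ζ, ?_⟩
    rw [capPt_neg b ζ hx1.le hx2.le, ← hζ, rp2Proj_neg]

end Cap

/-! ### Interior and frontier of a cap -/

theorem exists_orthonormalBasis (p : Sphere2) :
    ∃ b : OrthonormalBasis (Fin 3) ℝ (EuclideanSpace ℝ (Fin 3)), b 2 = p := by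
  obtain ⟨b, hb⟩ := Orthonormal.exists_orthonormalBasis_extension_of_card_eq (𝕜 := ℝ)
    (E := EuclideanSpace ℝ (Fin 3)) (ι := Fin 3) (by simp)
    (v := fun _ => (p : EuclideanSpace ℝ (Fin 3))) (s := {2}) (by
      rw [orthonormal_iff_ite]
      rintro ⟨i, hi⟩ ⟨j, hj⟩
      rw [mem_singleton_iff] at hi hj
      subst hi hj
      simp)
  exact ⟨b, hb 2 rfl⟩

/-- A point of height exactly `t` is not interior, because its meridian leaves the cap immediately
on going down. -/
theorem interior_cap (p : Sphere2) {t : ℝ} (ht0 : 0 < t) (ht1 : t < 1) :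
    interior {x | t ≤ absInner p x} = {x | t < absInner p x} := by
  refine Subset.antisymm (fun x hx => ?_) (interior_maximal
    (fun x (hx : t < _) => show t ≤ _ from hx.le) (isOpen_lt continuous_const (continuous_absInner p)))
  have hx' : x ∈ {x | t ≤ absInner p x} := interior_subset hx
  rw [mem_ofPred_eq] at hx'
  refine lt_of_le_of_ne hx' fun hxt => ?_
  obtain ⟨b, hb⟩ := exists_orthonormalBasis p
  rw [← hb] at hx hxt
  obtain ⟨ζ, hζ⟩ := exists_rp2Proj_capPt b x (by rw [← hxt]; exact ht1)
  rw [← hxt] at hζ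
  have hζc : Continuous fun h : ℝ => (ζ, h) := by fun_prop
  have hcomp := (continuous_rp2Proj_capPt b).comp hζc
  have hc : Continuous fun h : ℝ => rp2Proj (capPt b ζ h) := hcomp
  have ho : IsOpen ((fun h : ℝ => rp2Proj (capPt b ζ h)) ⁻¹' interior {x | t ≤ absInner (b 2) x}) :=
    isOpen_interior.preimage hc
  obtain ⟨ε, hε, hball⟩ := Metric.isOpen_iff.1 ho t (by rw [mem_preimage, ← hζ]; exact hx)
  -- The bound by `t` keeps the height `t - δ` nonnegative, so that `absInner` equals it.
  set δ := min (ε / 2) t with hδ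
  have hδ0 : 0 < δ := lt_min (by linarith) ht0
  have h1 : t - δ ∈ Metric.ball t ε := by
    rw [Metric.mem_ball, Real.dist_eq]
    have : δ ≤ ε / 2 := min_le_left _ _
    rw [abs_of_nonpos (by linarith)]
    linarith
  have h2 : rp2Proj (capPt b ζ (t - δ)) ∈ {x | t ≤ absInner (b 2) x} := interior_subset (hball h1)
  rw [mem_ofPred_eq] at h2
  rw [absInner_capPt b ζ (by linarith [min_le_right (ε / 2) t]) (by linarith)] at h2
  linarith

theorem frontier_cap (p : Sphere2) {t : ℝ} (ht0 : 0 < t) (ht1 : t < 1) :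
    frontier {x | t ≤ absInner p x} = {x | absInner p x = t} := by
  rw [frontier, interior_cap p ht0 ht1,
    (isClosed_le continuous_const (continuous_absInner p)).closure_eq]
  ext x
  simp only [mem_sdiff, mem_ofPred_eq, not_lt]
  exact ⟨fun h => le_antisymm h.2 h.1, fun h => ⟨h.ge, h.le⟩⟩

/-! ### The complement of a disc as a crosscap -/

/-- `k` presents the complement of the interior of `E` as the cylinder `S¹ × [0,1]` with
antipodal points at level `0` identified, extending the parametrization `e` of `∂E`. -/
structure IsCrosscap {Y : Type*} [TopologicalSpace Y] (E : Set Y) (e : Circle → Y)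
    (k : Circle × I → Y) : Prop where
  continuous : Continuous k
  range_eq : range k = (interior E)ᶜ
  apply_one : ∀ z, k (z, 1) = e z
  eq_iff : ∀ z s z' s', k (z, s) = k (z', s') ↔ s = s' ∧ (z = z' ∨ s = 0 ∧ z' = -z)

theorem absInner_nonneg (p : EuclideanSpace ℝ (Fin 3)) (x : RP2) : 0 ≤ absInner p x := by
  obtain ⟨X, rfl⟩ := rp2Proj_surjective x
  exact abs_nonneg _

/-- The part of the projective plane between the heights `t₀` and `t₁`, parametrized by a
cylinder. -/
noncomputable def capCyl (b : OrthonormalBasis (Fin 3) ℝ (EuclideanSpace ℝ (Fin 3))) (t₀ t₁ : ℝ)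
    (x : Circle × I) : RP2 :=
  rp2Proj (capPt b x.1 ((1 - x.2) * t₀ + x.2 * t₁))

section CapCyl

variable (b : OrthonormalBasis (Fin 3) ℝ (EuclideanSpace ℝ (Fin 3))) {t₀ t₁ : ℝ}

theorem continuous_capCyl : Continuous (capCyl b t₀ t₁) := by
  have h : Continuous fun x : Circle × I => (x.1, (1 - (x.2 : ℝ)) * t₀ + x.2 * t₁) := by fun_prop
  have hcomp := (continuous_rp2Proj_capPt b).comp h
  exact hcomp

theorem height_mem (h0 : 0 ≤ t₀) (h0' : t₀ < 1) (h1 : 0 ≤ t₁) (h1' : t₁ < 1) (s : I) :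
    0 ≤ (1 - (s : ℝ)) * t₀ + s * t₁ ∧ (1 - (s : ℝ)) * t₀ + s * t₁ < 1 := by
  have hs0 := s.2.1
  have hs1 := s.2.2
  constructor
  · nlinarith [mul_nonneg hs0 h1, mul_nonneg (sub_nonneg.2 hs1) h0]
  · rcases hs0.eq_or_lt with h | h
    · rw [← h]; linarith
    · nlinarith [mul_nonneg (sub_nonneg.2 hs1) (sub_nonneg.2 h0'.le), mul_pos h (sub_pos.2 h1')]

theorem absInner_capCyl (h0 : 0 ≤ t₀) (h0' : t₀ < 1) (h1 : 0 ≤ t₁) (h1' : t₁ < 1) (z : Circle)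
    (s : I) : absInner (b 2) (capCyl b t₀ t₁ (z, s)) = (1 - s) * t₀ + s * t₁ :=
  absInner_capPt b z (height_mem h0 h0' h1 h1' s).1 (height_mem h0 h0' h1 h1' s).2.le

/-- This serves two purposes: with `t₀ = 0` the cylinder starts at the equator and closes up to a
crosscap, while with both heights positive it is an embedded collar. -/
theorem capCyl_eq_iff (h0 : 0 ≤ t₀) (h0' : t₀ < 1) (h1 : 0 ≤ t₁) (h1' : t₁ < 1) (hne : t₀ ≠ t₁)
    (z : Circle) (s : I) (z' : Circle) (s' : I) :
    capCyl b t₀ t₁ (z, s) = capCyl b t₀ t₁ (z', s') ↔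
      s = s' ∧ (z = z' ∨ (1 - (s : ℝ)) * t₀ + s * t₁ = 0 ∧ z' = -z) := by
  refine (rp2Proj_capPt_eq_iff b (height_mem h0 h0' h1 h1' s).1 (height_mem h0 h0' h1 h1' s).2
    (height_mem h0 h0' h1 h1' s').1 (height_mem h0 h0' h1 h1' s').2).trans ?_
  refine and_congr ⟨fun h => ?_, fun h => by rw [h]⟩ Iff.rfl
  ext
  have : ((s : ℝ) - s') * (t₁ - t₀) = 0 := by linear_combination h
  rcases mul_eq_zero.1 this with h | h
  · linarith
  · exact absurd (by linarith) hne

theorem exists_capCyl {x : RP2} (hx : absInner (b 2) x < 1) {s : I}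
    (hs : absInner (b 2) x = (1 - s) * t₀ + s * t₁) : ∃ z, capCyl b t₀ t₁ (z, s) = x := by
  obtain ⟨ζ, hζ⟩ := exists_rp2Proj_capPt b x hx
  rw [hs] at hζ
  exact ⟨ζ, hζ.symm⟩

end CapCyl

/-- A continuous bijection from the circle to a boundary is a homeomorphism. -/
theorem exists_boundary_homeo {X : Type*} [TopologicalSpace X] [T2Space X] {D : Set X}
    {f : Circle → X} (hf : Continuous f) (hinj : Function.Injective f)
    (hr : range f = frontier D) : ∃ e : Circle ≃ₜ frontier D, ∀ z, (e z : X) = f z := by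
  let F : Circle ≃ frontier D := Equiv.ofBijective
    (fun z => ⟨f z, by rw [← hr]; exact mem_range_self z⟩)
    ⟨fun z z' h => hinj (by simpa using h), fun x => by
      obtain ⟨z, hz⟩ : (x : X) ∈ range f := by rw [hr]; exact x.2
      exact ⟨z, Subtype.ext hz⟩⟩
  have hF : Continuous F := Continuous.subtype_mk hf _
  exact ⟨hF.homeoOfEquivCompactToT2, fun z => rfl⟩

/-- The cylinder from the equator up to height `t` is a crosscap with a boundary parametrization
`e₀` of its own. Precomposing it with a level-preserving extension of `e₀⁻¹ ∘ e` changes this to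
`e`. Commutation with the antipodal map at level `0` keeps the fibres unchanged. -/
theorem exists_isCrosscap_cap (p : Sphere2) {t : ℝ} (ht0 : 0 < t) (ht1 : t < 1)
    (e : Circle ≃ₜ frontier {x | t ≤ absInner p x}) :
    ∃ k, IsCrosscap {x | t ≤ absInner p x} (fun z => (e z : RP2)) k := by
  obtain ⟨b, hb⟩ := exists_orthonormalBasis p
  have hμ : ∀ z s, absInner p (capCyl b 0 t (z, s)) = s * t := fun z s => by
    rw [← hb, absInner_capCyl b le_rfl one_pos ht0.le ht1]
    ring
  have hk₀eq : ∀ z s z' s', capCyl b 0 t (z, s) = capCyl b 0 t (z', s') ↔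
      s = s' ∧ (z = z' ∨ s = 0 ∧ z' = -z) := by
    intro z s z' s'
    rw [capCyl_eq_iff b le_rfl one_pos ht0.le ht1 ht0.ne, mul_zero, zero_add, mul_eq_zero,
      or_iff_left ht0.ne', Set.Icc.coe_eq_zero]
  have hsurj : ∀ x : RP2, absInner p x ≤ t →
      ∃ z s, capCyl b 0 t (z, s) = x ∧ (s : ℝ) * t = absInner p x := by
    intro x hx
    have hs : absInner p x / t * t = absInner p x := div_mul_cancel₀ _ ht0.ne'
    obtain ⟨z, hz⟩ := exists_capCyl b (t₀ := 0) (t₁ := t) (x := x) (by rw [hb]; linarith)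
      (s := ⟨absInner p x / t, div_nonneg (absInner_nonneg _ _) ht0.le, (div_le_one ht0).2 hx⟩)
      (by rw [hb]; simp [hs])
    exact ⟨z, _, hz, hs⟩
  obtain ⟨e₀, he₀⟩ := exists_boundary_homeo (D := {x | t ≤ absInner p x})
    (f := fun z => capCyl b 0 t (z, 1)) ((continuous_capCyl b).comp (by fun_prop))
    (fun z z' h => by simpa using ((hk₀eq _ _ _ _).1 h).2) (by
      rw [frontier_cap p ht0 ht1]
      ext x
      constructor
      · rintro ⟨z, rfl⟩
        exact (hμ z 1).trans (by simp)
      · intro hx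
        rw [mem_ofPred_eq] at hx
        obtain ⟨z, s, hzs, hs⟩ := hsurj x hx.le
        have : s = 1 := by
          ext
          rw [hx] at hs
          exact (mul_eq_right₀ ht0.ne').1 hs
        subst this
        exact ⟨z, hzs⟩)
  obtain ⟨H, hH, hHb, hH1, hH0⟩ := exists_level_extension (e.trans e₀.symm)
  refine ⟨fun x => capCyl b 0 t (H x, x.2),
    (continuous_capCyl b).comp (hH.prodMk continuous_snd), ?_, ?_, ?_⟩
  · rw [interior_cap p ht0 ht1]
    ext x
    simp only [mem_range, Prod.exists, mem_compl_iff, mem_ofPred_eq, not_lt]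
    constructor
    · rintro ⟨z, s, rfl⟩
      rw [hμ]
      nlinarith [s.2.2]
    · intro hx
      obtain ⟨z, s, rfl, -⟩ := hsurj x hx
      obtain ⟨w, hw⟩ := (hHb s).2 z
      exact ⟨w, s, by rw [← hw]⟩
  · intro z
    simp only [hH1]
    rw [← he₀]
    simp
  · intro z s z' s'
    rw [hk₀eq]
    constructor
    · rintro ⟨rfl, h | ⟨rfl, h⟩⟩
      · exact ⟨rfl, Or.inl ((hHb s).1 h)⟩
      · rw [← hH0] at h
        exact ⟨rfl, Or.inr ⟨rfl, (hHb 0).1 h⟩⟩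
    · rintro ⟨rfl, rfl | ⟨rfl, rfl⟩⟩
      · exact ⟨rfl, Or.inl rfl⟩
      · exact ⟨rfl, Or.inr ⟨rfl, hH0 z⟩⟩

theorem exists_isCrosscap_of_isRound {E : Set RP2} (hE : IsRoundRP2 E) (e : Circle ≃ₜ frontier E) :
    ∃ k, IsCrosscap E (fun z => (e z : RP2)) k := by
  obtain ⟨p, t, ht0, ht1, rfl⟩ := hE
  revert e
  rw [image_cap_eq]
  exact exists_isCrosscap_cap p ht0 ht1

/-- The complement of a tame disc in the projective plane is a Möbius band, and its presentation
as a crosscap can be chosen to extend any given parametrization of the boundary. -/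
theorem exists_isCrosscap {E : Set RP2} (hE : IsTameDisc IsRoundRP2 E) (e : Circle ≃ₜ frontier E) :
    ∃ k, IsCrosscap E (fun z => (e z : RP2)) k := by
  obtain ⟨f, hf⟩ := hE
  obtain ⟨k, hk⟩ := exists_isCrosscap_of_isRound hf
    (e.trans ((f.image (frontier E)).trans (Homeomorph.setCongr (f.image_frontier E))))
  refine ⟨fun x => f.symm (k x), f.symm.continuous.comp hk.continuous, ?_, ?_, ?_⟩
  · change range (f.symm ∘ k) = _
    rw [range_comp, hk.range_eq, ← f.image_interior, ← Set.image_compl_eq f.bijective,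
      ← image_comp]
    simp
  · intro z
    rw [hk.apply_one]
    exact f.symm_apply_apply _
  · intro z s z' s'
    rw [f.symm.injective.eq_iff, hk.eq_iff]

/-! ### Connected sums with the projective plane as crosscap quotients -/

/-- `c` is a cylinder inside `D`, one end of which is the boundary of `D`. -/
structure IsInnerCollar {X : Type*} [TopologicalSpace X] (D : Set X) (c : Circle × I → X) :
    Prop where
  continuous : Continuous c
  injective : Function.Injective c
  range_one : range (fun z => c (z, 1)) = frontier D
  mem_interior : ∀ z s, s ≠ 1 → c (z, s) ∈ interior D

/-- `Θ` presents `Z` as the quotient of `S` by the identifications `c z = c (-z)`, for the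
parametrized circles `c` belonging to `C`. -/
structure IsAntipodalQuotient {X Z : Type*} [TopologicalSpace X] [TopologicalSpace Z] (S : Set X)
    (C : Set (Circle → X)) (Θ : X → Z) : Prop where
  continuousOn : ContinuousOn Θ S
  surj : ∀ a, ∃ x ∈ S, Θ x = a
  eq_iff : ∀ x ∈ S, ∀ y ∈ S, Θ x = Θ y ↔ x = y ∨ ∃ c ∈ C, ∃ z, x = c z ∧ y = c (-z)

/-- A continuous map from a compact space to a Hausdorff space is a quotient map onto its range. -/
theorem continuousOn_range_of_comp {W X Z : Type*} [TopologicalSpace W] [TopologicalSpace X]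
    [TopologicalSpace Z] [CompactSpace W] [T2Space X] {c : W → X} (hc : Continuous c) {Θ : X → Z}
    (h : Continuous (Θ ∘ c)) : ContinuousOn Θ (range c) := by
  rw [continuousOn_iff_continuous_domRestrict]
  have q : IsQuotientMap (rangeFactorization c) :=
    IsQuotientMap.of_surjective_continuous rangeFactorization_surjective
      (Continuous.subtype_mk hc _)
  exact q.continuous_iff.2 h

section Crosscap

variable {X : Type*} [TopologicalSpace X] [T2Space X] {D : Set X} {c : Circle × I → X}

/-- Forming the connected sum with a projective plane along `D` amounts to replacing `D` by
a smaller disc and identifying antipodal points on its boundary. -/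
theorem exists_isAntipodalQuotient (hc : IsInnerCollar D c) {E : Set RP2}
    (hE : IsTameDisc IsRoundRP2 E) (h : frontier D ≃ₜ frontier E) :
    ∃ Θ : X → ConnectedSum D E h,
      IsAntipodalQuotient ((interior D)ᶜ ∪ range c) {fun z => c (z, 0)} Θ ∧
      ∀ x (hx : x ∈ (interior D)ᶜ), Θ x = ConnectedSum.inl D E h ⟨x, hx⟩ := by
  classical
  obtain ⟨e, he⟩ := exists_boundary_homeo (D := D) (f := fun z => c (z, 1))
    (hc.continuous.comp (by fun_prop)) (fun z z' hz => by simpa using hc.injective hz) hc.range_one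
  -- Prescribing the boundary parametrization `h ∘ e` absorbs the gluing map: the top of the
  -- crosscap then matches the outer end of the collar `c`.
  obtain ⟨k, hk⟩ := exists_isCrosscap hE (e.trans h)
  have hkm : ∀ a, k a ∈ (interior E)ᶜ := fun a => by
    rw [← hk.range_eq]
    exact mem_range_self a
  let κ : Circle × I → ConnectedSum D E h := fun a => ConnectedSum.inr D E h ⟨k a, hkm a⟩
  have hκ : Continuous κ :=
    (ConnectedSum.continuous_inr D E h).comp (Continuous.subtype_mk hk.continuous _)
  have hκeq : ∀ z s z' s', κ (z, s) = κ (z', s') ↔ s = s' ∧ (z = z' ∨ s = 0 ∧ z' = -z) := by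
    intro z s z' s'
    rw [← hk.eq_iff, (ConnectedSum.inr_injective D E h).eq_iff, Subtype.mk.injEq]
  have hκ1 : ∀ z, κ (z, 1) = ConnectedSum.inl D E h (bdryPt D (e z)) := by
    intro z
    rw [ConnectedSum.glue]
    simp only [κ]
    congr 1
    exact Subtype.ext (hk.apply_one z)
  have hκne : ∀ z s, s ≠ 1 → ∀ x, ConnectedSum.inl D E h x ≠ κ (z, s) := by
    intro z s hs x hx
    obtain ⟨w, -, hw⟩ := (ConnectedSum.inl_eq_inr_iff D E h _ _).1 hx
    obtain ⟨z', rfl⟩ := e.surjective w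
    have h1 := hκ1 z'
    rw [ConnectedSum.glue, hw] at h1
    exact hs ((hκeq _ _ _ _).1 h1).1.symm
  have hout : ∀ z, c (z, 1) ∈ (interior D)ᶜ := fun z => by
    have : c (z, 1) ∈ frontier D := by
      rw [← hc.range_one]
      exact ⟨z, rfl⟩
    exact this.2
  -- Outside `D` this is the inclusion; on the collar it transfers cylinder coordinates to the
  -- crosscap. The values in the rest of `D` are arbitrary and never used.
  let Θ : X → ConnectedSum D E h := fun x =>
    if hx : x ∈ (interior D)ᶜ then ConnectedSum.inl D E h ⟨x, hx⟩ else κ (Function.invFun c x)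
  have hΘ1 : ∀ x (hx : x ∈ (interior D)ᶜ), Θ x = ConnectedSum.inl D E h ⟨x, hx⟩ :=
    fun x hx => dif_pos hx
  have hΘ2 : ∀ a, Θ (c a) = κ a := by
    rintro ⟨z, s⟩
    by_cases hs : s = 1
    · subst hs
      rw [hΘ1 _ (hout z), hκ1]
      congr 1
      exact Subtype.ext (he z).symm
    · have hx : ¬ c (z, s) ∈ (interior D)ᶜ := not_not.2 (hc.mem_interior z s hs)
      simp only [Θ]
      rw [dif_neg hx, Function.leftInverse_invFun hc.injective]
  have hcases : ∀ x ∈ (interior D)ᶜ ∪ range c,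
      x ∈ (interior D)ᶜ ∨ ∃ z s, s ≠ 1 ∧ x = c (z, s) := by
    rintro x (hx | ⟨⟨z, s⟩, rfl⟩)
    · exact Or.inl hx
    · by_cases hs : s = 1
      · subst hs
        exact Or.inl (hout z)
      · exact Or.inr ⟨z, s, hs, rfl⟩
  have h01 : (0 : I) ≠ 1 := zero_ne_one
  refine ⟨Θ, ⟨?_, ?_, ?_⟩, hΘ1⟩
  · refine ContinuousOn.union_of_isClosed ?_ ?_ isOpen_interior.isClosed_compl
      (isCompact_range hc.continuous).isClosed
    · rw [continuousOn_iff_continuous_domRestrict]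
      have : (interior D)ᶜ.domRestrict Θ = ConnectedSum.inl D E h := by
        ext x
        exact hΘ1 x x.2
      rw [this]
      exact ConnectedSum.continuous_inl D E h
    · refine continuousOn_range_of_comp hc.continuous ?_
      have : Θ ∘ c = κ := funext hΘ2
      rwa [this]
  · intro a
    rcases ConnectedSum.exists_rep D E h a with ⟨x, rfl⟩ | ⟨y, rfl⟩
    · exact ⟨x, Or.inl x.2, hΘ1 x x.2⟩
    · have hy : (y : RP2) ∈ range k := by
        rw [hk.range_eq]
        exact y.2
      obtain ⟨b, hb⟩ := hy
      refine ⟨c b, Or.inr (mem_range_self b), ?_⟩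
      rw [hΘ2]
      simp only [κ]
      congr 1
      exact Subtype.ext hb
  · intro x hx y hy
    simp only [mem_singleton_iff, exists_eq_left]
    rcases hcases x hx with hx | ⟨z, s, hs, rfl⟩ <;> rcases hcases y hy with hy | ⟨z', s', hs', rfl⟩
    · rw [hΘ1 x hx, hΘ1 y hy, (ConnectedSum.inl_injective D E h).eq_iff, Subtype.mk.injEq]
      refine ⟨Or.inl, ?_⟩
      rintro (hxy | ⟨z, rfl, -⟩)
      · exact hxy
      · exact absurd (hc.mem_interior z 0 h01) hx
    · rw [hΘ1 x hx, hΘ2]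
      refine ⟨fun hh => absurd hh (hκne z' s' hs' _), ?_⟩
      rintro (rfl | ⟨z, rfl, -⟩)
      · exact absurd (hc.mem_interior _ _ hs') hx
      · exact absurd (hc.mem_interior z 0 h01) hx
    · rw [hΘ1 y hy, hΘ2]
      refine ⟨fun hh => absurd hh.symm (hκne z s hs _), ?_⟩
      rintro (rfl | ⟨z, -, rfl⟩)
      · exact absurd (hc.mem_interior _ _ hs) hy
      · exact absurd (hc.mem_interior _ 0 h01) hy
    · rw [hΘ2, hΘ2, hκeq]
      constructor
      · rintro ⟨rfl, rfl | ⟨rfl, rfl⟩⟩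
        · exact Or.inl rfl
        · exact Or.inr ⟨z, rfl, rfl⟩
      · rintro (hh | ⟨w, h1, h2⟩)
        · have := hc.injective hh
          simp only [Prod.mk.injEq] at this
          exact ⟨this.2, Or.inl this.1⟩
        · have h1 := hc.injective h1
          have h2 := hc.injective h2
          simp only [Prod.mk.injEq] at h1 h2
          obtain ⟨rfl, rfl⟩ := h1
          obtain ⟨rfl, rfl⟩ := h2
          exact ⟨rfl, Or.inr ⟨rfl, rfl⟩⟩

end Crosscap

/-! ### Two successive crosscaps -/

section TwoCrosscaps

variable {X Y : Type*} [TopologicalSpace X] [TopologicalSpace Y]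

/-- Since `A` avoids the closed set `D`, no point of `A` is glued to anything, and near `A` the sum
looks like `X`. -/
theorem interior_inl_image {D A : Set X} {E : Set Y} (h : frontier D ≃ₜ frontier E)
    (hD : IsClosed D) (hAD : Disjoint A D) :
    interior (ConnectedSum.inl D E h '' {x | (x : X) ∈ A}) =
      ConnectedSum.inl D E h '' {x | (x : X) ∈ interior A} := by
  refine Subset.antisymm ?_ (interior_maximal ?_ ?_)
  · intro a ha
    obtain ⟨x, hx, rfl⟩ := interior_subset ha
    refine ⟨x, ?_, rfl⟩
    let V : Set ((interior D)ᶜ : Set X) :=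
      ConnectedSum.inl D E h ⁻¹' interior (ConnectedSum.inl D E h '' {x | (x : X) ∈ A})
    have hV : IsOpen V := isOpen_interior.preimage (ConnectedSum.continuous_inl D E h)
    obtain ⟨U, hU, hUV⟩ := isOpen_induced_iff.1 hV
    have hsub : U ∩ Dᶜ ⊆ A := by
      rintro y ⟨hy, hyD⟩
      have hy' : y ∈ (interior D)ᶜ := fun hh => hyD (interior_subset hh)
      have : (⟨y, hy'⟩ : ((interior D)ᶜ : Set X)) ∈ V := by
        rw [← hUV]
        exact hy
      obtain ⟨w, hw, hwy⟩ := interior_subset this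
      rw [ConnectedSum.inl_injective D E h hwy] at hw
      exact hw
    refine interior_maximal hsub (hU.inter hD.isOpen_compl) ⟨?_, Set.disjoint_left.1 hAD hx⟩
    have : x ∈ V := ha
    rw [← hUV] at this
    exact this
  · rintro _ ⟨x, hx, rfl⟩
    have hxA : (x : X) ∈ A := interior_subset hx
    exact ⟨x, hxA, rfl⟩
  · have : IsOpen (Quot.mk (GlueRel D E h) ⁻¹'
        (ConnectedSum.inl D E h '' {x | (x : X) ∈ interior A})) := by
      rw [isOpen_sum_iff]
      constructor
      · have : Sum.inl ⁻¹' (Quot.mk (GlueRel D E h) ⁻¹'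
            (ConnectedSum.inl D E h '' {x | (x : X) ∈ interior A})) =
            (Subtype.val : ((interior D)ᶜ : Set X) → X) ⁻¹' interior A := by
          ext x
          constructor
          · rintro ⟨y, hy, hyx⟩
            rw [ConnectedSum.inl_injective D E h hyx] at hy
            exact hy
          · intro hx
            exact ⟨x, hx, rfl⟩
        rw [this]
        exact isOpen_interior.preimage continuous_subtype_val
      · have : Sum.inr ⁻¹' (Quot.mk (GlueRel D E h) ⁻¹'
            (ConnectedSum.inl D E h '' {x | (x : X) ∈ interior A})) = ∅ := by
          ext y
          simp only [mem_empty_iff_false, iff_false]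
          rintro ⟨x, hx, hxy⟩
          obtain ⟨z, rfl, -⟩ := (ConnectedSum.inl_eq_inr_iff D E h x y).1 hxy
          exact Set.disjoint_left.1 hAD (interior_subset hx) (hD.frontier_subset z.2)
        rw [this]
        exact isOpen_empty
    exact this

theorem frontier_inl_image [CompactSpace X] [T2Space X] [CompactSpace Y] [T2Space Y] {D A : Set X} {E : Set Y}
    (h : frontier D ≃ₜ frontier E) (hD : IsClosed D) (hA : IsClosed A) (hAD : Disjoint A D) :
    frontier (ConnectedSum.inl D E h '' {x | (x : X) ∈ A}) =
      ConnectedSum.inl D E h '' {x | (x : X) ∈ frontier A} := by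
  have : CompactSpace ((interior D)ᶜ : Set X) :=
    isCompact_iff_compactSpace.1 isOpen_interior.isClosed_compl.isCompact
  have hcl : IsClosed (ConnectedSum.inl D E h '' {x | (x : X) ∈ A}) :=
    ((hA.preimage continuous_subtype_val).isCompact.image
      (ConnectedSum.continuous_inl D E h)).isClosed
  rw [hcl.frontier_eq, hA.frontier_eq, interior_inl_image h hD hAD,
    ← image_sdiff (ConnectedSum.inl_injective D E h)]
  rfl

/-- Two successive connected sums with projective planes, along disjoint discs of `X`. -/
theorem exists_isAntipodalQuotient_two [CompactSpace X] [T2Space X] {D A : Set X} {c₁ c₂ : Circle × I → X}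
    (hD : IsClosed D) (hA : IsClosed A) (hAD : Disjoint A D)
    (hc₁ : IsInnerCollar D c₁) (hc₂ : IsInnerCollar A c₂) {E : Set RP2}
    (hE : IsTameDisc IsRoundRP2 E) (h : frontier D ≃ₜ frontier E)
    {F : Set (ConnectedSum D E h)} (hF : F = ConnectedSum.inl D E h '' {x | (x : X) ∈ A})
    {E' : Set RP2} (hE' : IsTameDisc IsRoundRP2 E') (h' : frontier F ≃ₜ frontier E') :
    ∃ Θ : X → ConnectedSum F E' h',
      IsAntipodalQuotient (((interior D)ᶜ ∪ range c₁) ∩ ((interior A)ᶜ ∪ range c₂))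
        {fun z => c₁ (z, 0), fun z => c₂ (z, 0)} Θ := by
  obtain ⟨Θ₁, hΘ₁, hΘ₁'⟩ := exists_isAntipodalQuotient hc₁ hE h
  have hintF : interior F = ConnectedSum.inl D E h '' {x | (x : X) ∈ interior A} := by
    rw [hF]
    exact interior_inl_image h hD hAD
  have hfrF : frontier F = ConnectedSum.inl D E h '' {x | (x : X) ∈ frontier A} := by
    rw [hF]
    exact frontier_inl_image h hD hA hAD
  have hAout : ∀ x ∈ A, x ∈ (interior D)ᶜ := fun x hx hx' =>
    Set.disjoint_left.1 hAD hx (interior_subset hx')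
  have hc₂A : ∀ a, c₂ a ∈ A := by
    rintro ⟨z, s⟩
    by_cases hs : s = 1
    · subst hs
      have : c₂ (z, 1) ∈ frontier A := by
        rw [← hc₂.range_one]
        exact ⟨z, rfl⟩
      exact hA.frontier_subset this
    · exact interior_subset (hc₂.mem_interior z s hs)
  -- The collar `c₂` lies in `A`, where `Θ₁` is the injective inclusion into the first sum, so it
  -- remains a collar there.
  have hc : IsInnerCollar F fun a => Θ₁ (c₂ a) := by
    have heq : (fun a => Θ₁ (c₂ a)) =
        fun a => ConnectedSum.inl D E h ⟨c₂ a, hAout _ (hc₂A a)⟩ :=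
      funext fun a => hΘ₁' _ (hAout _ (hc₂A a))
    rw [heq]
    refine ⟨(ConnectedSum.continuous_inl D E h).comp (Continuous.subtype_mk hc₂.continuous _),
      fun a b hab => ?_, ?_, fun z s hs => ?_⟩
    · have := ConnectedSum.inl_injective D E h hab
      rw [Subtype.mk.injEq] at this
      exact hc₂.injective this
    · rw [hfrF, ← hc₂.range_one]
      ext a
      constructor
      · rintro ⟨z, rfl⟩
        exact ⟨_, ⟨z, rfl⟩, rfl⟩
      · rintro ⟨⟨_, _⟩, ⟨z, rfl⟩, rfl⟩
        exact ⟨z, rfl⟩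
    · rw [hintF]
      exact ⟨_, hc₂.mem_interior z s hs, rfl⟩
  obtain ⟨Θ₂, hΘ₂, -⟩ := exists_isAntipodalQuotient hc hE' h'
  -- The only identifications made by `Θ₁` are on the inner end of `c₁`, which lies in the interior
  -- of `D` and so misses `A`. The two families of identifications therefore do not interact.
  have hinj : ∀ x ∈ (interior D)ᶜ ∪ range c₁, ∀ y ∈ A, Θ₁ x = Θ₁ y → x = y := by
    intro x hx y hy hxy
    rcases (hΘ₁.eq_iff x hx y (Or.inl (hAout y hy))).1 hxy with hxy | ⟨_, rfl, z, -, rfl⟩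
    · exact hxy
    · exact absurd (hc₁.mem_interior _ 0 zero_ne_one) (hAout _ hy)
  have hmaps : ∀ x ∈ ((interior D)ᶜ ∪ range c₁) ∩ ((interior A)ᶜ ∪ range c₂),
      Θ₁ x ∈ (interior F)ᶜ ∪ range fun a => Θ₁ (c₂ a) := by
    rintro x ⟨hx1, hx2⟩
    by_cases hxF : Θ₁ x ∈ interior F
    · right
      rw [hintF] at hxF
      obtain ⟨y, hy, hyx⟩ := hxF
      rw [← hΘ₁' _ y.2] at hyx
      have hyx := hinj x hx1 y (interior_subset hy) hyx.symm
      rcases hx2 with hx2 | ⟨a, rfl⟩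
      · rw [hyx] at hx2
        exact absurd hy hx2
      · exact ⟨a, rfl⟩
    · exact Or.inl hxF
  refine ⟨Θ₂ ∘ Θ₁, hΘ₂.continuousOn.comp (hΘ₁.continuousOn.mono inter_subset_left) hmaps, ?_, ?_⟩
  · intro b
    obtain ⟨y, hy, rfl⟩ := hΘ₂.surj b
    rcases hy with hy | ⟨a, rfl⟩
    · obtain ⟨x, hx, rfl⟩ := hΘ₁.surj y
      refine ⟨x, ⟨hx, Or.inl fun hxA => hy ?_⟩, rfl⟩
      rw [hΘ₁' x (hAout x (interior_subset hxA)), hintF]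
      exact ⟨_, hxA, rfl⟩
    · exact ⟨c₂ a, ⟨Or.inl (hAout _ (hc₂A a)), Or.inr ⟨a, rfl⟩⟩, rfl⟩
  · intro x hx y hy
    refine (hΘ₂.eq_iff _ (hmaps x hx) _ (hmaps y hy)).trans ?_
    rw [hΘ₁.eq_iff x hx.1 y hy.1]
    simp only [mem_singleton_iff, exists_eq_left, mem_insert_iff, exists_eq_or_imp]
    rw [or_assoc]
    refine or_congr_right (or_congr_right (exists_congr fun z => ?_))
    constructor
    · rintro ⟨h1, h2⟩
      exact ⟨hinj x hx.1 _ (hc₂A _) h1, hinj y hy.1 _ (hc₂A _) h2⟩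
    · rintro ⟨rfl, rfl⟩
      exact ⟨rfl, rfl⟩

end TwoCrosscaps

/-! ### A model: the closed disc with boundary identifications -/

/-- The Euclidean inner product of two points of the circle. -/
noncomputable def circInner (p z : Circle) : ℝ :=
  (p : ℂ).re * (z : ℂ).re + (p : ℂ).im * (z : ℂ).im

theorem circInner_exp (α φ : ℝ) :
    circInner (Circle.exp α) (Circle.exp φ) = Real.cos (φ - α) := by
  rw [Real.cos_sub, circInner, Circle.coe_exp, Circle.coe_exp, Complex.exp_ofReal_mul_I_re,
    Complex.exp_ofReal_mul_I_re, Complex.exp_ofReal_mul_I_im, Complex.exp_ofReal_mul_I_im]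
  ring

theorem circInner_neg_left (p z : Circle) : circInner (-p) z = -circInner p z := by
  have e : ((-p : Circle) : ℂ) = -(p : ℂ) := rfl
  simp only [circInner, e, Complex.neg_re, Complex.neg_im]
  ring

theorem circInner_neg_right (p z : Circle) : circInner p (-z) = -circInner p z := by
  have e : ((-z : Circle) : ℂ) = -(z : ℂ) := rfl
  simp only [circInner, e, Complex.neg_re, Complex.neg_im]
  ring

/-- The reflection of the circle that changes the sign of the component along `p`. -/
noncomputable def circRefl (p z : Circle) : Circle := -(p * p * z⁻¹)

/-- Identifications on the circle: the reflection along `p` on the two arcs around `±p`,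
the reflection along `q` on the two arcs around `±q`, and the antipodal map on the four
remaining arcs. -/
def BdRel (p q : Circle) (t s : ℝ) (z z' : Circle) : Prop :=
  ((|circInner p z| ≤ t ∧ |circInner q z| ≤ s) ∧ z' = -z) ∨
  -- The second alternative occurs only at an endpoint of an arc, where the reflection and the
  -- antipodal map both apply and their composite must be included for transitivity.
  (t ≤ |circInner p z| ∧ (z' = circRefl p z ∨ |circInner p z| ≤ t ∧ z' = -circRefl p z)) ∨
  (s ≤ |circInner q z| ∧ (z' = circRefl q z ∨ |circInner q z| ≤ s ∧ z' = -circRefl q z))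

/-- The arcs around `±p` and `±q` are proper and disjoint. -/
structure IsAdmissible (p q : Circle) (t s : ℝ) : Prop where
  t_pos : 0 < t
  t_lt_one : t < 1
  s_pos : 0 < s
  s_lt_one : s < 1
  disjoint : ∀ z, t ≤ |circInner p z| → |circInner q z| < s

/-- `G` presents `Z` as the closed disc, in polar coordinates, with boundary points identified
according to `BdRel p q t s`. -/
structure IsDiscModel {Z : Type*} [TopologicalSpace Z] (p q : Circle) (t s : ℝ)
    (G : Circle × I → Z) : Prop where
  continuous : Continuous G
  surjective : Function.Surjective G
  eq_iff : ∀ z l z' l', G (z, l) = G (z', l') ↔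
    l = l' ∧ (l = 0 ∨ z = z' ∨ l = 1 ∧ BdRel p q t s z z')

/-! ### Piecewise linear parametrizations -/

/-- Truncation to the unit interval. -/
noncomputable def ramp (u : ℝ) : ℝ := max 0 (min 1 u)

theorem continuous_ramp : Continuous ramp := by
  unfold ramp
  fun_prop

theorem ramp_of_le {u : ℝ} (h : u ≤ 0) : ramp u = 0 := by
  rw [ramp, min_eq_right (by linarith), max_eq_left h]

theorem ramp_of_ge {u : ℝ} (h : 1 ≤ u) : ramp u = 1 := by
  rw [ramp, min_eq_left h, max_eq_right zero_le_one]

theorem ramp_of_mem {u : ℝ} (h0 : 0 ≤ u) (h1 : u ≤ 1) : ramp u = u := by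
  rw [ramp, min_eq_right h1, max_eq_right h0]

theorem ramp_mono {u v : ℝ} (h : u ≤ v) : ramp u ≤ ramp v :=
  max_le_max le_rfl (min_le_min le_rfl h)

/-- The piecewise linear function with values `x₀, x₁, x₂, x₃, x₄` at `0, 1, 2, 3, 4`. -/
noncomputable def piecewiseLin (x₀ x₁ x₂ x₃ x₄ u : ℝ) : ℝ :=
  x₀ + (x₁ - x₀) * ramp u + (x₂ - x₁) * ramp (u - 1) + (x₃ - x₂) * ramp (u - 2) +
    (x₄ - x₃) * ramp (u - 3)

section PiecewiseLin

variable {x₀ x₁ x₂ x₃ x₄ : ℝ}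

theorem continuous_piecewiseLin : Continuous (piecewiseLin x₀ x₁ x₂ x₃ x₄) := by
  have := continuous_ramp
  unfold piecewiseLin
  fun_prop

theorem piecewiseLin_first {u : ℝ} (h0 : 0 ≤ u) (h1 : u ≤ 1) :
    piecewiseLin x₀ x₁ x₂ x₃ x₄ u = x₀ + (x₁ - x₀) * u := by
  rw [piecewiseLin, ramp_of_mem h0 h1, ramp_of_le (by linarith : u - 1 ≤ 0),
    ramp_of_le (by linarith : u - 2 ≤ 0), ramp_of_le (by linarith : u - 3 ≤ 0)]
  ring

theorem piecewiseLin_third {u : ℝ} (h0 : 2 ≤ u) (h1 : u ≤ 3) :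
    piecewiseLin x₀ x₁ x₂ x₃ x₄ u = x₂ + (x₃ - x₂) * (u - 2) := by
  rw [piecewiseLin, ramp_of_ge (by linarith : 1 ≤ u), ramp_of_ge (by linarith : 1 ≤ u - 1),
    ramp_of_mem (by linarith) (by linarith : u - 2 ≤ 1), ramp_of_le (by linarith : u - 3 ≤ 0)]
  ring

theorem piecewiseLin_four : piecewiseLin x₀ x₁ x₂ x₃ x₄ 4 = x₄ := by
  rw [piecewiseLin, ramp_of_ge (by norm_num), ramp_of_ge (by norm_num), ramp_of_ge (by norm_num),
    ramp_of_ge (by norm_num)]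
  ring

theorem ramp_sum {u : ℝ} (h0 : 0 ≤ u) (h4 : u ≤ 4) :
    ramp u + ramp (u - 1) + ramp (u - 2) + ramp (u - 3) = u := by
  rcases le_total u 1 with h | h
  · rw [ramp_of_mem h0 h, ramp_of_le (by linarith : u - 1 ≤ 0),
      ramp_of_le (by linarith : u - 2 ≤ 0), ramp_of_le (by linarith : u - 3 ≤ 0)]
    ring
  rw [ramp_of_ge h]
  rcases le_total u 2 with h' | h'
  · rw [ramp_of_mem (by linarith) (by linarith : u - 1 ≤ 1),
      ramp_of_le (by linarith : u - 2 ≤ 0), ramp_of_le (by linarith : u - 3 ≤ 0)]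
    ring
  rw [ramp_of_ge (by linarith : 1 ≤ u - 1)]
  rcases le_total u 3 with h'' | h''
  · rw [ramp_of_mem (by linarith) (by linarith : u - 2 ≤ 1), ramp_of_le (by linarith : u - 3 ≤ 0)]
    ring
  rw [ramp_of_ge (by linarith : 1 ≤ u - 2), ramp_of_mem (by linarith) (by linarith : u - 3 ≤ 1)]
  ring

/-- The ramps are monotone and sum to the identity on `[0,4]`. With `m` the least increment, the
function therefore grows by at least `m * (v - u)` from `u` to `v`. -/
theorem strictMonoOn_piecewiseLin (h01 : x₀ < x₁) (h12 : x₁ < x₂) (h23 : x₂ < x₃) (h34 : x₃ < x₄) :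
    StrictMonoOn (piecewiseLin x₀ x₁ x₂ x₃ x₄) (Icc 0 4) := by
  intro u hu v hv huv
  obtain ⟨m, hm, hm0, hm1, hm2, hm3⟩ : ∃ m, 0 < m ∧ m ≤ x₁ - x₀ ∧ m ≤ x₂ - x₁ ∧ m ≤ x₃ - x₂ ∧
      m ≤ x₄ - x₃ :=
    ⟨min (min (x₁ - x₀) (x₂ - x₁)) (min (x₃ - x₂) (x₄ - x₃)),
      lt_min (lt_min (by linarith) (by linarith)) (lt_min (by linarith) (by linarith)),
      (min_le_left _ _).trans (min_le_left _ _), (min_le_left _ _).trans (min_le_right _ _),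
      (min_le_right _ _).trans (min_le_left _ _), (min_le_right _ _).trans (min_le_right _ _)⟩
  have e1 := ramp_sum hu.1 hu.2
  have e2 := ramp_sum hv.1 hv.2
  have r0 := mul_le_mul_of_nonneg_right hm0 (sub_nonneg.2 (ramp_mono huv.le))
  have r1 := mul_le_mul_of_nonneg_right hm1
    (sub_nonneg.2 (ramp_mono (by linarith : u - 1 ≤ v - 1)))
  have r2 := mul_le_mul_of_nonneg_right hm2
    (sub_nonneg.2 (ramp_mono (by linarith : u - 2 ≤ v - 2)))
  have r3 := mul_le_mul_of_nonneg_right hm3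
    (sub_nonneg.2 (ramp_mono (by linarith : u - 3 ≤ v - 3)))
  have key : 0 < m * (v - u) := mul_pos hm (by linarith)
  rw [← e1, ← e2] at key
  unfold piecewiseLin
  linarith

end PiecewiseLin

/-- A parametrization of the circle by two copies of `[0,4]`, exchanged by the antipodal map, in
which `[0,1]` and `[2,3]` parametrize the arcs around `±p` and `±q` linearly. -/
structure IsArcParam (p q : Circle) (t s : ℝ) (E : Bool × Icc (0 : ℝ) 4 → Circle) : Prop where
  continuous : Continuous E
  surjective : Function.Surjective E
  eq_iff : ∀ ε u ε' u', E (ε, u) = E (ε', u') ↔ (ε = ε' ∧ u = u') ∨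
    (ε' = !ε ∧ (((u : ℝ) = 0 ∧ (u' : ℝ) = 4) ∨ ((u : ℝ) = 4 ∧ (u' : ℝ) = 0)))
  neg : ∀ ε u, E (!ε, u) = -E (ε, u)
  le_p_iff : ∀ ε u, t ≤ |circInner p (E (ε, u))| ↔ (u : ℝ) ≤ 1 ∨ (u : ℝ) = 4
  p_le_iff : ∀ ε u, |circInner p (E (ε, u))| ≤ t ↔ (u : ℝ) = 0 ∨ 1 ≤ (u : ℝ)
  le_q_iff : ∀ ε u, s ≤ |circInner q (E (ε, u))| ↔ 2 ≤ (u : ℝ) ∧ (u : ℝ) ≤ 3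
  q_le_iff : ∀ ε u, |circInner q (E (ε, u))| ≤ s ↔ (u : ℝ) ≤ 2 ∨ 3 ≤ (u : ℝ)
  refl_p : ∀ ε (u u' : Icc (0 : ℝ) 4), (u : ℝ) ≤ 1 → (u' : ℝ) = 1 - u → circRefl p (E (ε, u)) = E (!ε, u')
  refl_q : ∀ ε (u u' : Icc (0 : ℝ) 4), 2 ≤ (u : ℝ) → (u : ℝ) ≤ 3 → (u' : ℝ) = 5 - u →
    circRefl q (E (ε, u)) = E (!ε, u')

/-- The end `4` of one copy is the start `0` of the other, so the exceptional parameter in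
`le_p_iff` can be avoided. -/
theorem IsArcParam.exists_le_one {p q : Circle} {t s : ℝ} {E : Bool × Icc (0 : ℝ) 4 → Circle}
    (hE : IsArcParam p q t s E) {z : Circle} (hz : t ≤ |circInner p z|) :
    ∃ (ε : Bool) (u : Icc (0 : ℝ) 4), (u : ℝ) ≤ 1 ∧ E (ε, u) = z := by
  obtain ⟨⟨ε, u⟩, rfl⟩ := hE.surjective z
  rcases (hE.le_p_iff ε u).1 hz with h | h
  · exact ⟨ε, u, h, rfl⟩
  · exact ⟨!ε, ⟨0, by norm_num⟩, by norm_num, (hE.eq_iff _ _ _ _).2 (by simp [h])⟩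

/-- Any two admissible patterns of boundary identifications are carried to each other by a
homeomorphism of the circle. -/
theorem exists_circle_homeo {p q p' q' : Circle} {t s t' s' : ℝ}
    {E E' : Bool × Icc (0 : ℝ) 4 → Circle} (hE : IsArcParam p q t s E)
    (hE' : IsArcParam p' q' t' s' E') :
    ∃ f : Circle ≃ₜ Circle, ∀ z z', BdRel p q t s z z' ↔ BdRel p' q' t' s' (f z) (f z') := by
  -- The fibres of an arc parametrization are given by a condition on parameters that does not
  -- mention `p`, `q`, `t`, `s`, and the same holds for the arcs, reflections and antipodal map.
  obtain ⟨f, hf⟩ := nonempty_homeomorph_of_same_fibres hE.continuous hE'.continuous hE.surjective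
    hE'.surjective (by
      rintro ⟨ε, u⟩ ⟨ε', u'⟩
      rw [hE.eq_iff, hE'.eq_iff])
  have hneg : ∀ z, f (-z) = -f z := by
    intro z
    obtain ⟨⟨ε, u⟩, rfl⟩ := hE.surjective z
    rw [← hE.neg, hf, hf, hE'.neg]
  have h1 : ∀ z, t ≤ |circInner p z| ↔ t' ≤ |circInner p' (f z)| := by
    intro z
    obtain ⟨⟨ε, u⟩, rfl⟩ := hE.surjective z
    rw [hf, hE.le_p_iff, hE'.le_p_iff]
  have h2 : ∀ z, |circInner p z| ≤ t ↔ |circInner p' (f z)| ≤ t' := by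
    intro z
    obtain ⟨⟨ε, u⟩, rfl⟩ := hE.surjective z
    rw [hf, hE.p_le_iff, hE'.p_le_iff]
  have h3 : ∀ z, s ≤ |circInner q z| ↔ s' ≤ |circInner q' (f z)| := by
    intro z
    obtain ⟨⟨ε, u⟩, rfl⟩ := hE.surjective z
    rw [hf, hE.le_q_iff, hE'.le_q_iff]
  have h4 : ∀ z, |circInner q z| ≤ s ↔ |circInner q' (f z)| ≤ s' := by
    intro z
    obtain ⟨⟨ε, u⟩, rfl⟩ := hE.surjective z
    rw [hf, hE.q_le_iff, hE'.q_le_iff]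
  have h5 : ∀ z, t ≤ |circInner p z| → f (circRefl p z) = circRefl p' (f z) := by
    intro z hz
    obtain ⟨ε, u, hu, rfl⟩ := hE.exists_le_one hz
    have hu' : (1 - u : ℝ) ∈ Icc (0 : ℝ) 4 := ⟨by linarith, by linarith [u.2.1]⟩
    rw [hf, hE.refl_p ε u ⟨1 - u, hu'⟩ hu rfl, hE'.refl_p ε u ⟨1 - u, hu'⟩ hu rfl, hf]
  have h6 : ∀ z, s ≤ |circInner q z| → f (circRefl q z) = circRefl q' (f z) := by
    intro z hz
    obtain ⟨⟨ε, u⟩, rfl⟩ := hE.surjective z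
    obtain ⟨hu, hu3⟩ := (hE.le_q_iff ε u).1 hz
    have hu' : (5 - u : ℝ) ∈ Icc (0 : ℝ) 4 := ⟨by linarith, by linarith⟩
    rw [hf, hE.refl_q ε u ⟨5 - u, hu'⟩ hu hu3 rfl, hE'.refl_q ε u ⟨5 - u, hu'⟩ hu hu3 rfl, hf]
  refine ⟨f, fun z z' => ?_⟩
  unfold BdRel
  rw [← h1, ← h2, ← h3, ← h4]
  refine or_congr (and_congr_right fun _ => ?_) (or_congr (and_congr_right fun h => ?_)
    (and_congr_right fun h => ?_))
  · rw [← hneg, f.injective.eq_iff]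
  · rw [← h5 z h, ← hneg, f.injective.eq_iff, f.injective.eq_iff]
  · rw [← h6 z h, ← hneg, f.injective.eq_iff, f.injective.eq_iff]

/-! ### Existence of the parametrization -/

theorem cos_le_abs_cos {a v : ℝ} (ha : a < Real.pi / 2) (hv : |v| ≤ a) :
    Real.cos a ≤ |Real.cos v| := by
  rw [← Real.cos_abs v]
  exact (Real.cos_le_cos_of_nonneg_of_le_pi (abs_nonneg v) (by linarith [Real.pi_pos]) hv).trans
    (le_abs_self _)

theorem cos_lt_abs_cos {a v : ℝ} (ha : a < Real.pi / 2) (hv : |v| < a) :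
    Real.cos a < |Real.cos v| := by
  rw [← Real.cos_abs v]
  exact (Real.cos_lt_cos_of_nonneg_of_le_pi (abs_nonneg v) (by linarith [Real.pi_pos]) hv).trans_le
    (le_abs_self _)

theorem abs_cos_lt_cos {a v : ℝ} (ha : 0 < a) (hv : a < |v|) (hv' : |v| < Real.pi - a) :
    |Real.cos v| < Real.cos a := by
  rw [← Real.cos_abs v, abs_lt]
  constructor
  · rw [← Real.cos_pi_sub]
    exact Real.cos_lt_cos_of_nonneg_of_le_pi (abs_nonneg v) (by linarith) hv'
  · exact Real.cos_lt_cos_of_nonneg_of_le_pi ha.le (by linarith) hv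

/-- With `a = arccos t` and `b = arccos s` the arcs have half-widths `a` and `b`. Disjointness
forces the cyclic order: arc of p, arc of ±q, arc of −p. -/
theorem IsAdmissible.exists_angles {p q : Circle} {t s : ℝ} (h : IsAdmissible p q t s) :
    ∃ α β a b : ℝ, 0 < a ∧ a < Real.pi / 2 ∧ 0 < b ∧ b < Real.pi / 2 ∧ Real.cos a = t ∧
      Real.cos b = s ∧ p = Circle.exp α ∧ (q = Circle.exp β ∨ q = -Circle.exp β) ∧
      α + a < β - b ∧ β + b < α - a + Real.pi := by
  obtain ⟨α, rfl⟩ := Circle.exp_surjective p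
  obtain ⟨β₀, rfl⟩ := Circle.exp_surjective q
  have ha : 0 < Real.arccos t ∧ Real.arccos t < Real.pi / 2 :=
    ⟨Real.arccos_pos.2 h.t_lt_one, Real.arccos_lt_pi_div_two.2 h.t_pos⟩
  have hb : 0 < Real.arccos s ∧ Real.arccos s < Real.pi / 2 :=
    ⟨Real.arccos_pos.2 h.s_lt_one, Real.arccos_lt_pi_div_two.2 h.s_pos⟩
  have hca : Real.cos (Real.arccos t) = t :=
    Real.cos_arccos (by linarith [h.t_pos]) h.t_lt_one.le
  have hcb : Real.cos (Real.arccos s) = s :=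
    Real.cos_arccos (by linarith [h.s_pos]) h.s_lt_one.le
  set a := Real.arccos t
  set b := Real.arccos s
  -- Only the line spanned by `q` matters, so its angle may be moved by multiples of `π` into `[α, α
  -- + π)`.
  obtain ⟨k, hk, -⟩ := existsUnique_add_zsmul_mem_Ico Real.pi_pos β₀ α
  set β := β₀ + k • Real.pi with hβ
  have hq : Circle.exp β₀ = Circle.exp β ∨ Circle.exp β₀ = -Circle.exp β := by
    rcases Int.even_or_odd' k with ⟨m, hm | hm⟩
    · left
      rw [hβ, Circle.exp_eq_exp]
      exact ⟨-m, by rw [hm, zsmul_eq_mul]; push_cast; ring⟩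
    · right
      rw [← exp_add_pi, Circle.exp_eq_exp]
      exact ⟨-m - 1, by rw [hβ, hm, zsmul_eq_mul]; push_cast; ring⟩
  have hdisj : ∀ φ, Real.cos a ≤ |Real.cos (φ - α)| → |Real.cos (φ - β)| < Real.cos b := by
    intro φ hφ
    have := h.disjoint (Circle.exp φ) (by rw [circInner_exp, ← hca]; exact hφ)
    rw [hcb]
    rcases hq with hq | hq
    · rwa [hq, circInner_exp] at this
    · rwa [hq, circInner_neg_left, abs_neg, circInner_exp] at this
  refine ⟨α, β, a, b, ha.1, ha.2, hb.1, hb.2, hca, hcb, rfl, hq, ?_, ?_⟩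
  · by_contra hcon
    push Not at hcon
    have h1 := min_le_left (α + a) β
    have h2 := min_le_right (α + a) β
    have h3 : α ≤ min (α + a) β := le_min (by linarith [ha.1]) hk.1
    have h4 : β - b ≤ min (α + a) β := le_min hcon (by linarith [hb.1])
    -- If the arcs around `α` and `β` met, this angle would lie in both; the second inequality uses
    -- the arc around `α + π` in the same way.
    refine (hdisj (min (α + a) β) (cos_le_abs_cos ha.2 ?_)).not_ge (cos_le_abs_cos hb.2 ?_)
    · rw [abs_le]; constructor <;> linarith [ha.1]
    · rw [abs_le]; constructor <;> linarith [hb.1]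
  · by_contra hcon
    push Not at hcon
    have h1 := le_max_left (α - a + Real.pi) β
    have h2 := le_max_right (α - a + Real.pi) β
    have h3 : max (α - a + Real.pi) β ≤ α + Real.pi := max_le (by linarith [ha.1]) hk.2.le
    have h4 : max (α - a + Real.pi) β ≤ β + b := max_le hcon (by linarith [hb.1])
    refine (hdisj (max (α - a + Real.pi) β) ?_).not_ge (cos_le_abs_cos hb.2 ?_)
    · rw [← abs_neg, ← Real.cos_sub_pi]
      refine cos_le_abs_cos ha.2 ?_
      rw [abs_le]; constructor <;> linarith [ha.1]
    · rw [abs_le]; constructor <;> linarith [hb.1]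

/-- The sign `±1` in the circle attached to a Boolean. -/
noncomputable def boolSign (ε : Bool) : Circle := if ε then 1 else -1

theorem boolSign_not (ε : Bool) : boolSign (!ε) = -boolSign ε := by
  cases ε <;> simp [boolSign]

theorem boolSign_inv (ε : Bool) : (boolSign ε)⁻¹ = boolSign ε := by
  cases ε <;> simp [boolSign]

theorem abs_circInner_boolSign (p z : Circle) (ε : Bool) :
    |circInner p (boolSign ε * z)| = |circInner p z| := by
  cases ε <;> simp [boolSign, circInner_neg_right]

set_option maxHeartbeats 1000000 in
theorem IsAdmissible.exists_isArcParam {p q : Circle} {t s : ℝ} (h : IsAdmissible p q t s) :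
    ∃ E, IsArcParam p q t s E := by
  obtain ⟨α, β, a, b, ha0, ha1, hb0, hb1, rfl, rfl, rfl, hq, h12, h34⟩ := h.exists_angles
  have hqq : q * q = Circle.exp (2 * β) := by
    rw [two_mul, Circle.exp_add]
    rcases hq with rfl | rfl <;> simp
  have hqi : ∀ φ, |circInner q (Circle.exp φ)| = |Real.cos (φ - β)| := by
    intro φ
    rcases hq with rfl | rfl
    · rw [circInner_exp]
    · rw [circInner_neg_left, abs_neg, circInner_exp]
  -- The nodes are the ends of the two arcs, closed up by the antipode of the starting point. One
  -- copy of `[0,4]` thus covers a half circle, and the sign `boolSign` gives the other half.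
  let x : ℝ → ℝ := piecewiseLin (α - a) (α + a) (β - b) (β + b) (α - a + Real.pi)
  have hmono : StrictMonoOn x (Icc 0 4) := strictMonoOn_piecewiseLin (by linarith) h12
    (by linarith) h34
  have hxc : Continuous x := continuous_piecewiseLin
  have x0 : x 0 = α - a := by simp only [x]; rw [piecewiseLin_first le_rfl zero_le_one]; ring
  have x1 : x 1 = α + a := by simp only [x]; rw [piecewiseLin_first zero_le_one le_rfl]; ring
  have x2 : x 2 = β - b := by
    simp only [x]; rw [piecewiseLin_third le_rfl (by norm_num)]; ring
  have x3 : x 3 = β + b := by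
    simp only [x]; rw [piecewiseLin_third (by norm_num) le_rfl]; ring
  have x4 : x 4 = α - a + Real.pi := piecewiseLin_four
  have m0 : (0 : ℝ) ∈ Icc (0 : ℝ) 4 := by norm_num
  have m1 : (1 : ℝ) ∈ Icc (0 : ℝ) 4 := by norm_num
  have m2 : (2 : ℝ) ∈ Icc (0 : ℝ) 4 := by norm_num
  have m3 : (3 : ℝ) ∈ Icc (0 : ℝ) 4 := by norm_num
  have m4 : (4 : ℝ) ∈ Icc (0 : ℝ) 4 := by norm_num
  have xmem : ∀ u ∈ Icc (0 : ℝ) 4, α - a ≤ x u ∧ x u ≤ α - a + Real.pi := by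
    intro u hu
    rw [← x4, ← x0, hmono.le_iff_le m0 hu, hmono.le_iff_le hu m4]
    exact hu
  let E : Bool × Icc (0 : ℝ) 4 → Circle := fun w => boolSign w.1 * Circle.exp (x w.2)
  have hneg : ∀ ε u, E (!ε, u) = -E (ε, u) := fun ε u => by
    simp only [E, boolSign_not, neg_mul]
  have hpE : ∀ ε u, |circInner (Circle.exp α) (E (ε, u))| = |Real.cos (x u - α)| := fun ε u => by
    simp only [E, abs_circInner_boolSign, circInner_exp]
  have hqE : ∀ ε u, |circInner q (E (ε, u))| = |Real.cos (x u - β)| := fun ε u => by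
    simp only [E, abs_circInner_boolSign, hqi]
  have hrefl : ∀ (r : Circle) (γ : ℝ) ε (u u' : Icc (0 : ℝ) 4), r * r = Circle.exp (2 * γ) →
      x u' = 2 * γ - x u → circRefl r (E (ε, u)) = E (!ε, u') := by
    intro r γ ε u u' hr hu
    rw [hneg]
    simp only [E, circRefl]
    rw [hr, hu, Circle.exp_sub, mul_inv, boolSign_inv, div_eq_mul_inv]
    congr 1
    exact mul_left_comm _ _ _
  have hsame : ∀ u u' : Icc (0 : ℝ) 4, Circle.exp (x u) = Circle.exp (x u') → u = u' := by
    intro u u' huu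
    have hu := xmem u u.2
    have hu' := xmem u' u'.2
    refine Subtype.ext (hmono.injOn u.2 u'.2 ?_)
    exact Circle.exp_injOn_Icc (a := α - a) (b := α - a + Real.pi) (by linarith [Real.pi_pos])
      hu hu' huu
  have hopp : ∀ u u' : Icc (0 : ℝ) 4, Circle.exp (x u) = -Circle.exp (x u') →
      ((u : ℝ) = 0 ∧ (u' : ℝ) = 4) ∨ ((u : ℝ) = 4 ∧ (u' : ℝ) = 0) := by
    intro u u' huu
    have hu := xmem u u.2
    have hu' := xmem u' u'.2
    rw [← exp_add_pi, Circle.exp_eq_exp] at huu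
    obtain ⟨m, hm⟩ := huu
    -- All angles lie in an interval of length `π`, so two of them can differ by an odd multiple of
    -- `π` only if they are its two ends.
    have hm1 : (-1 : ℤ) ≤ m := by
      by_contra hcon
      have : (m : ℝ) ≤ -2 := by exact_mod_cast (by omega : m ≤ -2)
      nlinarith [Real.pi_pos]
    have hm2 : m ≤ 0 := by
      by_contra hcon
      have : (1 : ℝ) ≤ m := by exact_mod_cast (by omega : 1 ≤ m)
      nlinarith [Real.pi_pos]
    obtain rfl | rfl : m = -1 ∨ m = 0 := by omega
    · left
      push_cast at hm
      exact ⟨hmono.injOn u.2 m0 (by rw [x0]; linarith), hmono.injOn u'.2 m4 (by rw [x4]; linarith)⟩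
    · right
      push_cast at hm
      exact ⟨hmono.injOn u.2 m4 (by rw [x4]; linarith), hmono.injOn u'.2 m0 (by rw [x0]; linarith)⟩
  have hcross : ∀ (ε : Bool) (u u' : Icc (0 : ℝ) 4), (u : ℝ) = 0 → (u' : ℝ) = 4 →
      E (ε, u) = E (!ε, u') := by
    intro ε u u' hu hu'
    rw [hneg]
    simp only [E]
    rw [hu, hu', x0, x4, exp_add_pi, mul_neg, neg_neg]
  refine ⟨E, ?_, ?_, ?_, hneg, ?_, ?_, ?_, ?_, ?_, ?_⟩
  · have hb : Continuous boolSign := continuous_of_discreteTopology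
    have hx : Continuous fun w : Bool × Icc (0 : ℝ) 4 => Circle.exp (x w.2) :=
      Circle.exp.continuous.comp (hxc.comp (by fun_prop))
    exact (hb.comp continuous_fst).mul hx
  · intro z
    obtain ⟨φ, rfl⟩ := Circle.exp_surjective z
    obtain ⟨k, hk, -⟩ := existsUnique_add_zsmul_mem_Ico Real.pi_pos φ (α - a)
    have hsurj := intermediate_value_Icc (show (0 : ℝ) ≤ 4 by norm_num) hxc.continuousOn
    rw [x0, x4] at hsurj
    obtain ⟨u, hu, hux⟩ := hsurj ⟨hk.1, hk.2.le⟩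
    rcases Int.even_or_odd' k with ⟨m, hm | hm⟩
    · refine ⟨(true, ⟨u, hu⟩), ?_⟩
      simp only [E, boolSign, if_true, one_mul]
      rw [hux, Circle.exp_eq_exp]
      exact ⟨m, by rw [hm, zsmul_eq_mul]; push_cast; ring⟩
    · refine ⟨(false, ⟨u, hu⟩), ?_⟩
      simp only [E, boolSign, Bool.false_eq_true, if_false, neg_mul, one_mul]
      rw [← exp_add_pi, hux, Circle.exp_eq_exp]
      exact ⟨m + 1, by rw [hm, zsmul_eq_mul]; push_cast; ring⟩
  · intro ε u ε' u'
    constructor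
    · intro hE
      by_cases hε : ε = ε'
      · subst hε
        simp only [E] at hE
        exact Or.inl ⟨rfl, hsame u u' (mul_left_cancel hE)⟩
      · obtain rfl : ε' = !ε := Bool.eq_not.2 fun hh => hε hh.symm
        rw [hneg] at hE
        simp only [E] at hE
        rw [← mul_neg] at hE
        exact Or.inr ⟨rfl, hopp u u' (mul_left_cancel hE)⟩
    · rintro (⟨rfl, rfl⟩ | ⟨rfl, ⟨hu, hu'⟩ | ⟨hu, hu'⟩⟩)
      · rfl
      · exact hcross ε u u' hu hu'
      · have := hcross (!ε) u' u hu' hu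
        rw [Bool.not_not] at this
        exact this.symm
  · intro ε u
    have hu := xmem u u.2
    rw [hpE]
    constructor
    · intro hle
      by_contra hcon
      push Not at hcon
      have h1 : x 1 < x u := (hmono.lt_iff_lt m1 u.2).2 hcon.1
      have h4 : x u < x 4 := (hmono.lt_iff_lt u.2 m4).2 (lt_of_le_of_ne u.2.2 hcon.2)
      rw [x1] at h1
      rw [x4] at h4
      refine hle.not_gt (abs_cos_lt_cos ha0 ?_ ?_) <;> rw [abs_of_nonneg (by linarith)] <;> linarith
    · rintro (h1 | h4)
      · have h1 : x u ≤ x 1 := (hmono.le_iff_le u.2 m1).2 h1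
        rw [x1] at h1
        exact cos_le_abs_cos ha1 (abs_le.2 ⟨by linarith, by linarith⟩)
      · rw [h4, x4, show α - a + Real.pi - α = Real.pi - a by ring, Real.cos_pi_sub, abs_neg]
        exact le_abs_self _
  · intro ε u
    have hu := xmem u u.2
    have hca : 0 ≤ Real.cos a := Real.cos_nonneg_of_mem_Icc ⟨by linarith, by linarith⟩
    rw [hpE]
    constructor
    · intro hle
      by_contra hcon
      push Not at hcon
      have h1 : x u < x 1 := (hmono.lt_iff_lt u.2 m1).2 hcon.2
      have h0 : x 0 < x u := (hmono.lt_iff_lt m0 u.2).2 (lt_of_le_of_ne u.2.1 (Ne.symm hcon.1))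
      rw [x1] at h1
      rw [x0] at h0
      exact hle.not_gt (cos_lt_abs_cos ha1 (abs_lt.2 ⟨by linarith, by linarith⟩))
    · rintro (h0 | h1)
      · rw [h0, x0, show α - a - α = -a by ring, Real.cos_neg, abs_of_nonneg hca]
      · rcases h1.eq_or_lt with h1 | h1
        · rw [← h1, x1, add_sub_cancel_left, abs_of_nonneg hca]
        rcases u.2.2.eq_or_lt with h4 | h4
        · rw [h4, x4, show α - a + Real.pi - α = Real.pi - a by ring, Real.cos_pi_sub, abs_neg,
            abs_of_nonneg hca]
        have h1 : x 1 < x u := (hmono.lt_iff_lt m1 u.2).2 h1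
        have h4 : x u < x 4 := (hmono.lt_iff_lt u.2 m4).2 h4
        rw [x1] at h1
        rw [x4] at h4
        refine (abs_cos_lt_cos ha0 ?_ ?_).le <;> rw [abs_of_nonneg (by linarith)] <;> linarith
  · intro ε u
    have hu := xmem u u.2
    rw [hqE, ← hmono.le_iff_le m2 u.2, ← hmono.le_iff_le u.2 m3, x2, x3]
    constructor
    · intro hle
      by_contra hcon
      rw [not_and_or, not_le, not_le] at hcon
      rcases hcon with hcon | hcon
      · refine hle.not_gt (abs_cos_lt_cos hb0 ?_ ?_) <;> rw [abs_of_nonpos (by linarith)] <;>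
          linarith
      · refine hle.not_gt (abs_cos_lt_cos hb0 ?_ ?_) <;> rw [abs_of_nonneg (by linarith)] <;>
          linarith
    · rintro ⟨h1, h2⟩
      exact cos_le_abs_cos hb1 (abs_le.2 ⟨by linarith, by linarith⟩)
  · intro ε u
    have hu := xmem u u.2
    have hcb : 0 ≤ Real.cos b := Real.cos_nonneg_of_mem_Icc ⟨by linarith, by linarith⟩
    rw [hqE, ← hmono.le_iff_le m3 u.2, ← hmono.le_iff_le u.2 m2, x2, x3]
    constructor
    · intro hle
      by_contra hcon
      rw [not_or, not_le, not_le] at hcon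
      exact hle.not_gt (cos_lt_abs_cos hb1 (abs_lt.2 ⟨by linarith, by linarith⟩))
    · rintro (h1 | h1)
      · rcases h1.eq_or_lt with h1 | h1
        · rw [h1, show β - b - β = -b by ring, Real.cos_neg, abs_of_nonneg hcb]
        · refine (abs_cos_lt_cos hb0 ?_ ?_).le <;> rw [abs_of_nonpos (by linarith)] <;> linarith
      · rcases h1.eq_or_lt with h1 | h1
        · rw [← h1, add_sub_cancel_left, abs_of_nonneg hcb]
        · refine (abs_cos_lt_cos hb0 ?_ ?_).le <;> rw [abs_of_nonneg (by linarith)] <;> linarith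
  · intro ε u u' hu hu'
    refine hrefl _ α ε u u' (by rw [two_mul, Circle.exp_add]) ?_
    simp only [x]
    rw [hu', piecewiseLin_first u.2.1 hu, piecewiseLin_first (by linarith) (by linarith [u.2.1])]
    ring
  · intro ε u u' hu2 hu3 hu'
    refine hrefl _ β ε u u' hqq ?_
    simp only [x]
    rw [hu', piecewiseLin_third hu2 hu3, piecewiseLin_third (by linarith) (by linarith)]
    ring

/-- The disc model is unique up to homeomorphism. -/
theorem IsDiscModel.nonempty_homeomorph {Z Z' : Type*} [TopologicalSpace Z] [TopologicalSpace Z']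
    [T2Space Z] [T2Space Z'] {p q p' q' : Circle} {t s t' s' : ℝ} {G : Circle × I → Z}
    {G' : Circle × I → Z'} (hG : IsDiscModel p q t s G) (hG' : IsDiscModel p' q' t' s' G')
    (h : IsAdmissible p q t s) (h' : IsAdmissible p' q' t' s') : Nonempty (Z ≃ₜ Z') := by
  obtain ⟨E, hE⟩ := h.exists_isArcParam
  obtain ⟨E', hE'⟩ := h'.exists_isArcParam
  obtain ⟨f, hf⟩ := exists_circle_homeo hE hE'
  obtain ⟨Φ, -⟩ := nonempty_homeomorph_of_same_fibres hG.continuous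
    -- The circle homeomorphism is extended radially, keeping the level.
    (g := fun x => G' (f x.1, x.2)) (hG'.continuous.comp (by fun_prop)) hG.surjective (by
      intro a
      obtain ⟨⟨z, l⟩, rfl⟩ := hG'.surjective a
      exact ⟨(f.symm z, l), by simp⟩) (by
      rintro ⟨z, l⟩ ⟨z', l'⟩
      rw [hG.eq_iff, hG'.eq_iff, f.injective.eq_iff, hf])
  exact ⟨Φ⟩

/-! ### Disc models from star-shaped plane regions -/

/-- Positively homogeneous even functions on the plane; the unit balls are the regions
that we use. -/
structure IsGauge (g : ℂ → ℝ) : Prop where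
  continuous : Continuous g
  smul : ∀ (a : ℝ) w, 0 ≤ a → g (a * w) = a * g w
  pos : ∀ w, w ≠ 0 → 0 < g w
  neg : ∀ w, g (-w) = g w

/-- Polar coordinates on the unit ball of a gauge. -/
noncomputable def gaugePolar (g : ℂ → ℝ) (x : Circle × I) : ℂ :=
  ((x.2 / g x.1 : ℝ) : ℂ) * x.1

/-- The reflection of the plane that changes the sign of the component along `p`. -/
noncomputable def planeRefl (p : Circle) (w : ℂ) : ℂ := -(p * p * conj w)

theorem coe_circRefl (p z : Circle) : (circRefl p z : ℂ) = planeRefl p z := by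
  have e : ∀ z : Circle, ((-z : Circle) : ℂ) = -(z : ℂ) := fun _ => rfl
  rw [circRefl, planeRefl, e, Circle.coe_mul, Circle.coe_mul, Circle.coe_inv_eq_conj]

theorem planeRefl_real_mul (p : Circle) (a : ℝ) (w : ℂ) :
    planeRefl p (a * w) = a * planeRefl p w := by
  simp only [planeRefl, map_mul, Complex.conj_ofReal]
  ring

theorem planeRefl_neg (p : Circle) (w : ℂ) : planeRefl p (-w) = -planeRefl p w := by
  simp only [planeRefl, map_neg]
  ring

namespace IsGauge

variable {g : ℂ → ℝ}

theorem circle_pos (hg : IsGauge g) (z : Circle) : 0 < g z := hg.pos z z.coe_ne_zero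

theorem continuous_gaugePolar (hg : IsGauge g) : Continuous (gaugePolar g) := by
  have h1 : Continuous fun x : Circle × I => (x.1 : ℂ) := continuous_subtype_val.comp continuous_fst
  have h2 : Continuous fun x : Circle × I => g x.1 := hg.continuous.comp h1
  have h3 : Continuous fun x : Circle × I => (x.2 / g x.1 : ℝ) :=
    Continuous.div (by fun_prop) h2 fun x => (hg.circle_pos x.1).ne'
  exact (Complex.continuous_ofReal.comp h3).mul h1

theorem apply_gaugePolar (hg : IsGauge g) (z : Circle) (l : I) : g (gaugePolar g (z, l)) = l := by
  have h := hg.circle_pos z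
  rw [gaugePolar, hg.smul _ _ (div_nonneg l.2.1 h.le)]
  exact div_mul_cancel₀ _ h.ne'

theorem gaugePolar_zero (g : ℂ → ℝ) (z : Circle) : gaugePolar g (z, 0) = 0 := by
  simp [gaugePolar]

theorem gaugePolar_eq_iff (hg : IsGauge g) (z z' : Circle) (l l' : I) :
    gaugePolar g (z, l) = gaugePolar g (z', l') ↔ l = l' ∧ (l = 0 ∨ z = z') := by
  constructor
  · intro h
    have hl : l = l' := by
      ext
      rw [← hg.apply_gaugePolar z l, h, hg.apply_gaugePolar]
    subst hl
    refine ⟨rfl, or_iff_not_imp_left.2 fun hl => ?_⟩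
    have hl0 : (l : ℝ) ≠ 0 := fun hh => hl (Subtype.ext hh)
    have hlp : 0 < (l : ℝ) := lt_of_le_of_ne l.2.1 (Ne.symm hl0)
    have h1 := congrArg (fun w : ℂ => ‖w‖) h
    simp only [gaugePolar, norm_mul, Complex.norm_real, Circle.norm_coe, mul_one,
      Real.norm_eq_abs] at h1
    rw [abs_of_pos (div_pos hlp (hg.circle_pos z)), abs_of_pos (div_pos hlp (hg.circle_pos z'))]
      at h1
    simp only [gaugePolar] at h
    rw [h1] at h
    have h0 : ((l / g z' : ℝ) : ℂ) ≠ 0 :=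
      Complex.ofReal_ne_zero.2 (div_pos hlp (hg.circle_pos z')).ne'
    exact Circle.ext (mul_left_cancel₀ h0 h)
  · rintro ⟨rfl, rfl | rfl⟩
    · rw [gaugePolar_zero, gaugePolar_zero]
    · rfl

theorem exists_gaugePolar (hg : IsGauge g) {w : ℂ} (hw : g w ≤ 1) : ∃ z l, gaugePolar g (z, l) = w := by
  by_cases h0 : w = 0
  · exact ⟨1, 0, by rw [gaugePolar_zero, h0]⟩
  have hn : 0 < ‖w‖ := norm_pos_iff.2 h0
  have hgw := hg.pos w h0
  obtain ⟨z, hz⟩ : ∃ z : Circle, ((‖w‖ : ℝ) : ℂ) * z = w := by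
    have hne : ((‖w‖ : ℝ) : ℂ) ≠ 0 := Complex.ofReal_ne_zero.2 hn.ne'
    refine ⟨⟨w / ‖w‖, mem_sphere_zero_iff_norm.2 ?_⟩, ?_⟩
    · rw [norm_div, Complex.norm_real, norm_norm, div_self hn.ne']
    · exact mul_div_cancel₀ w hne
  refine ⟨z, ⟨g w, hgw.le, hw⟩, ?_⟩
  have h1 : g w = ‖w‖ * g z := by
    conv_lhs => rw [← hz]
    rw [hg.smul _ _ hn.le]
  simp only [gaugePolar]
  rw [h1, mul_div_cancel_right₀ _ (hg.circle_pos z).ne', hz]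

theorem gaugePolar_of_eq {z z' : Circle} (h : g z' = g z) (l : I) :
    gaugePolar g (z', l) = ((l / g z : ℝ) : ℂ) * z' := by
  simp only [gaugePolar, h]

/-- Quotients of the unit ball of a gauge by boundary identifications of the model type are
disc models. -/
theorem isDiscModel (hg : IsGauge g) {Z : Type*} [TopologicalSpace Z] {p q : Circle} {t s : ℝ} {F : ℂ → Z}
    {A P Q : ℂ → Prop} (hF : ContinuousOn F {w | g w ≤ 1})
    (hsurj : ∀ a, ∃ w, g w ≤ 1 ∧ F w = a)
    (hA : ∀ z l, A (gaugePolar g (z, l)) ↔ l = 1 ∧ |circInner p z| ≤ t ∧ |circInner q z| ≤ s)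
    (hP : ∀ z l, P (gaugePolar g (z, l)) ↔ l = 1 ∧ t ≤ |circInner p z|)
    (hQ : ∀ z l, Q (gaugePolar g (z, l)) ↔ l = 1 ∧ s ≤ |circInner q z|)
    (hgp : ∀ z, t ≤ |circInner p z| → g (circRefl p z) = g z)
    (hgq : ∀ z, s ≤ |circInner q z| → g (circRefl q z) = g z)
    (hadm : IsAdmissible p q t s)
    (hfib : ∀ w w', g w ≤ 1 → g w' ≤ 1 → (F w = F w' ↔ w' = w ∨ (A w ∧ w' = -w) ∨
      (P w ∧ (w' = planeRefl p w ∨ A w ∧ w' = -planeRefl p w)) ∨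
      (Q w ∧ (w' = planeRefl q w ∨ A w ∧ w' = -planeRefl q w)))) :
    IsDiscModel p q t s fun x => F (gaugePolar g x) := by
  have hle : ∀ z l, g (gaugePolar g (z, l)) ≤ 1 := fun z l => by
    rw [hg.apply_gaugePolar]
    exact l.2.2
  refine ⟨hF.comp_continuous hg.continuous_gaugePolar fun x => hle x.1 x.2, fun a => ?_, ?_⟩
  · obtain ⟨w, hw, rfl⟩ := hsurj a
    obtain ⟨z, l, rfl⟩ := hg.exists_gaugePolar hw
    exact ⟨(z, l), rfl⟩
  intro z l z' l'
  have en : ∀ z l, -gaugePolar g (z, l) = gaugePolar g (-z, l) := by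
    intro z l
    have e : ((-z : Circle) : ℂ) = -(z : ℂ) := rfl
    rw [gaugePolar_of_eq (z := z) (z' := -z) (by rw [e, hg.neg]), e, gaugePolar, mul_neg]
  have er : ∀ r z l, g (circRefl r z) = g z →
      planeRefl r (gaugePolar g (z, l)) = gaugePolar g (circRefl r z, l) := by
    intro r z l h
    rw [gaugePolar_of_eq h, coe_circRefl, gaugePolar, planeRefl_real_mul]
  rw [hfib _ _ (hle z l) (hle z' l'), hA, hP, hQ]
  by_cases hl : l = 1
  · subst hl
    have h10 : (1 : I) ≠ 0 := one_ne_zero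
    have heq : ∀ y : Circle, gaugePolar g (z', l') = gaugePolar g (y, 1) ↔ l' = 1 ∧ z' = y := by
      intro y
      rw [hg.gaugePolar_eq_iff]
      constructor
      · rintro ⟨rfl, h | h⟩
        · exact absurd h h10
        · exact ⟨rfl, h⟩
      · rintro ⟨rfl, rfl⟩
        exact ⟨rfl, Or.inr rfl⟩
    -- On the arc around ±p the bound on `q` in `A` holds automatically by disjointness, which
    -- leaves exactly the endpoint clause of `BdRel`.
    have hPc : (t ≤ |circInner p z| ∧
        (gaugePolar g (z', l') = planeRefl p (gaugePolar g (z, 1)) ∨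
          (|circInner p z| ≤ t ∧ |circInner q z| ≤ s) ∧
            gaugePolar g (z', l') = -planeRefl p (gaugePolar g (z, 1)))) ↔
        l' = 1 ∧ (t ≤ |circInner p z| ∧
          (z' = circRefl p z ∨ |circInner p z| ≤ t ∧ z' = -circRefl p z)) := by
      by_cases h : t ≤ |circInner p z|
      · have hq := (hadm.disjoint z h).le
        rw [er p z 1 (hgp z h), en, heq, heq]
        tauto
      · tauto
    have hQc : (s ≤ |circInner q z| ∧
        (gaugePolar g (z', l') = planeRefl q (gaugePolar g (z, 1)) ∨
          (|circInner p z| ≤ t ∧ |circInner q z| ≤ s) ∧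
            gaugePolar g (z', l') = -planeRefl q (gaugePolar g (z, 1)))) ↔
        l' = 1 ∧ (s ≤ |circInner q z| ∧
          (z' = circRefl q z ∨ |circInner q z| ≤ s ∧ z' = -circRefl q z)) := by
      by_cases h : s ≤ |circInner q z|
      · have hp : |circInner p z| ≤ t := by
          by_contra hcon
          exact (hadm.disjoint z (not_le.1 hcon).le).not_ge h
        rw [er q z 1 (hgq z h), en, heq, heq]
        tauto
      · tauto
    simp only [true_and]
    rw [hPc, hQc, en, heq, heq]
    by_cases hl' : l' = 1
    · subst hl'
      simp only [true_and, h10, false_or]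
      rw [BdRel, eq_comm (a := z') (b := z)]
    · simp only [hl', Ne.symm hl', false_and, and_false, or_self]
  · have : gaugePolar g (z', l') = gaugePolar g (z, l) ↔ l = l' ∧ (l = 0 ∨ z = z') := by
      rw [eq_comm, hg.gaugePolar_eq_iff]
    rw [this]
    tauto

end IsGauge

/-! ### The torus with a crosscap -/

theorem coe_unitAddCircle_eq_iff (a b : ℝ) :
    (a : UnitAddCircle) = b ↔ ∃ n : ℤ, b = a + n := by
  rw [eq_comm, ← sub_eq_zero, ← AddCircle.coe_sub, AddCircle.coe_eq_zero_iff]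
  refine exists_congr fun n => ?_
  rw [zsmul_eq_mul, mul_one]
  constructor <;> intro h <;> linarith

theorem norm_coe_unitAddCircle {x : ℝ} (h : |x| ≤ 1 / 2) : ‖(x : UnitAddCircle)‖ = |x| :=
  (AddCircle.norm_coe_eq_abs_iff (1 : ℝ) one_ne_zero).2 (by simpa using h)

theorem exists_coe_unitAddCircle (a : UnitAddCircle) :
    ∃ x : ℝ, |x| ≤ 1 / 2 ∧ (x : UnitAddCircle) = a := by
  obtain ⟨y, rfl⟩ := QuotientAddGroup.mk_surjective a
  exact ⟨y - round y, abs_sub_round y, (coe_unitAddCircle_eq_iff _ _).2 ⟨round y, by ring⟩⟩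

theorem norm_half_add {x : ℝ} (h : |x| ≤ 1 / 2) :
    ‖((1 / 2 + x : ℝ) : UnitAddCircle)‖ = 1 / 2 - |x| := by
  obtain ⟨h1, h2⟩ := abs_le.1 h
  rcases le_total 0 x with h0 | h0
  · have : ((1 / 2 + x : ℝ) : UnitAddCircle) = ((x - 1 / 2 : ℝ) : UnitAddCircle) :=
      (coe_unitAddCircle_eq_iff _ _).2 ⟨-1, by push_cast; ring⟩
    rw [this, norm_coe_unitAddCircle (by rw [abs_le]; constructor <;> linarith),
      abs_of_nonneg h0, abs_of_nonpos (by linarith)]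
    ring
  · rw [norm_coe_unitAddCircle (by rw [abs_le]; constructor <;> linarith),
      abs_of_nonpos h0, abs_of_nonneg (by linarith)]
    ring

/-! ### Coordinates on the torus around a point -/

section TorusPoints

variable (c : EuclideanSpace ℝ (Fin 2))

/-- The point of the torus with displacement `w` from the point given by `c`. -/
def torusPt (w : ℂ) : Torus := ((c 0 + w.re : ℝ), (c 1 + w.im : ℝ))

/-- The distance from `c` in the first coordinate. -/
noncomputable def torusX (P : Torus) : ℝ := ‖P.1 - ((c 0 : ℝ) : UnitAddCircle)‖

/-- The distance from `c` in the second coordinate. -/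
noncomputable def torusY (P : Torus) : ℝ := ‖P.2 - ((c 1 : ℝ) : UnitAddCircle)‖

theorem continuous_torusPt : Continuous (torusPt c) := by
  have h : Continuous ((↑) : ℝ → UnitAddCircle) := AddCircle.continuous_mk' 1
  exact (h.comp (by fun_prop)).prodMk (h.comp (by fun_prop))

theorem continuous_torusX : Continuous (torusX c) := by
  unfold torusX
  fun_prop

theorem continuous_torusY : Continuous (torusY c) := by
  unfold torusY
  fun_prop

theorem torusX_torusPt (w : ℂ) : torusX c (torusPt c w) = ‖(w.re : UnitAddCircle)‖ := by
  rw [torusX, torusPt, ← AddCircle.coe_sub, add_sub_cancel_left]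

theorem torusY_torusPt (w : ℂ) : torusY c (torusPt c w) = ‖(w.im : UnitAddCircle)‖ := by
  rw [torusY, torusPt, ← AddCircle.coe_sub, add_sub_cancel_left]

theorem torusPt_eq_iff (w w' : ℂ) : torusPt c w = torusPt c w' ↔
    (∃ m : ℤ, w'.re = w.re + m) ∧ ∃ n : ℤ, w'.im = w.im + n := by
  rw [torusPt, torusPt, Prod.mk.injEq, coe_unitAddCircle_eq_iff, coe_unitAddCircle_eq_iff]
  simp only [add_assoc, add_right_inj]

/-- The lattice is symmetric, so the point reflection about the base point descends to the torus. -/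
theorem torusPt_neg_eq {w w' : ℂ} (h : torusPt c w = torusPt c w') :
    torusPt c (-w) = torusPt c (-w') := by
  rw [torusPt_eq_iff] at h ⊢
  obtain ⟨⟨m, hm⟩, n, hn⟩ := h
  refine ⟨⟨-m, ?_⟩, -n, ?_⟩ <;> simp only [Complex.neg_re, Complex.neg_im] <;> push_cast <;>
    linarith

theorem exists_torusPt (P : Torus) :
    ∃ w : ℂ, |w.re| ≤ 1 / 2 ∧ |w.im| ≤ 1 / 2 ∧ torusPt c w = P := by
  obtain ⟨x, hx, hx'⟩ := exists_coe_unitAddCircle (P.1 - ((c 0 : ℝ) : UnitAddCircle))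
  obtain ⟨y, hy, hy'⟩ := exists_coe_unitAddCircle (P.2 - ((c 1 : ℝ) : UnitAddCircle))
  refine ⟨⟨x, y⟩, hx, hy, ?_⟩
  rw [torusPt, AddCircle.coe_add, AddCircle.coe_add, hx', hy', add_sub_cancel, add_sub_cancel]

theorem eq_of_torusPt_eq {w w' : ℂ} (h : torusPt c w = torusPt c w') (h1 : |w.re| < 1 / 2)
    (h2 : |w.im| < 1 / 2) (h1' : |w'.re| < 1 / 2) (h2' : |w'.im| < 1 / 2) : w = w' := by
  obtain ⟨⟨m, hm⟩, n, hn⟩ := (torusPt_eq_iff c w w').1 h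
  rw [abs_lt] at h1 h2 h1' h2'
  have hm0 : m = 0 := by
    have h3 : (-1 : ℝ) < m := by linarith
    have h4 : (m : ℝ) < 1 := by linarith
    have h3' : (-1 : ℤ) < m := by exact_mod_cast h3
    have h4' : m < 1 := by exact_mod_cast h4
    omega
  have hn0 : n = 0 := by
    have h3 : (-1 : ℝ) < n := by linarith
    have h4 : (n : ℝ) < 1 := by linarith
    have h3' : (-1 : ℤ) < n := by exact_mod_cast h3
    have h4' : n < 1 := by exact_mod_cast h4
    omega
  subst hm0 hn0
  exact Complex.ext (by simpa using hm.symm) (by simpa using hn.symm)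

/-- Displacements of size at most `1/2` realise the distances in the circle factors, so round discs
become sublevel sets of a continuous function on the torus. -/
theorem image_closedBall_eq {r : ℝ} (hr0 : 0 < r) (hr : r < 1 / 2) :
    torusProj '' Metric.closedBall c r = {P | torusX c P ^ 2 + torusY c P ^ 2 ≤ r ^ 2} := by
  have hball : ∀ v : EuclideanSpace ℝ (Fin 2), v ∈ Metric.closedBall c r ↔
      (v 0 - c 0) ^ 2 + (v 1 - c 1) ^ 2 ≤ r ^ 2 := by
    intro v
    rw [Metric.mem_closedBall, EuclideanSpace.dist_eq, Real.sqrt_le_left hr0.le, Fin.sum_univ_two,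
      Real.dist_eq, Real.dist_eq, sq_abs, sq_abs]
  have hproj : ∀ v : EuclideanSpace ℝ (Fin 2),
      torusProj v = torusPt c ⟨v 0 - c 0, v 1 - c 1⟩ := by
    intro v
    simp only [torusProj, torusPt, add_sub_cancel]
  ext P
  constructor
  · rintro ⟨v, hv, rfl⟩
    rw [hball] at hv
    have h1 : |v 0 - c 0| ≤ 1 / 2 := by
      refine (abs_le_of_sq_le_sq ?_ hr0.le).trans hr.le
      nlinarith
    have h2 : |v 1 - c 1| ≤ 1 / 2 := by
      refine (abs_le_of_sq_le_sq ?_ hr0.le).trans hr.le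
      nlinarith
    rw [mem_ofPred_eq, hproj, torusX_torusPt, torusY_torusPt, norm_coe_unitAddCircle h1,
      norm_coe_unitAddCircle h2, sq_abs, sq_abs]
    exact hv
  · intro hP
    obtain ⟨w, h1, h2, rfl⟩ := exists_torusPt c P
    rw [mem_ofPred_eq, torusX_torusPt, torusY_torusPt, norm_coe_unitAddCircle h1,
      norm_coe_unitAddCircle h2, sq_abs, sq_abs] at hP
    refine ⟨!₂[c 0 + w.re, c 1 + w.im], ?_, ?_⟩
    · rw [hball]
      simpa using hP
    · rw [hproj]
      simp

theorem circle_abs_le (z : Circle) : |(z : ℂ).re| ≤ 1 ∧ |(z : ℂ).im| ≤ 1 := by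
  have := circle_sq_add_sq z
  exact ⟨abs_le_one_iff_mul_self_le_one.2 (by nlinarith),
    abs_le_one_iff_mul_self_le_one.2 (by nlinarith)⟩

theorem one_le_circle_l1 (z : Circle) : 1 ≤ |(z : ℂ).re| + |(z : ℂ).im| := by
  have h := circle_sq_add_sq z
  rw [← sq_abs (z : ℂ).re, ← sq_abs (z : ℂ).im] at h
  nlinarith [abs_nonneg (z : ℂ).re, abs_nonneg (z : ℂ).im]

theorem torus_norms_of_circle (z : Circle) {a : ℝ} (h0 : 0 ≤ a) (h1 : a ≤ 1 / 2) :
    torusX c (torusPt c (a * z)) = a * |(z : ℂ).re| ∧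
      torusY c (torusPt c (a * z)) = a * |(z : ℂ).im| := by
  obtain ⟨hx, hy⟩ := circle_abs_le z
  have e1 : ((a : ℂ) * z).re = a * (z : ℂ).re := Complex.re_ofReal_mul _ _
  have e2 : ((a : ℂ) * z).im = a * (z : ℂ).im := Complex.im_ofReal_mul _ _
  rw [torusX_torusPt, torusY_torusPt, e1, e2, norm_coe_unitAddCircle, norm_coe_unitAddCircle,
    abs_mul, abs_mul, abs_of_nonneg h0]
  · exact ⟨rfl, rfl⟩
  · rw [abs_mul, abs_of_nonneg h0]
    nlinarith
  · rw [abs_mul, abs_of_nonneg h0]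
    nlinarith

theorem exists_polar (w : ℂ) : ∃ (a : ℝ) (z : Circle), 0 ≤ a ∧ (a : ℂ) * z = w ∧
    a ^ 2 = w.re ^ 2 + w.im ^ 2 := by
  have hsq : ‖w‖ ^ 2 = w.re ^ 2 + w.im ^ 2 := by
    rw [← Complex.normSq_eq_norm_sq, Complex.normSq_apply]
    ring
  by_cases h0 : w = 0
  · exact ⟨0, 1, le_rfl, by simp [h0], by simp [h0]⟩
  have hn : ‖w‖ ≠ 0 := norm_ne_zero_iff.2 h0
  refine ⟨‖w‖, ⟨w / ‖w‖, mem_sphere_zero_iff_norm.2 ?_⟩, norm_nonneg _, ?_, hsq⟩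
  · rw [norm_div, Complex.norm_real, norm_norm, div_self hn]
  · exact mul_div_cancel₀ w (Complex.ofReal_ne_zero.2 hn)

/-- A point at distance exactly `r` leaves the disc when moved outwards along its ray. -/
theorem interior_torus_disc {r : ℝ} (hr0 : 0 < r) (hr : r < 1 / 2) :
    interior {P | torusX c P ^ 2 + torusY c P ^ 2 ≤ r ^ 2} =
      {P | torusX c P ^ 2 + torusY c P ^ 2 < r ^ 2} := by
  have hcont : Continuous fun P => torusX c P ^ 2 + torusY c P ^ 2 :=
    ((continuous_torusX c).pow 2).add ((continuous_torusY c).pow 2)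
  refine Subset.antisymm (fun P hP => ?_) (interior_maximal
    (fun P (hP : _ < r ^ 2) => show _ ≤ r ^ 2 from hP.le) (isOpen_lt hcont continuous_const))
  have hP' : P ∈ {P | torusX c P ^ 2 + torusY c P ^ 2 ≤ r ^ 2} := interior_subset hP
  rw [mem_ofPred_eq] at hP' ⊢
  refine lt_of_le_of_ne hP' fun hPr => ?_
  obtain ⟨w, h1, h2, rfl⟩ := exists_torusPt c P
  obtain ⟨a, z, ha, rfl, haw⟩ := exists_polar w
  rw [torusX_torusPt, torusY_torusPt, norm_coe_unitAddCircle h1, norm_coe_unitAddCircle h2,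
    sq_abs, sq_abs, ← haw] at hPr
  have har : a = r := by nlinarith
  subst har
  have hline : Continuous fun x : ℝ => (x : ℂ) * (z : ℂ) := by fun_prop
  have hcomp := (continuous_torusPt c).comp hline
  obtain ⟨ε, hε, hball⟩ := Metric.isOpen_iff.1 (isOpen_interior.preimage hcomp) a hP
  -- The second bound keeps the displacement within `1/2`, where the circle norms are still absolute
  -- values.
  set δ := min (ε / 2) (1 / 2 - a) with hδ
  have hδ0 : 0 < δ := lt_min (by linarith) (by linarith)
  have hδ1 : δ ≤ ε / 2 := min_le_left _ _
  have hδ2 : δ ≤ 1 / 2 - a := min_le_right _ _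
  have h3 : a + δ ∈ Metric.ball a ε := by
    rw [Metric.mem_ball, Real.dist_eq, add_sub_cancel_left, abs_of_pos hδ0]
    linarith
  have h4 : torusPt c ((a + δ : ℝ) * z) ∈ {P | torusX c P ^ 2 + torusY c P ^ 2 ≤ a ^ 2} :=
    interior_subset (hball h3)
  obtain ⟨e1, e2⟩ := torus_norms_of_circle c z (a := a + δ) (by linarith) (by linarith)
  rw [mem_ofPred_eq, e1, e2, mul_pow, mul_pow, ← mul_add, sq_abs, sq_abs, circle_sq_add_sq] at h4
  nlinarith

theorem frontier_torus_disc {r : ℝ} (hr0 : 0 < r) (hr : r < 1 / 2) :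
    frontier {P | torusX c P ^ 2 + torusY c P ^ 2 ≤ r ^ 2} =
      {P | torusX c P ^ 2 + torusY c P ^ 2 = r ^ 2} := by
  have hcont : Continuous fun P => torusX c P ^ 2 + torusY c P ^ 2 :=
    ((continuous_torusX c).pow 2).add ((continuous_torusY c).pow 2)
  rw [frontier, interior_torus_disc c hr0 hr, (isClosed_le hcont continuous_const).closure_eq]
  ext P
  simp only [mem_sdiff, mem_ofPred_eq, not_lt]
  exact ⟨fun h => le_antisymm h.1 h.2, fun h => ⟨h.le, h.ge⟩⟩

/-- The distance from the centre of the points of a cylinder between a diamond and a round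
circle. -/
noncomputable def torusRadius (ρ r : ℝ) (x : Circle × I) : ℝ :=
  (1 - x.2) * (ρ / (|(x.1 : ℂ).re| + |(x.1 : ℂ).im|)) + x.2 * r

/-- The cylinder between the diamond of radius `ρ` and the circle of radius `r` around `c`. -/
noncomputable def torusCyl (ρ r : ℝ) (x : Circle × I) : Torus :=
  torusPt c (torusRadius ρ r x * x.1)

/-! ### The collar between a diamond and a round circle -/

section TorusCyl

variable {ρ r : ℝ}

theorem diamond_radius_le (hρ : 0 < ρ) (z : Circle) :
    0 < ρ / (|(z : ℂ).re| + |(z : ℂ).im|) ∧ ρ / (|(z : ℂ).re| + |(z : ℂ).im|) ≤ ρ := by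
  have h := one_le_circle_l1 z
  exact ⟨div_pos hρ (by linarith), div_le_self hρ.le h⟩

theorem torusRadius_mem (hρ : 0 < ρ) (hρr : ρ < r) (z : Circle) (s : I) :
    0 < torusRadius ρ r (z, s) ∧ torusRadius ρ r (z, s) ≤ r := by
  obtain ⟨h1, h2⟩ := diamond_radius_le hρ z
  have hs0 := s.2.1
  have hs1 := s.2.2
  set k := ρ / (|(z : ℂ).re| + |(z : ℂ).im|) with hk
  have : torusRadius ρ r (z, s) = k + s * (r - k) := by
    simp only [torusRadius, ← hk]
    ring
  rw [this]
  constructor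
  · nlinarith
  · nlinarith

theorem torusRadius_injective (hρ : 0 < ρ) (hρr : ρ < r) {z : Circle} {s s' : I}
    (h : torusRadius ρ r (z, s) = torusRadius ρ r (z, s')) : s = s' := by
  obtain ⟨h1, h2⟩ := diamond_radius_le hρ z
  simp only [torusRadius] at h
  set k := ρ / (|(z : ℂ).re| + |(z : ℂ).im|) with hk
  have : ((s : ℝ) - s') * (r - k) = 0 := by linear_combination h
  rcases mul_eq_zero.1 this with h | h
  · exact Subtype.ext (by linarith)
  · linarith

/-- The diamond of radius `ρ` lies in the Euclidean disc of radius `ρ < r`, so on each ray the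
radius increases strictly from the diamond to the circle; `r < 1/2` makes the lift to the plane
unique. -/
theorem isInnerCollar_torusCyl (hρ : 0 < ρ) (hρr : ρ < r) (hr : r < 1 / 2) :
    IsInnerCollar {P | torusX c P ^ 2 + torusY c P ^ 2 ≤ r ^ 2} (torusCyl c ρ r) := by
  have hr0 : 0 < r := hρ.trans hρr
  have hn : ∀ z s, torusX c (torusCyl c ρ r (z, s)) ^ 2 + torusY c (torusCyl c ρ r (z, s)) ^ 2 =
      torusRadius ρ r (z, s) ^ 2 := by
    intro z s
    obtain ⟨h1, h2⟩ := torusRadius_mem hρ hρr z s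
    obtain ⟨e1, e2⟩ := torus_norms_of_circle c z h1.le (h2.trans hr.le)
    rw [torusCyl, e1, e2, mul_pow, mul_pow, ← mul_add, sq_abs, sq_abs, circle_sq_add_sq, mul_one]
  refine ⟨?_, ?_, ?_, ?_⟩
  · refine (continuous_torusPt c).comp ?_
    have h1 : Continuous fun x : Circle × I => (x.1 : ℂ) :=
      continuous_subtype_val.comp continuous_fst
    have h2 : Continuous fun x : Circle × I => |(x.1 : ℂ).re| + |(x.1 : ℂ).im| :=
      (Complex.continuous_re.comp h1).abs.add (Complex.continuous_im.comp h1).abs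
    have h3 : Continuous fun x : Circle × I => ρ / (|(x.1 : ℂ).re| + |(x.1 : ℂ).im|) :=
      continuous_const.div h2 fun x => by linarith [one_le_circle_l1 x.1]
    have h4 : Continuous (torusRadius ρ r) := by
      unfold torusRadius
      fun_prop
    exact (Complex.continuous_ofReal.comp h4).mul h1
  · rintro ⟨z, s⟩ ⟨z', s'⟩ h
    obtain ⟨h1, h2⟩ := torusRadius_mem hρ hρr z s
    obtain ⟨h1', h2'⟩ := torusRadius_mem hρ hρr z' s'
    have hcoord : ∀ (z : Circle) (a : ℝ), 0 < a → a ≤ r →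
        |((a : ℂ) * z).re| < 1 / 2 ∧ |((a : ℂ) * z).im| < 1 / 2 := by
      intro z a h0 h1
      obtain ⟨hx, hy⟩ := circle_abs_le z
      rw [Complex.re_ofReal_mul, Complex.im_ofReal_mul, abs_mul, abs_mul, abs_of_pos h0]
      constructor <;> nlinarith
    have heq := eq_of_torusPt_eq c h (hcoord z _ h1 h2).1 (hcoord z _ h1 h2).2
      (hcoord z' _ h1' h2').1 (hcoord z' _ h1' h2').2
    have hrad : torusRadius ρ r (z, s) = torusRadius ρ r (z', s') := by
      have := congrArg (fun w : ℂ => ‖w‖) heq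
      simp only [norm_mul, Complex.norm_real, Circle.norm_coe, mul_one, Real.norm_eq_abs] at this
      rwa [abs_of_pos h1, abs_of_pos h1'] at this
    simp only at heq
    rw [hrad] at heq
    have hzz : z = z' := Circle.ext (mul_left_cancel₀ (Complex.ofReal_ne_zero.2 h1'.ne') heq)
    subst hzz
    rw [torusRadius_injective hρ hρr hrad]
  · rw [frontier_torus_disc c hr0 hr]
    have h1r : ∀ z, torusRadius ρ r (z, 1) = r := fun z => by simp [torusRadius]
    ext P
    constructor
    · rintro ⟨z, rfl⟩
      rw [mem_ofPred_eq, hn, h1r]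
    · intro hP
      obtain ⟨w, h1, h2, rfl⟩ := exists_torusPt c P
      obtain ⟨a, z, ha, rfl, haw⟩ := exists_polar w
      rw [mem_ofPred_eq, torusX_torusPt, torusY_torusPt, norm_coe_unitAddCircle h1,
        norm_coe_unitAddCircle h2, sq_abs, sq_abs, ← haw] at hP
      have har : a = r := by nlinarith
      subst har
      refine ⟨z, ?_⟩
      simp only [torusCyl, h1r]
  · intro z s hs
    rw [interior_torus_disc c hr0 hr, mem_ofPred_eq, hn]
    obtain ⟨h1, h2⟩ := torusRadius_mem hρ hρr z s
    have : torusRadius ρ r (z, s) ≠ r := by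
      intro h
      refine hs (torusRadius_injective hρ hρr (z := z) ?_)
      rw [h]
      simp [torusRadius]
    have hlt := lt_of_le_of_ne h2 this
    nlinarith

theorem compl_union_range_torusCyl (hρ : 0 < ρ) (hρr : ρ < r) (hr : r < 1 / 2) :
    (interior {P | torusX c P ^ 2 + torusY c P ^ 2 ≤ r ^ 2})ᶜ ∪ range (torusCyl c ρ r) =
      {P | ρ ≤ torusX c P + torusY c P} := by
  have hr0 : 0 < r := hρ.trans hρr
  rw [interior_torus_disc c hr0 hr]
  ext P
  constructor
  · rintro (hP | ⟨⟨z, s⟩, rfl⟩)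
    · rw [mem_compl_iff, mem_ofPred_eq, not_lt] at hP
      have h1 : 0 ≤ torusX c P := norm_nonneg _
      have h2 : 0 ≤ torusY c P := norm_nonneg _
      rw [mem_ofPred_eq]
      nlinarith
    · obtain ⟨h1, h2⟩ := torusRadius_mem hρ hρr z s
      obtain ⟨e1, e2⟩ := torus_norms_of_circle c z h1.le (h2.trans hr.le)
      rw [mem_ofPred_eq, torusCyl, e1, e2, ← mul_add]
      have hl := one_le_circle_l1 z
      have : torusRadius ρ r (z, s) * (|(z : ℂ).re| + |(z : ℂ).im|) =
          (1 - s) * ρ + s * r * (|(z : ℂ).re| + |(z : ℂ).im|) := by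
        simp only [torusRadius]
        field_simp
      rw [this]
      have hs0 := s.2.1
      nlinarith [mul_nonneg (mul_nonneg hs0 hr0.le) (sub_nonneg.2 hl),
        mul_nonneg hs0 (sub_nonneg.2 hρr.le)]
  · intro hP
    by_cases hout : torusX c P ^ 2 + torusY c P ^ 2 < r ^ 2
    · right
      obtain ⟨w, h1, h2, rfl⟩ := exists_torusPt c P
      obtain ⟨a, z, ha, rfl, haw⟩ := exists_polar w
      rw [torusX_torusPt, torusY_torusPt, norm_coe_unitAddCircle h1,
        norm_coe_unitAddCircle h2, sq_abs, sq_abs, ← haw] at hout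
      rw [mem_ofPred_eq, torusX_torusPt, torusY_torusPt, norm_coe_unitAddCircle h1,
        norm_coe_unitAddCircle h2, Complex.re_ofReal_mul, Complex.im_ofReal_mul, abs_mul, abs_mul,
        abs_of_nonneg ha, ← mul_add] at hP
      have har : a < r := by nlinarith
      have hl := one_le_circle_l1 z
      obtain ⟨hk1, hk2⟩ := diamond_radius_le hρ z
      have hka : ρ / (|(z : ℂ).re| + |(z : ℂ).im|) ≤ a := (div_le_iff₀ (by linarith)).2 hP
      set k := ρ / (|(z : ℂ).re| + |(z : ℂ).im|) with hk
      have hrk : 0 < r - k := by linarith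
      refine ⟨(z, ⟨(a - k) / (r - k), div_nonneg (by linarith) hrk.le,
        (div_le_one hrk).2 (by linarith)⟩), ?_⟩
      have : torusRadius ρ r (z, ⟨(a - k) / (r - k), div_nonneg (by linarith) hrk.le,
          (div_le_one hrk).2 (by linarith)⟩) = a := by
        simp only [torusRadius, ← hk]
        field_simp
        ring
      rw [torusCyl, this]
    · exact Or.inl hout

/-- The diamond is centrally symmetric, so the antipodal map in its circle parameter is the point
reflection about `c`. -/
theorem torusCyl_antipodal_iff (hρ : 0 < ρ) (hρr : ρ < r) (hr : r < 1 / 2) (u : ℂ) (Q : Torus) :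
    (∃ z, torusPt c u = torusCyl c ρ r (z, 0) ∧ Q = torusCyl c ρ r (-z, 0)) ↔
      torusX c (torusPt c u) + torusY c (torusPt c u) = ρ ∧ Q = torusPt c (-u) := by
  have hrad : ∀ z, torusRadius ρ r (z, 0) = ρ / (|(z : ℂ).re| + |(z : ℂ).im|) := fun z => by
    simp [torusRadius]
  have e : ∀ z : Circle, ((-z : Circle) : ℂ) = -(z : ℂ) := fun _ => rfl
  have hneg : ∀ z, torusRadius ρ r (-z, 0) = torusRadius ρ r (z, 0) := fun z => by
    rw [hrad, hrad, e]
    simp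
  constructor
  · rintro ⟨z, hz, rfl⟩
    obtain ⟨h1, h2⟩ := torusRadius_mem hρ hρr z 0
    obtain ⟨e1, e2⟩ := torus_norms_of_circle c z h1.le (h2.trans hr.le)
    constructor
    · have hl := one_le_circle_l1 z
      rw [hz, torusCyl, e1, e2, ← mul_add, hrad]
      field_simp
    · rw [torusCyl] at hz ⊢
      rw [torusPt_neg_eq c hz, hneg, e, mul_neg]
  · rintro ⟨hu, rfl⟩
    obtain ⟨w, h1, h2, hw⟩ := exists_torusPt c (torusPt c u)
    obtain ⟨a, z, ha, rfl, haw⟩ := exists_polar w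
    rw [← hw, torusX_torusPt, torusY_torusPt, norm_coe_unitAddCircle h1,
      norm_coe_unitAddCircle h2, Complex.re_ofReal_mul, Complex.im_ofReal_mul, abs_mul, abs_mul,
      abs_of_nonneg ha, ← mul_add] at hu
    have hl := one_le_circle_l1 z
    have hak : ρ / (|(z : ℂ).re| + |(z : ℂ).im|) = a := by
      rw [div_eq_iff (by linarith)]
      exact hu.symm
    refine ⟨z, ?_, ?_⟩
    · rw [torusCyl, hrad, hak, hw]
    · rw [torusCyl, hneg, hrad, hak, e, mul_neg]
      exact torusPt_neg_eq c hw.symm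

end TorusCyl

end TorusPoints

/-- For a gauge `g` that is a maximum of terms such as `x`, this says when a point in polar
coordinates lies on the side given by one term: at level `1`, in a direction where that term attains
the maximum. -/
theorem mul_div_eq_one_iff {l x g : ℝ} (hg : 0 < g) (hl0 : 0 ≤ l) (hl1 : l ≤ 1) (hx : x ≤ g) :
    l / g * x = 1 ↔ l = 1 ∧ x = g := by
  rw [div_mul_eq_mul_div, div_eq_one_iff_eq hg.ne']
  constructor
  · intro h
    have h1 : l = 1 := by
      by_contra hne
      have : l < 1 := lt_of_le_of_ne hl1 hne
      nlinarith
    subst h1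
    exact ⟨rfl, by linarith⟩
  · rintro ⟨rfl, rfl⟩
    rw [one_mul]

/-- The gauge of a square with corners cut off. -/
noncomputable def octGauge (κ : ℝ) (w : ℂ) : ℝ :=
  max (max (2 * |w.re|) (2 * |w.im|)) ((|w.re| + |w.im|) / κ)

theorem isGauge_octGauge {κ : ℝ} (hκ : 0 < κ) : IsGauge (octGauge κ) := by
  refine ⟨?_, ?_, ?_, ?_⟩
  · unfold octGauge
    fun_prop
  · intro a w ha
    simp only [octGauge, Complex.re_ofReal_mul, Complex.im_ofReal_mul, abs_mul, abs_of_nonneg ha]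
    rw [mul_max_of_nonneg _ _ ha, mul_max_of_nonneg _ _ ha]
    congr 1
    · congr 1 <;> ring
    · ring
  · intro w hw
    refine lt_of_lt_of_le ?_ (le_max_right _ _)
    refine div_pos ?_ hκ
    by_contra hcon
    have h1 := abs_nonneg w.re
    have h2 := abs_nonneg w.im
    exact hw (Complex.ext (abs_eq_zero.1 (by linarith)) (abs_eq_zero.1 (by linarith)))
  · intro w
    simp [octGauge]

theorem octGauge_le_one_iff {κ : ℝ} (hκ : 0 < κ) (w : ℂ) :
    octGauge κ w ≤ 1 ↔ |w.re| ≤ 1 / 2 ∧ |w.im| ≤ 1 / 2 ∧ |w.re| + |w.im| ≤ κ := by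
  rw [octGauge, max_le_iff, max_le_iff, div_le_one hκ, and_assoc]
  refine and_congr ⟨fun h => by linarith, fun h => by linarith⟩
    (and_congr_left fun _ => ⟨fun h => by linarith, fun h => by linarith⟩)

theorem exists_circle_I : ∃ q : Circle, (q : ℂ) = Complex.I := by
  obtain ⟨q, h1, h2⟩ := exists_circle_of_sq (u := 0) (v := 1) (by norm_num)
  exact ⟨q, Complex.ext (by simp [h1]) (by simp [h2])⟩

theorem circInner_one (z : Circle) : circInner 1 z = (z : ℂ).re := by simp [circInner]

theorem circInner_I {q : Circle} (hq : (q : ℂ) = Complex.I) (z : Circle) :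
    circInner q z = (z : ℂ).im := by simp [circInner, hq]

theorem planeRefl_one (w : ℂ) : planeRefl 1 w = ⟨-w.re, w.im⟩ := by
  apply Complex.ext <;> simp [planeRefl]

theorem planeRefl_I {q : Circle} (hq : (q : ℂ) = Complex.I) (w : ℂ) :
    planeRefl q w = ⟨w.re, -w.im⟩ := by
  apply Complex.ext <;> simp [planeRefl, hq]

section Threshold

variable {m T x y : ℝ}

/-- Here `T` is the cosine of the angle whose tangent is `m`, so on the unit circle a bound on the
slope is a bound on one coordinate. -/
theorem abs_le_mul_abs_iff (hm : 0 < m) (hT : 0 < T) (hTm : T ^ 2 * (1 + m ^ 2) = 1)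
    (h : x ^ 2 + y ^ 2 = 1) : |y| ≤ m * |x| ↔ T ≤ |x| := by
  rw [← sq_abs x, ← sq_abs y] at h
  rw [← sq_le_sq₀ (abs_nonneg y) (mul_nonneg hm.le (abs_nonneg x)),
    ← sq_le_sq₀ hT.le (abs_nonneg x), mul_pow]
  have hp : 0 < 1 + m ^ 2 := by positivity
  rw [← mul_le_mul_iff_left₀ hp (b := T ^ 2), hTm]
  constructor <;> intro hh <;> linarith

theorem mul_abs_le_abs_iff (hm : 0 < m) (hT : 0 < T) (hTm : T ^ 2 * (1 + m ^ 2) = 1)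
    (h : x ^ 2 + y ^ 2 = 1) : m * |x| ≤ |y| ↔ |x| ≤ T := by
  rw [← sq_abs x, ← sq_abs y] at h
  rw [← sq_le_sq₀ (mul_nonneg hm.le (abs_nonneg x)) (abs_nonneg y),
    ← sq_le_sq₀ (abs_nonneg x) hT.le, mul_pow]
  have hp : 0 < 1 + m ^ 2 := by positivity
  rw [← mul_le_mul_iff_left₀ hp (c := T ^ 2), hTm]
  constructor <;> intro hh <;> linarith

end Threshold

/-! ### The octagon model -/

section TorusModel

variable (c : EuclideanSpace ℝ (Fin 2))

/-- The centre of the fundamental square. -/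
noncomputable def squareCentre : ℂ := ⟨1 / 2, 1 / 2⟩

theorem torus_norms_of_square {w : ℂ} (h1 : |w.re| ≤ 1 / 2) (h2 : |w.im| ≤ 1 / 2) :
    torusX c (torusPt c (squareCentre + w)) + torusY c (torusPt c (squareCentre + w)) =
      1 - (|w.re| + |w.im|) := by
  rw [torusX_torusPt, torusY_torusPt]
  simp only [squareCentre, Complex.add_re, Complex.add_im]
  rw [norm_half_add h1, norm_half_add h2]
  ring

theorem coord_cases {x y : ℝ} (hx : |x| ≤ 1 / 2) (hy : |y| ≤ 1 / 2) :
    (∃ n : ℤ, y = x + n) ↔ y = x ∨ (|x| = 1 / 2 ∧ y = -x) := by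
  rw [abs_le] at hx hy
  constructor
  · rintro ⟨n, rfl⟩
    have h3 : (n : ℝ) ≤ 1 := by linarith
    have h4 : (-1 : ℝ) ≤ n := by linarith
    have h3' : n ≤ 1 := by exact_mod_cast h3
    have h4' : -1 ≤ n := by exact_mod_cast h4
    obtain rfl | rfl | rfl : n = -1 ∨ n = 0 ∨ n = 1 := by omega
    · right
      push_cast at hy
      have : x = 1 / 2 := by linarith
      subst this
      norm_num
    · left; simp
    · right
      push_cast at hy
      have : x = -(1 / 2) := by linarith
      subst this
      norm_num
  · rintro (rfl | ⟨h, rfl⟩)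
    · exact ⟨0, by simp⟩
    · rcases abs_eq (by norm_num : (0 : ℝ) ≤ 1 / 2) |>.1 h with rfl | rfl
      · exact ⟨-1, by norm_num⟩
      · exact ⟨1, by norm_num⟩

/-- Cutting the corners (`κ < 1`) leaves no point on both a vertical and a horizontal side, so at
most one coordinate is flipped. On a side, translation to the opposite side is a change of sign of
that coordinate. -/
theorem torusPt_square_eq_iff {κ : ℝ} (hκ1 : κ < 1) {w w' : ℂ} (h1 : |w.re| ≤ 1 / 2)
    (h2 : |w.im| ≤ 1 / 2) (h3 : |w.re| + |w.im| ≤ κ) (h1' : |w'.re| ≤ 1 / 2)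
    (h2' : |w'.im| ≤ 1 / 2) {q : Circle} (hq : (q : ℂ) = Complex.I) :
    torusPt c (squareCentre + w) = torusPt c (squareCentre + w') ↔
      w' = w ∨ (|w.re| = 1 / 2 ∧ w' = planeRefl 1 w) ∨ (|w.im| = 1 / 2 ∧ w' = planeRefl q w) := by
  rw [torusPt_eq_iff, planeRefl_one, planeRefl_I hq]
  simp only [Complex.add_re, Complex.add_im, add_assoc, add_right_inj, Complex.ext_iff]
  rw [coord_cases h1 h1', coord_cases h2 h2']
  have hnot : ¬ (|w.re| = 1 / 2 ∧ |w.im| = 1 / 2) := by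
    rintro ⟨e1, e2⟩
    linarith
  tauto

theorem exists_torus_model {ρ : ℝ} (hρ : 0 < ρ) (hρ' : ρ < 1 / 2) {r : ℝ} (hρr : ρ < r)
    (hr : r < 1 / 2) {Z : Type*} [TopologicalSpace Z] {Θ : Torus → Z}
    (hΘ : IsAntipodalQuotient {P | ρ ≤ torusX c P + torusY c P}
      {fun z => torusCyl c ρ r (z, 0)} Θ) :
    ∃ (p q : Circle) (T : ℝ) (G : Circle × I → Z), IsAdmissible p q T T ∧
      IsDiscModel p q T T G := by
  obtain ⟨q, hq⟩ := exists_circle_I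
  have hκ : 0 < 1 - ρ := by linarith
  have hκ1 : 1 - ρ < 1 := by linarith
  -- The octagon has a vertex at `(1/2, 1/2 - ρ)`, and `m` is the slope of the ray through it; `T`
  -- is the cosine of the corresponding angle.
  set m := 1 - 2 * ρ with hm
  have hm0 : 0 < m := by rw [hm]; linarith
  have hm1 : m < 1 := by rw [hm]; linarith
  have hp : 0 < 1 + m ^ 2 := by positivity
  obtain ⟨T, hT0, hT⟩ : ∃ T : ℝ, 0 < T ∧ T ^ 2 * (1 + m ^ 2) = 1 :=
    ⟨√(1 / (1 + m ^ 2)), Real.sqrt_pos.2 (by positivity), by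
      rw [Real.sq_sqrt (by positivity)]
      field_simp⟩
  have hT1 : T < 1 := by nlinarith [pow_pos hT0 2, mul_pos hT0 hT0, pow_pos hm0 2]
  -- This makes the arcs around the two axes disjoint, since both coordinates of a unit vector
  -- cannot exceed `√(1/2)` in absolute value.
  have hT2 : 1 / 2 < T ^ 2 := by nlinarith [pow_pos hT0 2]
  have hadm : IsAdmissible 1 q T T := by
    refine ⟨hT0, hT1, hT0, hT1, fun z hz => ?_⟩
    rw [circInner_one] at hz
    rw [circInner_I hq]
    by_contra hcon
    have h := circle_sq_add_sq z
    rw [← sq_abs (z : ℂ).re, ← sq_abs (z : ℂ).im] at h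
    have h1 := pow_le_pow_left₀ hT0.le hz 2
    have h2 := pow_le_pow_left₀ hT0.le (not_lt.1 hcon) 2
    linarith
  have hg := isGauge_octGauge hκ
  set g := octGauge (1 - ρ) with hgdef
  have hK := octGauge_le_one_iff hκ
  have hre : ∀ z l, (gaugePolar g (z, l)).re = l / g z * (z : ℂ).re := fun z l =>
    Complex.re_ofReal_mul _ _
  have him : ∀ z l, (gaugePolar g (z, l)).im = l / g z * (z : ℂ).im := fun z l =>
    Complex.im_ofReal_mul _ _
  have hge1 : ∀ z : Circle, 2 * |(z : ℂ).re| ≤ g z := fun z =>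
    (le_max_left _ _).trans (le_max_left _ _)
  have hge2 : ∀ z : Circle, 2 * |(z : ℂ).im| ≤ g z := fun z =>
    (le_max_right _ _).trans (le_max_left _ _)
  have hge3 : ∀ z : Circle, (|(z : ℂ).re| + |(z : ℂ).im|) / (1 - ρ) ≤ g z := fun z =>
    le_max_right _ _
  have hgle : ∀ (z : Circle) (a : ℝ), g z ≤ a ↔ (2 * |(z : ℂ).re| ≤ a ∧ 2 * |(z : ℂ).im| ≤ a) ∧
      (|(z : ℂ).re| + |(z : ℂ).im|) / (1 - ρ) ≤ a := fun z a => by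
    rw [hgdef, octGauge, max_le_iff, max_le_iff]
  have hdnn : ∀ (z : Circle) (l : I), 0 ≤ (l : ℝ) / g z := fun z l =>
    div_nonneg l.2.1 (hg.circle_pos z).le
  refine ⟨1, q, T, _, hadm,
    hg.isDiscModel (F := fun w => Θ (torusPt c (squareCentre + w))) (A := fun w => |w.re| + |w.im| = 1 - ρ) (P := fun w => |w.re| = 1 / 2)
      (Q := fun w => |w.im| = 1 / 2) ?_ ?_ ?_ ?_ ?_ ?_ ?_ hadm ?_⟩
  · have hline : Continuous fun w : ℂ => squareCentre + w := by fun_prop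
    refine hΘ.continuousOn.comp ((continuous_torusPt c).comp hline).continuousOn ?_
    intro w hw
    obtain ⟨h1, h2, h3⟩ := (hK w).1 hw
    change ρ ≤ torusX c (torusPt c (squareCentre + w)) + torusY c (torusPt c (squareCentre + w))
    rw [torus_norms_of_square c h1 h2]
    linarith
  · intro a
    obtain ⟨P, hP, rfl⟩ := hΘ.surj a
    obtain ⟨x, hx, hx'⟩ := exists_coe_unitAddCircle (P.1 - ((c 0 + 1 / 2 : ℝ) : UnitAddCircle))
    obtain ⟨y, hy, hy'⟩ := exists_coe_unitAddCircle (P.2 - ((c 1 + 1 / 2 : ℝ) : UnitAddCircle))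
    have hPw : torusPt c (squareCentre + ⟨x, y⟩) = P := by
      simp only [torusPt, squareCentre, Complex.add_re, Complex.add_im]
      rw [← add_assoc, ← add_assoc, AddCircle.coe_add _ (c 0 + 1 / 2) x,
        AddCircle.coe_add _ (c 1 + 1 / 2) y, hx', hy', add_sub_cancel, add_sub_cancel]
    rw [mem_ofPred_eq, ← hPw, torus_norms_of_square c hx hy] at hP
    refine ⟨⟨x, y⟩, (hK _).2 ⟨hx, hy, by linarith⟩, by rw [hPw]⟩
  · intro z l
    rw [hre, him, abs_mul, abs_mul, abs_of_nonneg (hdnn z l), ← mul_add, circInner_one,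
      circInner_I hq]
    have h := circle_sq_add_sq z
    have h' : (z : ℂ).im ^ 2 + (z : ℂ).re ^ 2 = 1 := by linarith
    rw [← mul_abs_le_abs_iff hm0 hT0 hT h, ← mul_abs_le_abs_iff hm0 hT0 hT h',
      ← div_eq_one_iff_eq hκ.ne', mul_div_assoc,
      mul_div_eq_one_iff (hg.circle_pos z) l.2.1 l.2.2 (hge3 z), Icc.coe_eq_one]
    refine and_congr_right fun _ => ?_
    -- A term of the maximum equals the gauge exactly when it dominates the other terms, which gives
    -- slope conditions on the direction.
    rw [← (hge3 z).ge_iff_eq, hgle, le_div_iff₀ hκ, le_div_iff₀ hκ]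
    constructor
    · rintro ⟨⟨h1, h2⟩, -⟩
      constructor <;> rw [hm] <;> linarith
    · rintro ⟨h1, h2⟩
      rw [hm] at h1 h2
      exact ⟨⟨by linarith, by linarith⟩, le_rfl⟩
  · intro z l
    rw [hre, abs_mul, abs_of_nonneg (hdnn z l), circInner_one,
      ← abs_le_mul_abs_iff hm0 hT0 hT (circle_sq_add_sq z)]
    have e : (l : ℝ) / g z * |(z : ℂ).re| = 1 / 2 ↔ (l : ℝ) / g z * (2 * |(z : ℂ).re|) = 1 := by
      constructor <;> intro h <;> linarith
    rw [e, mul_div_eq_one_iff (hg.circle_pos z) l.2.1 l.2.2 (hge1 z), Icc.coe_eq_one]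
    refine and_congr_right fun _ => ?_
    rw [← (hge1 z).ge_iff_eq, hgle, div_le_iff₀ hκ]
    have := abs_nonneg (z : ℂ).re
    constructor
    · rintro ⟨-, h1⟩
      rw [hm]; linarith
    · intro h1
      rw [hm] at h1
      exact ⟨⟨le_rfl, by nlinarith⟩, by linarith⟩
  · intro z l
    have h := circle_sq_add_sq z
    have h' : (z : ℂ).im ^ 2 + (z : ℂ).re ^ 2 = 1 := by linarith
    rw [him, abs_mul, abs_of_nonneg (hdnn z l), circInner_I hq,
      ← abs_le_mul_abs_iff hm0 hT0 hT h']
    have e : (l : ℝ) / g z * |(z : ℂ).im| = 1 / 2 ↔ (l : ℝ) / g z * (2 * |(z : ℂ).im|) = 1 := by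
      constructor <;> intro h <;> linarith
    rw [e, mul_div_eq_one_iff (hg.circle_pos z) l.2.1 l.2.2 (hge2 z), Icc.coe_eq_one]
    refine and_congr_right fun _ => ?_
    rw [← (hge2 z).ge_iff_eq, hgle, div_le_iff₀ hκ]
    have := abs_nonneg (z : ℂ).im
    constructor
    · rintro ⟨-, h1⟩
      rw [hm]; linarith
    · intro h1
      rw [hm] at h1
      exact ⟨⟨by nlinarith, le_rfl⟩, by linarith⟩
  · intro z _
    rw [coe_circRefl, planeRefl_one, hgdef]
    simp only [octGauge, abs_neg]
  · intro z _
    rw [coe_circRefl, planeRefl_I hq, hgdef]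
    simp only [octGauge, abs_neg]
  · intro w w' hw hw'
    obtain ⟨h1, h2, h3⟩ := (hK w).1 hw
    obtain ⟨h1', h2', h3'⟩ := (hK w').1 hw'
    have hmem : ∀ w : ℂ, g w ≤ 1 →
        torusPt c (squareCentre + w) ∈ {P | ρ ≤ torusX c P + torusY c P} := by
      intro w hw
      obtain ⟨h1, h2, h3⟩ := (hK w).1 hw
      rw [mem_ofPred_eq, torus_norms_of_square c h1 h2]
      linarith
    -- The two displacements differ by the lattice vector `(1, 1)`, so reflection about `c` is also
    -- reflection about the centre of the square.
    have hinv : torusPt c (-(squareCentre + w)) = torusPt c (squareCentre + -w) := by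
      rw [torusPt_eq_iff]
      simp only [squareCentre, Complex.neg_re, Complex.neg_im, Complex.add_re, Complex.add_im]
      exact ⟨⟨1, by push_cast; ring⟩, ⟨1, by push_cast; ring⟩⟩
    refine (hΘ.eq_iff _ (hmem w hw) _ (hmem w' hw')).trans ?_
    simp only [mem_singleton_iff, exists_eq_left]
    have hn1 : |(-w).re| = |w.re| := by simp
    have hn2 : |(-w).im| = |w.im| := by simp
    rw [torusCyl_antipodal_iff c hρ hρr hr, torus_norms_of_square c h1 h2, hinv,
      eq_comm (a := torusPt c (squareCentre + w')),
      torusPt_square_eq_iff c hκ1 h1 h2 h3 h1' h2' hq,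
      torusPt_square_eq_iff c hκ1 (w := -w) (by rwa [hn1]) (by rwa [hn2]) (by rwa [hn1, hn2])
        h1' h2' hq, hn1, hn2, planeRefl_neg, planeRefl_neg]
    have e : 1 - (|w.re| + |w.im|) = ρ ↔ |w.re| + |w.im| = 1 - ρ := by
      constructor <;> intro h <;> linarith
    rw [e]
    tauto

end TorusModel

/-! ### The projective plane with two crosscaps -/

theorem isInnerCollar_capCyl (b : OrthonormalBasis (Fin 3) ℝ (EuclideanSpace ℝ (Fin 3)))
    {p : Sphere2} (hb : b 2 = p) {t t' : ℝ} (ht0 : 0 < t) (htt : t < t') (ht1 : t' < 1) :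
    IsInnerCollar {x | t ≤ absInner p x} (capCyl b t' t) := by
  have ht0' : 0 < t' := ht0.trans htt
  have ht : t < 1 := htt.trans ht1
  have hμ : ∀ z s, absInner p (capCyl b t' t (z, s)) = (1 - s) * t' + s * t := fun z s => by
    rw [← hb, absInner_capCyl b ht0'.le ht1 ht0.le ht]
  refine ⟨continuous_capCyl b, ?_, ?_, ?_⟩
  · rintro ⟨z, s⟩ ⟨z', s'⟩ h
    obtain ⟨rfl, rfl | ⟨h0, -⟩⟩ :=
      (capCyl_eq_iff b ht0'.le ht1 ht0.le ht htt.ne' z s z' s').1 h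
    · rfl
    · exfalso
      have hs0 := s.2.1
      have hs1 := s.2.2
      nlinarith
  · rw [frontier_cap p ht0 ht]
    ext x
    constructor
    · rintro ⟨z, rfl⟩
      rw [mem_ofPred_eq, hμ]
      simp
    · intro hx
      rw [mem_ofPred_eq] at hx
      obtain ⟨z, hz⟩ := exists_capCyl b (t₀ := t') (t₁ := t) (x := x) (s := 1)
        (by rw [hb, hx]; exact ht) (by rw [hb, hx]; simp)
      exact ⟨z, hz⟩
  · intro z s hs
    rw [interior_cap p ht0 ht, mem_ofPred_eq, hμ]
    have hs1 : (s : ℝ) < 1 := lt_of_le_of_ne s.2.2 fun h => hs (Subtype.ext h)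
    nlinarith

theorem compl_union_range_capCyl (b : OrthonormalBasis (Fin 3) ℝ (EuclideanSpace ℝ (Fin 3)))
    {p : Sphere2} (hb : b 2 = p) {t t' : ℝ} (ht0 : 0 < t) (htt : t < t') (ht1 : t' < 1) :
    (interior {x | t ≤ absInner p x})ᶜ ∪ range (capCyl b t' t) = {x | absInner p x ≤ t'} := by
  have ht0' : 0 < t' := ht0.trans htt
  have ht : t < 1 := htt.trans ht1
  rw [interior_cap p ht0 ht]
  ext x
  constructor
  · rintro (hx | ⟨⟨z, s⟩, rfl⟩)
    · rw [mem_compl_iff, mem_ofPred_eq, not_lt] at hx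
      exact hx.trans htt.le
    · rw [mem_ofPred_eq, ← hb, absInner_capCyl b ht0'.le ht1 ht0.le ht]
      have hs0 := s.2.1
      nlinarith
  · intro hx
    rw [mem_ofPred_eq] at hx
    by_cases hxt : t < absInner p x
    · right
      have hd : 0 < t' - t := by linarith
      have hs0 : 0 ≤ (t' - absInner p x) / (t' - t) := div_nonneg (by linarith) hd.le
      have hs1 : (t' - absInner p x) / (t' - t) ≤ 1 := (div_le_one hd).2 (by linarith)
      obtain ⟨z, hz⟩ := exists_capCyl b (t₀ := t') (t₁ := t) (x := x)
        (s := ⟨(t' - absInner p x) / (t' - t), hs0, hs1⟩) (by rw [hb]; linarith) (by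
          rw [hb]
          simp only
          field_simp
          ring)
      exact ⟨_, hz⟩
    · exact Or.inl hxt

/-- The half-turn about the axis `b 2` is the reflection along `b 2` followed by the antipodal map,
which is trivial in the projective plane. -/
theorem capCyl_antipodal_iff (b : OrthonormalBasis (Fin 3) ℝ (EuclideanSpace ℝ (Fin 3)))
    {t t' : ℝ} (ht0 : 0 < t') (ht1 : t' < 1) {X X' : Sphere2}
    (hX : (X' : EuclideanSpace ℝ (Fin 3)) =
      X - (2 * inner ℝ (b 2) (X : EuclideanSpace ℝ (Fin 3))) • b 2) (y : RP2) :
    (∃ z, rp2Proj X = capCyl b t' t (z, 0) ∧ y = capCyl b t' t (-z, 0)) ↔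
      |inner ℝ (b 2) (X : EuclideanSpace ℝ (Fin 3))| = t' ∧ y = rp2Proj X' := by
  have hcyl : ∀ z, capCyl b t' t (z, 0) = rp2Proj (capPt b z t') := fun z => by
    simp [capCyl]
  have hneg : ∀ z, (capPt b (-z) t' : EuclideanSpace ℝ (Fin 3)) =
      -((capPt b z t' : EuclideanSpace ℝ (Fin 3)) - (2 * t') • b 2) := by
    intro z
    have e : ((-z : Circle) : ℂ) = -(z : ℂ) := rfl
    rw [coe_capPt b _ (by linarith) ht1.le, coe_capPt b _ (by linarith) ht1.le]
    simp only [capVec, e, Complex.neg_re, Complex.neg_im]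
    module
  have hin : ∀ z, inner ℝ (b 2) (capPt b z t' : EuclideanSpace ℝ (Fin 3)) = t' := fun z => by
    rw [coe_capPt b _ (by linarith) ht1.le, inner_capVec_two]
  have key : ∀ z, rp2Proj X = rp2Proj (capPt b z t') → rp2Proj (capPt b (-z) t') = rp2Proj X' := by
    intro z hz
    rw [rp2Proj_eq_iff] at hz
    rcases hz with hz | hz
    · rw [← rp2Proj_neg]
      congr 1
      refine Subtype.ext ?_
      change -(capPt b (-z) t' : EuclideanSpace ℝ (Fin 3)) = X'
      rw [hneg, hX, ← hz, hin, neg_neg]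
    · congr 1
      refine Subtype.ext ?_
      have hz' : (X : EuclideanSpace ℝ (Fin 3)) = -(capPt b z t' : EuclideanSpace ℝ (Fin 3)) := by
        rw [hz]
        change _ = -(-(X : EuclideanSpace ℝ (Fin 3)))
        rw [neg_neg]
      rw [hneg, hX, hz', inner_neg_right, hin]
      module
  constructor
  · rintro ⟨z, hz, rfl⟩
    rw [hcyl] at hz ⊢
    refine ⟨?_, key z hz⟩
    rw [← absInner_rp2Proj, hz, absInner_capPt b z ht0.le ht1.le]
  · rintro ⟨h, rfl⟩
    obtain ⟨z, hz⟩ := exists_rp2Proj_capPt b (rp2Proj X) (by rw [absInner_rp2Proj, h]; exact ht1)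
    rw [absInner_rp2Proj, h] at hz
    exact ⟨z, by rw [hcyl, hz], by rw [hcyl, key z hz]⟩

/-! ### The hemisphere over the unit disc -/

section Hemisphere

variable (e : OrthonormalBasis (Fin 3) ℝ (EuclideanSpace ℝ (Fin 3)))

/-- The Euclidean inner product in the plane of a point of the circle and a point. -/
noncomputable def planeInner (p : Circle) (w : ℂ) : ℝ := (p : ℂ).re * w.re + (p : ℂ).im * w.im

/-- The vector of the upper hemisphere over a point of the unit disc. -/
noncomputable def hemiVec (w : ℂ) : EuclideanSpace ℝ (Fin 3) :=
  w.re • e 0 + w.im • e 1 + √(1 - ‖w‖ ^ 2) • e 2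

theorem inner_hemiVec_zero (w : ℂ) : inner ℝ (e 0) (hemiVec e w) = w.re := by
  simp [hemiVec, inner_add_right, inner_smul_right]

theorem inner_hemiVec_one (w : ℂ) : inner ℝ (e 1) (hemiVec e w) = w.im := by
  simp [hemiVec, inner_add_right, inner_smul_right]

theorem inner_hemiVec_two (w : ℂ) : inner ℝ (e 2) (hemiVec e w) = √(1 - ‖w‖ ^ 2) := by
  simp [hemiVec, inner_add_right, inner_smul_right]

theorem complex_norm_sq (w : ℂ) : ‖w‖ ^ 2 = w.re ^ 2 + w.im ^ 2 := by
  rw [← Complex.normSq_eq_norm_sq, Complex.normSq_apply]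
  ring

theorem norm_hemiVec {w : ℂ} (hw : ‖w‖ ≤ 1) : ‖hemiVec e w‖ = 1 := by
  have h0 := norm_nonneg w
  have h1 : ‖hemiVec e w‖ ^ 2 = 1 := by
    rw [norm_sq_eq_sum e, inner_hemiVec_zero, inner_hemiVec_one, inner_hemiVec_two,
      Real.sq_sqrt (by nlinarith), complex_norm_sq]
    ring
  have := norm_nonneg (hemiVec e w)
  nlinarith

/-- The point of the upper hemisphere over a point of the unit disc; points outside the disc are
first moved radially to its boundary. -/
noncomputable def hemiPt (w : ℂ) : Sphere2 :=
  ⟨hemiVec e (w / (max 1 ‖w‖ : ℝ)), by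
    rw [mem_sphere_zero_iff_norm]
    refine norm_hemiVec e ?_
    have h : 0 < max 1 ‖w‖ := lt_of_lt_of_le one_pos (le_max_left _ _)
    rw [norm_div, Complex.norm_real, Real.norm_of_nonneg h.le]
    exact (div_le_one h).2 (le_max_right _ _)⟩

theorem coe_hemiPt {w : ℂ} (hw : ‖w‖ ≤ 1) :
    (hemiPt e w : EuclideanSpace ℝ (Fin 3)) = hemiVec e w := by
  simp [hemiPt, hw]

theorem continuous_hemiPt : Continuous (hemiPt e) := by
  have h1 : Continuous fun w : ℂ => w / ((max 1 ‖w‖ : ℝ) : ℂ) := by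
    refine continuous_id.div (by fun_prop) fun w => ?_
    have h : 0 < max 1 ‖w‖ := lt_of_lt_of_le one_pos (le_max_left _ _)
    exact Complex.ofReal_ne_zero.2 h.ne'
  have h2 : Continuous (hemiVec e) := by
    unfold hemiVec
    fun_prop
  exact Continuous.subtype_mk (h2.comp h1) _

theorem rp2Proj_hemiPt_eq_iff {w w' : ℂ} (hw : ‖w‖ ≤ 1) (hw' : ‖w'‖ ≤ 1) :
    rp2Proj (hemiPt e w) = rp2Proj (hemiPt e w') ↔ w' = w ∨ (‖w‖ = 1 ∧ w' = -w) := by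
  rw [rp2Proj_eq_iff]
  constructor
  · rintro (h | h)
    · left
      have h' := congrArg (Subtype.val : Sphere2 → _) h
      rw [coe_hemiPt e hw, coe_hemiPt e hw'] at h'
      refine Complex.ext ?_ ?_
      · rw [← inner_hemiVec_zero e, h', inner_hemiVec_zero]
      · rw [← inner_hemiVec_one e, h', inner_hemiVec_one]
    · right
      have h' : (hemiPt e w' : EuclideanSpace ℝ (Fin 3)) = -(hemiPt e w : EuclideanSpace ℝ (Fin 3)) :=
        congrArg (Subtype.val : Sphere2 → _) h
      rw [coe_hemiPt e hw, coe_hemiPt e hw'] at h'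
      have hneg : w' = -w := by
        refine Complex.ext ?_ ?_
        · rw [← inner_hemiVec_zero e, h', inner_neg_right, inner_hemiVec_zero, Complex.neg_re]
        · rw [← inner_hemiVec_one e, h', inner_neg_right, inner_hemiVec_one, Complex.neg_im]
      refine ⟨?_, hneg⟩
      have h2 : √(1 - ‖w'‖ ^ 2) = -√(1 - ‖w‖ ^ 2) := by
        rw [← inner_hemiVec_two e, h', inner_neg_right, inner_hemiVec_two]
      have h3 := Real.sqrt_nonneg (1 - ‖w'‖ ^ 2)
      have h4 : √(1 - ‖w‖ ^ 2) = 0 := le_antisymm (by linarith) (Real.sqrt_nonneg _)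
      rw [Real.sqrt_eq_zero (by nlinarith [norm_nonneg w])] at h4
      nlinarith [norm_nonneg w]
  · rintro (rfl | ⟨h, rfl⟩)
    · exact Or.inl rfl
    · right
      refine Subtype.ext ?_
      change _ = -(hemiPt e w : EuclideanSpace ℝ (Fin 3))
      rw [coe_hemiPt e hw, coe_hemiPt e hw']
      simp only [hemiVec, norm_neg, h, Complex.neg_re, Complex.neg_im]
      norm_num
      module

theorem exists_hemiPt (x : RP2) : ∃ w : ℂ, ‖w‖ ≤ 1 ∧ rp2Proj (hemiPt e w) = x := by
  have key : ∀ X : Sphere2, 0 ≤ inner ℝ (e 2) (X : EuclideanSpace ℝ (Fin 3)) →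
      ∃ w : ℂ, ‖w‖ ≤ 1 ∧ hemiPt e w = X := by
    intro X hX
    have hn := norm_sq_eq_sum e X
    rw [norm_eq_of_mem_sphere] at hn
    set w : ℂ := ⟨inner ℝ (e 0) (X : EuclideanSpace ℝ (Fin 3)),
      inner ℝ (e 1) (X : EuclideanSpace ℝ (Fin 3))⟩ with hwdef
    have hw2 : ‖w‖ ^ 2 = 1 - inner ℝ (e 2) (X : EuclideanSpace ℝ (Fin 3)) ^ 2 := by
      rw [complex_norm_sq, hwdef]
      linarith
    have hw : ‖w‖ ≤ 1 := by
      have := norm_nonneg w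
      nlinarith [sq_nonneg (inner ℝ (e 2) (X : EuclideanSpace ℝ (Fin 3)))]
    refine ⟨w, hw, Subtype.ext ?_⟩
    rw [coe_hemiPt e hw]
    refine eq_of_inner_basis e ?_ ?_ ?_
    · rw [inner_hemiVec_zero]
    · rw [inner_hemiVec_one]
    · rw [inner_hemiVec_two, hw2, sub_sub_cancel, Real.sqrt_sq hX]
  obtain ⟨X, rfl⟩ := rp2Proj_surjective x
  rcases le_total 0 (inner ℝ (e 2) (X : EuclideanSpace ℝ (Fin 3))) with h | h
  · obtain ⟨w, hw, hwX⟩ := key X h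
    exact ⟨w, hw, by rw [hwX]⟩
  · obtain ⟨w, hw, hwX⟩ := key (-X) (by
      change 0 ≤ inner ℝ (e 2) (-(X : EuclideanSpace ℝ (Fin 3)))
      rw [inner_neg_right]
      linarith)
    exact ⟨w, hw, by rw [hwX, rp2Proj_neg]⟩

theorem norm_planeRefl (p : Circle) (w : ℂ) : ‖planeRefl p w‖ = ‖w‖ := by
  rw [planeRefl, norm_neg, norm_mul, norm_mul, Circle.norm_coe, RCLike.norm_conj]
  ring

theorem planeRefl_eq (p : Circle) (w : ℂ) :
    (planeRefl p w).re = w.re - 2 * planeInner p w * (p : ℂ).re ∧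
      (planeRefl p w).im = w.im - 2 * planeInner p w * (p : ℂ).im := by
  have h := circle_sq_add_sq p
  simp only [planeRefl, planeInner, Complex.neg_re, Complex.mul_re, Complex.mul_im,
    Complex.conj_re, Complex.conj_im, Complex.neg_im]
  constructor
  · linear_combination w.re * h
  · linear_combination w.im * h

variable {e}

theorem inner_hemiPt {p : Sphere2} {P : Circle}
    (hp : (p : EuclideanSpace ℝ (Fin 3)) = (P : ℂ).re • e 0 + (P : ℂ).im • e 1) {w : ℂ}
    (hw : ‖w‖ ≤ 1) : inner ℝ (p : EuclideanSpace ℝ (Fin 3)) (hemiPt e w) = planeInner P w := by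
  rw [coe_hemiPt e hw, hp, inner_add_left, real_inner_smul_left, real_inner_smul_left,
    inner_hemiVec_zero, inner_hemiVec_one, planeInner]

/-- As `p` is orthogonal to the pole `e 2`, reflection along `p` preserves the height and covers the
plane reflection along `P`. -/
theorem hemiPt_planeRefl {p : Sphere2} {P : Circle}
    (hp : (p : EuclideanSpace ℝ (Fin 3)) = (P : ℂ).re • e 0 + (P : ℂ).im • e 1) {w : ℂ}
    (hw : ‖w‖ ≤ 1) : (hemiPt e (planeRefl P w) : EuclideanSpace ℝ (Fin 3)) =
      hemiPt e w - (2 * inner ℝ (p : EuclideanSpace ℝ (Fin 3)) (hemiPt e w)) •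
        (p : EuclideanSpace ℝ (Fin 3)) := by
  rw [inner_hemiPt hp hw, coe_hemiPt e hw, coe_hemiPt e (by rwa [norm_planeRefl]), hp]
  simp only [hemiVec, norm_planeRefl, (planeRefl_eq P w).1, (planeRefl_eq P w).2]
  module

/-- Two points of the sphere lie on a common great circle. -/
theorem exists_common_plane (p q : Sphere2) :
    ∃ (e : OrthonormalBasis (Fin 3) ℝ (EuclideanSpace ℝ (Fin 3))) (P Q : Circle),
      (p : EuclideanSpace ℝ (Fin 3)) = (P : ℂ).re • e 0 + (P : ℂ).im • e 1 ∧
      (q : EuclideanSpace ℝ (Fin 3)) = (Q : ℂ).re • e 0 + (Q : ℂ).im • e 1 := by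
  classical
  -- The span of `p` and `q` has dimension at most two, so a unit normal exists; it serves as the
  -- pole.
  obtain ⟨n, hn, hpn, hqn⟩ : ∃ n : EuclideanSpace ℝ (Fin 3), ‖n‖ = 1 ∧
      inner ℝ n (p : EuclideanSpace ℝ (Fin 3)) = 0 ∧
      inner ℝ n (q : EuclideanSpace ℝ (Fin 3)) = 0 := by
    let S : Submodule ℝ (EuclideanSpace ℝ (Fin 3)) :=
      Submodule.span ℝ ({(p : EuclideanSpace ℝ (Fin 3)), (q : EuclideanSpace ℝ (Fin 3))} :
        Finset (EuclideanSpace ℝ (Fin 3)))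
    have hS : Module.finrank ℝ S ≤ 2 := (finrank_span_finset_le_card _).trans Finset.card_le_two
    have hsum := S.finrank_add_finrank_orthogonal
    rw [finrank_euclideanSpace_fin] at hsum
    have hpos : 0 < Module.finrank ℝ Sᗮ := by omega
    have : Nontrivial Sᗮ := Module.finrank_pos_iff.1 hpos
    obtain ⟨v, hv⟩ := exists_ne (0 : Sᗮ)
    have hv0 : ‖(v : EuclideanSpace ℝ (Fin 3))‖ ≠ 0 := by
      rw [norm_ne_zero_iff]
      exact fun h => hv (Subtype.ext h)
    have hpS : (p : EuclideanSpace ℝ (Fin 3)) ∈ S := Submodule.subset_span (by simp)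
    have hqS : (q : EuclideanSpace ℝ (Fin 3)) ∈ S := Submodule.subset_span (by simp)
    refine ⟨(‖(v : EuclideanSpace ℝ (Fin 3))‖)⁻¹ • (v : EuclideanSpace ℝ (Fin 3)), ?_, ?_, ?_⟩
    · rw [norm_smul, norm_inv, norm_norm, inv_mul_cancel₀ hv0]
    · rw [real_inner_smul_left, real_inner_comm, v.2 _ hpS, mul_zero]
    · rw [real_inner_smul_left, real_inner_comm, v.2 _ hqS, mul_zero]
  obtain ⟨e, he⟩ := exists_orthonormalBasis ⟨n, mem_sphere_zero_iff_norm.2 hn⟩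
  have key : ∀ p : Sphere2, inner ℝ n (p : EuclideanSpace ℝ (Fin 3)) = 0 → ∃ P : Circle,
      (p : EuclideanSpace ℝ (Fin 3)) = (P : ℂ).re • e 0 + (P : ℂ).im • e 1 := by
    intro p hp
    have hn := norm_sq_eq_sum e p
    rw [norm_eq_of_mem_sphere, he, hp] at hn
    obtain ⟨P, h1, h2⟩ := exists_circle_of_sq
      (u := inner ℝ (e 0) (p : EuclideanSpace ℝ (Fin 3)))
      (v := inner ℝ (e 1) (p : EuclideanSpace ℝ (Fin 3))) (by linarith)
    refine ⟨P, eq_of_inner_basis e ?_ ?_ ?_⟩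
    · simp [inner_add_right, inner_smul_right, h1]
    · simp [inner_add_right, inner_smul_right, h2]
    · rw [he, hp, ← he]
      simp [inner_add_right, inner_smul_right]
  obtain ⟨P, hP⟩ := key p hpn
  obtain ⟨Q, hQ⟩ := key q hqn
  exact ⟨e, P, Q, hP, hQ⟩

end Hemisphere

/-! ### The truncated disc model -/

/-- The gauge of a disc truncated by two strips. -/
noncomputable def stripGauge (P Q : Circle) (t s : ℝ) (w : ℂ) : ℝ :=
  max ‖w‖ (max (|planeInner P w| / t) (|planeInner Q w| / s))

theorem planeInner_neg (P : Circle) (w : ℂ) : planeInner P (-w) = -planeInner P w := by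
  simp only [planeInner, Complex.neg_re, Complex.neg_im]
  ring

theorem planeInner_real_mul (P : Circle) (a : ℝ) (w : ℂ) :
    planeInner P (a * w) = a * planeInner P w := by
  simp only [planeInner, Complex.re_ofReal_mul, Complex.im_ofReal_mul]
  ring

theorem planeInner_planeRefl (P : Circle) (w : ℂ) :
    planeInner P (planeRefl P w) = -planeInner P w := by
  have h := circle_sq_add_sq P
  rw [planeInner, (planeRefl_eq P w).1, (planeRefl_eq P w).2]
  have : planeInner P w = (P : ℂ).re * w.re + (P : ℂ).im * w.im := rfl
  linear_combination (-2 * planeInner P w) * h - this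

theorem isGauge_stripGauge (P Q : Circle) {t s : ℝ} :
    IsGauge (stripGauge P Q t s) := by
  refine ⟨?_, ?_, ?_, ?_⟩
  · unfold stripGauge planeInner
    fun_prop
  · intro a w ha
    simp only [stripGauge, planeInner_real_mul, abs_mul, abs_of_nonneg ha, norm_mul,
      Complex.norm_real, Real.norm_of_nonneg ha]
    rw [mul_max_of_nonneg _ _ ha, mul_max_of_nonneg _ _ ha, mul_div_assoc, mul_div_assoc]
  · intro w hw
    exact lt_of_lt_of_le (norm_pos_iff.2 hw) (le_max_left _ _)
  · intro w
    simp only [stripGauge, norm_neg, planeInner_neg, abs_neg]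

theorem stripGauge_le_one_iff (P Q : Circle) {t s : ℝ} (ht : 0 < t) (hs : 0 < s) (w : ℂ) :
    stripGauge P Q t s w ≤ 1 ↔ ‖w‖ ≤ 1 ∧ |planeInner P w| ≤ t ∧ |planeInner Q w| ≤ s := by
  rw [stripGauge, max_le_iff, max_le_iff, div_le_one ht, div_le_one hs]

theorem stripGauge_swap (P Q : Circle) (t s : ℝ) : stripGauge P Q t s = stripGauge Q P s t := by
  ext w
  rw [stripGauge, stripGauge, max_comm (|planeInner P w| / t)]

/-- In the directions of the arc around ±P the strip of `P` cuts off the circle, while by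
disjointness the strip of `Q` does not, so the first strip alone determines the gauge. -/
theorem stripGauge_circle_of_le {P Q : Circle} {t s : ℝ} (h : IsAdmissible P Q t s) {z : Circle}
    (hz : t ≤ |circInner P z|) : stripGauge P Q t s z = |circInner P z| / t := by
  have h1 : 1 ≤ |circInner P z| / t := (one_le_div h.t_pos).2 hz
  have h2 : |planeInner Q z| / s ≤ 1 := (div_le_one h.s_pos).2 (h.disjoint z hz).le
  rw [stripGauge, Circle.norm_coe]
  refine le_antisymm (max_le h1 (max_le le_rfl (h2.trans h1))) ?_
  exact (le_max_left _ _).trans (le_max_right _ _)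

theorem IsAdmissible.symm {P Q : Circle} {t s : ℝ} (h : IsAdmissible P Q t s) :
    IsAdmissible Q P s t := by
  refine ⟨h.s_pos, h.s_lt_one, h.t_pos, h.t_lt_one, fun z hz => ?_⟩
  by_contra hcon
  exact (h.disjoint z (not_lt.1 hcon)).not_ge hz

theorem abs_planeInner_gaugePolar_eq_iff {P Q : Circle} {t s : ℝ} (h : IsAdmissible P Q t s)
    (z : Circle) (l : I) :
    |planeInner P (gaugePolar (stripGauge P Q t s) (z, l))| = t ↔ l = 1 ∧ t ≤ |circInner P z| := by
  have hg := isGauge_stripGauge P Q (t := t) (s := s)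
  have hd : 0 ≤ (l : ℝ) / stripGauge P Q t s z := div_nonneg l.2.1 (hg.circle_pos z).le
  rw [gaugePolar, planeInner_real_mul, abs_mul, abs_of_nonneg hd, ← div_eq_one_iff_eq h.t_pos.ne',
    mul_div_assoc, mul_div_eq_one_iff (hg.circle_pos z) l.2.1 l.2.2
      ((le_max_left _ _).trans (le_max_right _ _)), Icc.coe_eq_one]
  refine and_congr_right fun _ => ⟨fun hh => ?_, fun hh => ?_⟩
  · have h1 : 1 ≤ stripGauge P Q t s z := by
      rw [← Circle.norm_coe z]
      exact le_max_left _ _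
    rw [← hh] at h1
    exact (one_le_div h.t_pos).1 h1
  · exact (stripGauge_circle_of_le h hh).symm

theorem stripGauge_circRefl {P Q : Circle} {t s : ℝ} (h : IsAdmissible P Q t s) {z : Circle}
    (hz : t ≤ |circInner P z|) : stripGauge P Q t s (circRefl P z) = stripGauge P Q t s z := by
  have e : |circInner P (circRefl P z)| = |circInner P z| := by
    change |planeInner P (circRefl P z)| = |planeInner P z|
    rw [coe_circRefl, planeInner_planeRefl, abs_neg]
  rw [stripGauge_circle_of_le h hz, stripGauge_circle_of_le h (by rwa [e]), e]

/-- With a pole orthogonal to `p` and `q`, the region outside both shrunken caps projects to the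
unit disc truncated by two strips. Its circular arcs carry the antipodal map of the equator, and its
chords carry the cap reflections. -/
theorem exists_rp2_model {p q : Sphere2} {t t' s s' : ℝ} (ht0 : 0 < t) (htt : t < t')
    (ht1 : t' < 1) (hs0 : 0 < s) (hss : s < s') (hs1 : s' < 1)
    (hdisj : ∀ x, t ≤ absInner p x → absInner q x < s)
    {b₁ b₂ : OrthonormalBasis (Fin 3) ℝ (EuclideanSpace ℝ (Fin 3))} (hb₁ : b₁ 2 = p)
    (hb₂ : b₂ 2 = q) {Z : Type*} [TopologicalSpace Z] {Θ : RP2 → Z}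
    (hΘ : IsAntipodalQuotient ({x | absInner p x ≤ t'} ∩ {x | absInner q x ≤ s'})
      {fun z => capCyl b₁ t' t (z, 0), fun z => capCyl b₂ s' s (z, 0)} Θ) :
    ∃ (P Q : Circle) (G : Circle × I → Z), IsAdmissible P Q t' s' ∧ IsDiscModel P Q t' s' G := by
  obtain ⟨e, P, Q, hP, hQ⟩ := exists_common_plane p q
  have hcirc : ∀ z : Circle, ‖(z : ℂ)‖ ≤ 1 := fun z => (Circle.norm_coe z).le
  have hpw : ∀ w : ℂ, ‖w‖ ≤ 1 → absInner p (rp2Proj (hemiPt e w)) = |planeInner P w| :=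
    fun w hw => by rw [absInner_rp2Proj, inner_hemiPt hP hw]
  have hqw : ∀ w : ℂ, ‖w‖ ≤ 1 → absInner q (rp2Proj (hemiPt e w)) = |planeInner Q w| :=
    fun w hw => by rw [absInner_rp2Proj, inner_hemiPt hQ hw]
  have hadm : IsAdmissible P Q t' s' := by
    refine ⟨ht0.trans htt, ht1, hs0.trans hss, hs1, fun z hz => ?_⟩
    have h1 := hdisj (rp2Proj (hemiPt e z)) (by rw [hpw _ (hcirc z)]; exact htt.le.trans hz)
    rw [hqw _ (hcirc z)] at h1
    exact h1.trans hss
  have hg := isGauge_stripGauge P Q (t := t') (s := s')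
  have hK := stripGauge_le_one_iff P Q hadm.t_pos hadm.s_pos
  have hmem : ∀ w, stripGauge P Q t' s' w ≤ 1 →
      rp2Proj (hemiPt e w) ∈ {x | absInner p x ≤ t'} ∩ {x | absInner q x ≤ s'} := by
    intro w hw
    obtain ⟨h1, h2, h3⟩ := (hK w).1 hw
    rw [mem_inter_iff, mem_ofPred_eq, mem_ofPred_eq, hpw w h1, hqw w h1]
    exact ⟨h2, h3⟩
  refine ⟨P, Q, _, hadm, hg.isDiscModel (F := fun w => Θ (rp2Proj (hemiPt e w)))
    (A := fun w => ‖w‖ = 1) (P := fun w => |planeInner P w| = t')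
    (Q := fun w => |planeInner Q w| = s') ?_ ?_ ?_ (abs_planeInner_gaugePolar_eq_iff hadm) ?_
    (fun z hz => stripGauge_circRefl hadm hz) ?_ hadm ?_⟩
  · have hc := continuous_rp2Proj.comp (continuous_hemiPt e)
    exact hΘ.continuousOn.comp hc.continuousOn hmem
  · intro a
    obtain ⟨x, hx, rfl⟩ := hΘ.surj a
    obtain ⟨w, hw, rfl⟩ := exists_hemiPt e x
    rw [mem_inter_iff, mem_ofPred_eq, mem_ofPred_eq, hpw w hw, hqw w hw] at hx
    exact ⟨w, (hK w).2 ⟨hw, hx.1, hx.2⟩, rfl⟩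
  · intro z l
    have hd : 0 ≤ (l : ℝ) / stripGauge P Q t' s' z := div_nonneg l.2.1 (hg.circle_pos z).le
    have hz1 : 1 ≤ stripGauge P Q t' s' z := by
      rw [← Circle.norm_coe z]
      exact le_max_left _ _
    rw [gaugePolar, norm_mul, Complex.norm_real, Real.norm_of_nonneg hd, Circle.norm_coe,
      mul_div_eq_one_iff (hg.circle_pos z) l.2.1 l.2.2 hz1, Icc.coe_eq_one,
      ← hz1.ge_iff_eq, hK]
    exact and_congr_right fun _ => ⟨fun h => h.2, fun h => ⟨hcirc z, h⟩⟩
  · rw [stripGauge_swap]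
    exact abs_planeInner_gaugePolar_eq_iff hadm.symm
  · rw [stripGauge_swap]
    exact fun z hz => stripGauge_circRefl hadm.symm hz
  · intro w w' hw hw'
    obtain ⟨h1, h2, h3⟩ := (hK w).1 hw
    obtain ⟨h1', h2', h3'⟩ := (hK w').1 hw'
    refine (hΘ.eq_iff _ (hmem w hw) _ (hmem w' hw')).trans ?_
    simp only [mem_insert_iff, mem_singleton_iff, exists_eq_or_imp, exists_eq_left]
    have hXp := hemiPt_planeRefl hP h1
    rw [← hb₁] at hXp
    have hXq := hemiPt_planeRefl hQ h1
    rw [← hb₂] at hXq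
    rw [capCyl_antipodal_iff b₁ hadm.t_pos hadm.t_lt_one hXp,
      capCyl_antipodal_iff b₂ hadm.s_pos hadm.s_lt_one hXq, hb₁, hb₂, inner_hemiPt hP h1,
      inner_hemiPt hQ h1, rp2Proj_hemiPt_eq_iff e h1 h1',
      eq_comm (a := rp2Proj (hemiPt e w')), eq_comm (a := rp2Proj (hemiPt e w')),
      rp2Proj_hemiPt_eq_iff e (by rwa [norm_planeRefl]) h1',
      rp2Proj_hemiPt_eq_iff e (by rwa [norm_planeRefl]) h1', norm_planeRefl, norm_planeRefl]
    tauto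

/-! ### Disc models of the two connected sums -/

/-- The space `Z` is a closed disc with boundary points identified as in `IsDiscModel`. -/
def HasDiscModel (Z : Type*) [TopologicalSpace Z] : Prop :=
  ∃ (p q : Circle) (t s : ℝ) (G : Circle × I → Z), IsAdmissible p q t s ∧ IsDiscModel p q t s G

theorem HasDiscModel.of_homeomorph {Z Z' : Type*} [TopologicalSpace Z] [TopologicalSpace Z']
    (h : HasDiscModel Z) (φ : Z ≃ₜ Z') : HasDiscModel Z' := by
  obtain ⟨p, q, t, s, G, hadm, hG⟩ := h
  exact ⟨p, q, t, s, φ ∘ G, hadm, φ.continuous.comp hG.continuous,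
    φ.surjective.comp hG.surjective,
    fun z l z' l' => φ.injective.eq_iff.trans (hG.eq_iff z l z' l')⟩

section

variable {X Y X' : Type*} [TopologicalSpace X] [TopologicalSpace Y] [TopologicalSpace X']
  {D : Set X} {E : Set Y}

/-- The compatibility with `inl` is what allows a disc of the first summand to be followed into the
new sum. -/
theorem ConnectedSum.exists_congr_left (h : frontier D ≃ₜ frontier E) (φ : X ≃ₜ X') :
    ∃ (h' : frontier (φ '' D) ≃ₜ frontier E) (Φ : ConnectedSum D E h ≃ₜ ConnectedSum (φ '' D) E h'),
      ∀ (x : ((interior D)ᶜ : Set X)) (x' : ((interior (φ '' D))ᶜ : Set X')), φ x = x' →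
        Φ (inl D E h x) = inl _ _ h' x' := by
  have := ConnectedSum.exists_congr D E h φ (Homeomorph.refl Y)
  rwa [show (Homeomorph.refl Y : Y → Y) '' E = E by simp] at this

/-- Because the hypothesis covers every gluing map, the transported one never has to be computed. -/
theorem HasDiscModel.of_image (h : frontier D ≃ₜ frontier E) (φ : X ≃ₜ X')
    (H : ∀ h' : frontier (φ '' D) ≃ₜ frontier E, HasDiscModel (ConnectedSum (φ '' D) E h')) :
    HasDiscModel (ConnectedSum D E h) := by
  obtain ⟨h', Φ, -⟩ := ConnectedSum.exists_congr_left h φ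
  exact (H h').of_homeomorph Φ.symm

end

theorem hasDiscModel_torus {D : Set Torus} (hD : IsTameDisc IsRoundTorus D) {E : Set RP2}
    (hE : IsTameDisc IsRoundRP2 E) (h : frontier D ≃ₜ frontier E) :
    HasDiscModel (ConnectedSum D E h) := by
  obtain ⟨f, c, r, hr0, hr, hf⟩ := hD
  refine .of_image h f ?_
  rw [hf, image_closedBall_eq c hr0 hr]
  intro h'
  -- Any diamond radius strictly between `0` and `r` would do.
  have hρ : 0 < r / 2 := by linarith
  have hρr : r / 2 < r := by linarith
  obtain ⟨Θ, hΘ, -⟩ := exists_isAntipodalQuotient (isInnerCollar_torusCyl c hρ hρr hr) hE h'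
  rw [compl_union_range_torusCyl c hρ hρr hr] at hΘ
  obtain ⟨p, q, T, G, hadm, hG⟩ := exists_torus_model c hρ (by linarith) hρr hr hΘ
  exact ⟨p, q, T, T, G, hadm, hG⟩

theorem hasDiscModel_rp2_of_round {D₁ A : Set RP2} (hD₁ : IsRoundRP2 D₁) (hA : IsRoundRP2 A)
    (hAD : Disjoint A D₁) {D₂ : Set RP2} (hD₂ : IsTameDisc IsRoundRP2 D₂)
    (g₁ : frontier D₁ ≃ₜ frontier D₂) {D₃ : Set RP2} (hD₃ : IsTameDisc IsRoundRP2 D₃)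
    (g₂ : frontier (ConnectedSum.inl D₁ D₂ g₁ '' {x | (x : RP2) ∈ A}) ≃ₜ frontier D₃) :
    HasDiscModel (ConnectedSum (ConnectedSum.inl D₁ D₂ g₁ '' {x | (x : RP2) ∈ A}) D₃ g₂) := by
  obtain ⟨p, t, ht0, ht1, rfl⟩ := hD₁
  obtain ⟨q, s, hs0, hs1, rfl⟩ := hA
  revert g₁
  rw [image_cap_eq, image_cap_eq] at *
  intro g₁ g₂
  obtain ⟨b₁, hb₁⟩ := exists_orthonormalBasis p
  obtain ⟨b₂, hb₂⟩ := exists_orthonormalBasis q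
  -- The shrunken caps may have any heights strictly between the given ones and `1`.
  have htt : t < (t + 1) / 2 := by linarith
  have ht1' : (t + 1) / 2 < 1 := by linarith
  have hss : s < (s + 1) / 2 := by linarith
  have hs1' : (s + 1) / 2 < 1 := by linarith
  obtain ⟨Θ, hΘ⟩ := exists_isAntipodalQuotient_two
    (isClosed_le continuous_const (continuous_absInner p))
    (isClosed_le continuous_const (continuous_absInner q)) hAD
    (isInnerCollar_capCyl b₁ hb₁ ht0 htt ht1') (isInnerCollar_capCyl b₂ hb₂ hs0 hss hs1')
    hD₂ g₁ rfl hD₃ g₂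
  rw [compl_union_range_capCyl b₁ hb₁ ht0 htt ht1',
    compl_union_range_capCyl b₂ hb₂ hs0 hss hs1'] at hΘ
  obtain ⟨P, Q, G, hadm, hG⟩ := exists_rp2_model ht0 htt ht1' hs0 hss hs1'
    (fun x hx => not_le.1 fun hx' => disjoint_left.1 hAD hx' hx) hb₁ hb₂ hΘ
  exact ⟨P, Q, _, _, G, hadm, hG⟩

theorem hasDiscModel_rp2_of_isTamePair {D₁ A : Set RP2} (hA : IsTamePair IsRoundRP2 A D₁)
    {D₂ : Set RP2} (hD₂ : IsTameDisc IsRoundRP2 D₂) (g₁ : frontier D₁ ≃ₜ frontier D₂)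
    {D₃ : Set RP2} (hD₃ : IsTameDisc IsRoundRP2 D₃)
    (g₂ : frontier (ConnectedSum.inl D₁ D₂ g₁ '' {x | (x : RP2) ∈ A}) ≃ₜ frontier D₃) :
    HasDiscModel (ConnectedSum (ConnectedSum.inl D₁ D₂ g₁ '' {x | (x : RP2) ∈ A}) D₃ g₂) := by
  obtain ⟨hAD, f, hfA, hfD⟩ := hA
  obtain ⟨g, Φ, hΦ⟩ := ConnectedSum.exists_congr_left g₁ f
  refine .of_image g₂ Φ ?_
  have hint : ∀ x : RP2, f x ∈ (interior (f '' D₁))ᶜ ↔ x ∈ (interior D₁)ᶜ := fun x => by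
    rw [← f.image_interior, mem_compl_iff, mem_compl_iff, f.injective.mem_set_image]
  -- The single homeomorphism `f` makes `A` and `D₁` round together, so the induced map of sums
  -- takes the second disc to a round one as well.
  have himg : Φ '' (ConnectedSum.inl D₁ D₂ g₁ '' {x | (x : RP2) ∈ A}) =
      ConnectedSum.inl (f '' D₁) D₂ g '' {x | (x : RP2) ∈ f '' A} := by
    ext a
    constructor
    · rintro ⟨_, ⟨x, hx, rfl⟩, rfl⟩
      exact ⟨⟨f x, (hint x).2 x.2⟩, mem_image_of_mem f hx, (hΦ x ⟨f x, (hint x).2 x.2⟩ rfl).symm⟩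
    · rintro ⟨⟨_, hy⟩, ⟨x, hx, rfl⟩, rfl⟩
      exact ⟨_, ⟨⟨x, (hint x).1 hy⟩, hx, rfl⟩, hΦ ⟨x, (hint x).1 hy⟩ ⟨f x, hy⟩ rfl⟩
  rw [himg]
  exact fun g' => hasDiscModel_rp2_of_round hfD hfA
    ((disjoint_image_iff f.injective).2 hAD) hD₂ g hD₃ g'

theorem hasDiscModel_rp2 {D₁ D₂ : Set RP2} (hD₁ : IsTameDisc IsRoundRP2 D₁)
    (hD₂ : IsTameDisc IsRoundRP2 D₂) (g₁ : frontier D₁ ≃ₜ frontier D₂)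
    {F : Set (ConnectedSum D₁ D₂ g₁)}
    (hF : IsTameDisc (IsModelDiscSum IsRoundRP2 IsRoundRP2 D₁ D₂ g₁) F)
    {D₃ : Set RP2} (hD₃ : IsTameDisc IsRoundRP2 D₃) (g₂ : frontier F ≃ₜ frontier D₃) :
    HasDiscModel (ConnectedSum F D₃ g₂) := by
  obtain ⟨f, ⟨A, hA, hf⟩ | ⟨B, hB, hf⟩⟩ := hF
  · refine .of_image g₂ f ?_
    rw [hf]
    exact fun g => hasDiscModel_rp2_of_isTamePair hA hD₂ g₁ hD₃ g
  · refine .of_image g₂ f ?_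
    rw [hf]
    -- A disc in the second summand is reduced to the first case by exchanging the summands.
    refine fun g => .of_image g (ConnectedSum.swap D₁ D₂ g₁) ?_
    rw [image_image]
    exact fun g' => hasDiscModel_rp2_of_isTamePair hB hD₁ g₁.symm hD₃ g'

end Surfaces

/-- For all admissible choices of discs and gluing homeomorphisms, `T² # RP²` is homeomorphic
to `(RP² # RP²) # RP²`. -/
theorem proposition2p1
    -- the choices made for the connected sum of the torus and the projective plane
    (D : Set Surfaces.Torus) (hD : Surfaces.IsTameDisc Surfaces.IsRoundTorus D)
    (E : Set Surfaces.RP2) (hE : Surfaces.IsTameDisc Surfaces.IsRoundRP2 E)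
    (g : frontier D ≃ₜ frontier E)
    -- the choices made for the connected sum of two projective planes
    (D₁ : Set Surfaces.RP2) (hD₁ : Surfaces.IsTameDisc Surfaces.IsRoundRP2 D₁)
    (D₂ : Set Surfaces.RP2) (hD₂ : Surfaces.IsTameDisc Surfaces.IsRoundRP2 D₂)
    (g₁ : frontier D₁ ≃ₜ frontier D₂)
    -- the choices made for its connected sum with a third projective plane
    (F : Set (Surfaces.ConnectedSum D₁ D₂ g₁))
    (hF : Surfaces.IsTameDisc
      (Surfaces.IsModelDiscSum Surfaces.IsRoundRP2 Surfaces.IsRoundRP2 D₁ D₂ g₁) F)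
    (D₃ : Set Surfaces.RP2) (hD₃ : Surfaces.IsTameDisc Surfaces.IsRoundRP2 D₃)
    (g₂ : frontier F ≃ₜ frontier D₃) :
    Nonempty (Surfaces.ConnectedSum D E g ≃ₜ Surfaces.ConnectedSum F D₃ g₂) := by
  obtain ⟨p, q, t, s, G, hadm, hG⟩ := Surfaces.hasDiscModel_torus hD hE g
  obtain ⟨p', q', t', s', G', hadm', hG'⟩ := Surfaces.hasDiscModel_rp2 hD₁ hD₂ g₁ hF hD₃ g₂
  exact hG.nonempty_homeomorph hG' hadm hadm'
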